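/- Strings are over the alphabet $\{1,\dots,k\}$ and are ordered lexicographically; the weight of a string is the sum of its symbols. Let $\mathbf S_k(n,w^\uparrow)$ be the set of strings of length $n$ and weight at least $w$, and let $S_k(n,w^\uparrow)$ be its cardinality. A necklace is a string that is smallest among its rotations; the necklace of a string is its smallest rotation. The aperiodic prefix $\mathrm{ap}(\mathbf s)$ of $\mathbf s$ is the shortest $\mathbf t$ with $\mathbf s=\mathbf t^j$ for some $j\ge 1$. Let $\alpha_1<\dots<\alpha_m$ be the necklaces in $\mathbf S_k(n,w^\uparrow)$ and put $\mathcal G_k(n,w^\uparrow)=\mathrm{ap}(\alpha_1)\cdots\mathrm{ap}(\alpha_m)$. A universal cycle for a finite set $\mathbf S$ of strings is a cyclic sequence of length $|\mathbf S|$ in which every $\mathbf s\in\mathbf S$ occurs, read cyclically, from exactly one starting position; that position (counted from $1$) is the rank of $\mathbf s$. For a necklace $\alpha$ of length $n$ let $T_k(n,w,\alpha)$ be the number of strings in $\mathbf S_k(n,w^\uparrow)$ whose necklace is smaller than $\alpha$. **Theorem.** Let $n,k\ge 2$ and $0\le w<kn$. (1) $\mathcal G_k(n,w^\uparrow)$ is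 a universal cycle for $\mathbf S_k(n,w^\uparrow)$ (a bounded-weight de Bruijn sequence), and it is the lexicographically smallest one. (2) Let $\mathbf s\in\mathbf S_k(n,w^\uparrow)$ and let $a_1\cdots a_n=\alpha_1$ be the first necklace in $\mathbf S_k(n,w^\uparrow)$. If $\mathbf s=k^{n-j}a_1\cdots a_j$ with $0\le j<n$ (a string in the wraparound), then the rank of $\mathbf s$ in $\mathcal G_k(n,w^\uparrow)$ is $S_k(n,w^\uparrow)-(n-j)+1$. Otherwise write $\mathbf s=\mathbf p\mathbf q$, where $\mathbf q$ is the longest suffix of $\mathbf s$ such that $\mathbf q\mathbf p$ is a necklace. There is then exactly one pair $(\beta_1,\beta_2)$ of cyclically consecutive necklaces in the lexicographically ordered list of all necklaces of length $n$ over $\{1,\dots,k\}$ (with no weight restriction) such that $\mathbf p$ is a suffix of $\beta_1$ and $\mathbf q$ is a prefix of $\beta_2$, and the rank of $\mathbf s$ in $\mathcal G_k(n,w^\uparrow)$ is $T_k(n,w,\beta_2)-|\mathbf p|+1$. (3) The sequence can be ranked in $O(n^3k^2)$ time using $O(n^3k)$ space on a unit-cost RAM. Precisely, there are a single RAM program (instructions: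 load a constant, addition, truncated subtraction, multiplication, indirect load, indirect store, jump on zero; each costs one step) and a constant $C$ such that for all $n,k\ge2$, all $0\le w<kn$ and all $\mathbf s\in\mathbf S_k(n,w^\uparrow)$, the program started on the input $(n,k,w,\mathbf s)$ halts after at most $Cn^3k^2$ steps with the rank of $\mathbf s$ in $\mathcal G_k(n,w^\uparrow)$ as output, it accesses only registers with addresses below $Cn^3k$, and no register ever holds a number larger than $k^{Cn}$ (that is, words of $O(n\log k)$ bits suffice). -/

import Mathlib

namespace BoundedWeight

/-! ### Strings, necklaces and the bounded-weight sequence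

Strings are lists of natural numbers, compared by the lexicographic order `≤` of `List ℕ`.
The weight of a string `s` is `s.sum`. -/

/-- The set of all strings of length `n` over the alphabet `{1, …, k}` of weight at least `w`. -/
def strings (k n w : ℕ) : Finset (List ℕ) :=
  ((Fintype.piFinset fun _ : Fin n => Finset.Icc 1 k).image List.ofFn).filter fun s => w ≤ s.sum

theorem mem_strings {k n w : ℕ} {s : List ℕ} :
    s ∈ strings k n w ↔ s.length = n ∧ (∀ x ∈ s, 1 ≤ x ∧ x ≤ k) ∧ w ≤ s.sum := by
  unfold strings
  simp only [Finset.mem_filter, Finset.mem_image, Fintype.mem_piFinset, Finset.mem_Icc]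
  constructor
  · rintro ⟨⟨f, hf, rfl⟩, hw⟩
    refine ⟨List.length_ofFn, ?_, hw⟩
    intro x hx
    obtain ⟨i, rfl⟩ := (List.mem_ofFn' f x).1 hx
    exact hf i
  · rintro ⟨rfl, hs, hw⟩
    exact ⟨⟨s.get, fun i => hs _ (List.get_mem s i), List.ofFn_get s⟩, hw⟩

/-- The lexicographically smallest rotation of a string. -/
def neck (s : List ℕ) : List ℕ :=
  s.cyclicPermutations.foldr min s

/-- A necklace is a string that is lexicographically smallest among its rotations. -/
def IsNecklace (s : List ℕ) : Prop :=
  ∀ t ∈ s.cyclicPermutations, s ≤ t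

instance : DecidablePred IsNecklace := fun s =>
  inferInstanceAs (Decidable (∀ t ∈ s.cyclicPermutations, s ≤ t))

/-- The tuple of all necklaces of length `n` over `{1, …, k}` of weight at least `w`,
in lexicographic order. For `w = 0` these are all necklaces of length `n`. -/
def necklaces (k n w : ℕ) : List (List ℕ) :=
  ((strings k n w).filter IsNecklace).sort (· ≤ ·)

/-- The aperiodic prefix: the shortest prefix `t` of `s` with `s = t ^ j` for some `j ≥ 1`. -/
noncomputable def ap (s : List ℕ) : List ℕ :=
  s.take (sInf {d | ∃ j, 1 ≤ j ∧ s = (List.replicate j (s.take d)).flatten})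

/-- The concatenation, in lexicographic order, of the aperiodic prefixes of all necklaces of
length `n` over `{1, …, k}` of weight at least `w`. -/
noncomputable def granddaddy (k n w : ℕ) : List ℕ :=
  ((necklaces k n w).map ap).flatten

/-- The string `s` has rank `r` in the cyclic sequence `U`: reading `U` cyclically from its
`r`-th symbol (the first symbol being number 1) one finds `s`. -/
def HasRank (U s : List ℕ) (r : ℕ) : Prop :=
  1 ≤ r ∧ r ≤ U.length ∧ ∀ i < s.length, U[(r - 1 + i) % U.length]? = s[i]?

/-- A universal cycle for `S`: a cyclic sequence of length `|S|` that contains each element of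
`S` exactly once. -/
def IsUniversalCycle (S : Finset (List ℕ)) (U : List ℕ) : Prop :=
  U.length = S.card ∧ ∀ s ∈ S, ∃! r, HasRank U s r

/-- The number of strings of length `n` over `{1, …, k}` of weight at least `w` whose necklace is
lexicographically smaller than `α`. -/
def smallerCount (k n w : ℕ) (α : List ℕ) : ℕ :=
  ((strings k n w).filter fun s => neck s < α).card

/-- The smallest `i` such that, writing `s = p q` with `|p| = i`, the string `q p` is a necklace.
Thus `q` is the longest suffix of `s` with this property. -/
noncomputable def splitIndex (s : List ℕ) : ℕ :=
  sInf {i | i ≤ s.length ∧ IsNecklace (s.drop i ++ s.take i)}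

/-- The part `p` of `s = p q`, where `q` is the longest suffix such that `q p` is a necklace. -/
noncomputable def pPart (s : List ℕ) : List ℕ := s.take (splitIndex s)

/-- The part `q` of `s = p q`, where `q` is the longest suffix such that `q p` is a necklace. -/
noncomputable def qPart (s : List ℕ) : List ℕ := s.drop (splitIndex s)

/-- `β₁` and `β₂` are cyclically consecutive in the list of all necklaces of length `n` over
`{1, …, k}`, the string `p` is a suffix of `β₁`, and `q` is a prefix of `β₂`. -/
def IsGranddaddyPair (k n : ℕ) (s β₁ β₂ : List ℕ) : Prop :=
  (∃ i < (necklaces k n 0).length, (necklaces k n 0)[i]? = some β₁ ∧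
    (necklaces k n 0)[(i + 1) % (necklaces k n 0).length]? = some β₂) ∧
  pPart s <:+ β₁ ∧ qPart s <+: β₂

/-- `s = k^{n-j} a₁ ⋯ a_j`, where `a₁ ⋯ a_n` is the first necklace of weight at least `w`. -/
def IsWraparound (k n w : ℕ) (s : List ℕ) (j : ℕ) : Prop :=
  j < n ∧ ∃ α, (necklaces k n w).head? = some α ∧ s = List.replicate (n - j) k ++ α.take j

/-! ### The unit-cost random access machine -/

/-- Instructions of a random access machine whose registers hold natural numbers and are
numbered by natural numbers. -/
inductive Instr where
  /-- `R[d] := c` -/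
  | const (d c : ℕ)
  /-- `R[d] := R[a] + R[b]` -/
  | add (d a b : ℕ)
  /-- `R[d] := max (R[a] - R[b]) 0` -/
  | sub (d a b : ℕ)
  /-- `R[d] := R[a] * R[b]` -/
  | mul (d a b : ℕ)
  /-- `R[d] := R[R[a]]` -/
  | load (d a : ℕ)
  /-- `R[R[a]] := R[b]` -/
  | store (a b : ℕ)
  /-- continue with instruction number `l` if `R[a] = 0`, otherwise with the next one -/
  | jumpZero (a l : ℕ)

/-- A configuration: the program counter and the contents of the registers. -/
structure Config where
  pc : ℕ
  reg : ℕ → ℕ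

/-- The effect of one instruction. -/
def Instr.exec (c : Config) : Instr → Config
  | .const d v => ⟨c.pc + 1, Function.update c.reg d v⟩
  | .add d a b => ⟨c.pc + 1, Function.update c.reg d (c.reg a + c.reg b)⟩
  | .sub d a b => ⟨c.pc + 1, Function.update c.reg d (c.reg a - c.reg b)⟩
  | .mul d a b => ⟨c.pc + 1, Function.update c.reg d (c.reg a * c.reg b)⟩
  | .load d a => ⟨c.pc + 1, Function.update c.reg d (c.reg (c.reg a))⟩
  | .store a b => ⟨c.pc + 1, Function.update c.reg (c.reg a) (c.reg b)⟩
  | .jumpZero a l => ⟨if c.reg a = 0 then l else c.pc + 1, c.reg⟩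

/-- The registers read or written by one instruction. -/
def Instr.touched (c : Config) : Instr → Finset ℕ
  | .const d _ => {d}
  | .add d a b => {d, a, b}
  | .sub d a b => {d, a, b}
  | .mul d a b => {d, a, b}
  | .load d a => {d, a, c.reg a}
  | .store a b => {a, c.reg a, b}
  | .jumpZero a _ => {a}

/-- A program is a list of instructions. The machine has halted when the program counter does not
point to an instruction. -/
def halted (P : List Instr) (c : Config) : Prop := P[c.pc]? = none

/-- One step of the machine; a halted machine stays as it is. -/
def step (P : List Instr) (c : Config) : Config :=
  match P[c.pc]? with
  | none => c
  | some I => I.exec c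

/-- The registers read or written in the next step. -/
def touched (P : List Instr) (c : Config) : Finset ℕ :=
  match P[c.pc]? with
  | none => ∅
  | some I => I.touched c

/-- The configuration after `t` steps, starting at instruction number 0 with registers `m`. -/
def run (P : List Instr) (m : ℕ → ℕ) (t : ℕ) : Config := (step P)^[t] ⟨0, m⟩

/-- Started with registers `m`, the program `P` halts after at most `time` steps (each instruction
costs one step) with `r` in register 0. Up to then it uses only registers with numbers below
`space`, and every register always holds a number at most `word`. -/
def Computes (P : List Instr) (m : ℕ → ℕ) (r time space word : ℕ) : Prop :=
  ∃ t ≤ time, halted P (run P m t) ∧ (run P m t).reg 0 = r ∧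
    (∀ i < t, ∀ a ∈ touched P (run P m i), a < space) ∧
    (∀ i ≤ t, ∀ a, (run P m i).reg a ≤ word)

/-- The initial registers: `n, k, w` in registers 0, 1, 2, the symbols of `s` in the registers
from number 3 on, and 0 in all others. -/
def input (k n w : ℕ) (s : List ℕ) (a : ℕ) : ℕ := (n :: k :: w :: s).getD a 0

end BoundedWeight

namespace BoundedWeight

/-! ### Comparing strings digit by digit -/

/-! Rotation preserves weight, so the strings split into rotation classes, and the class of a
necklace `α` has `|ap α|` members (`card_filter_neck_eq`). Hence `granddaddy` has the required
length, and it remains to locate every string in it. The main tool is `strictNeck_bump`: raising one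
symbol in a prefix of a necklace and filling up with `k` gives a necklace again, and its weight has
not dropped. Consequently neighbouring necklaces in the bounded-weight list share long prefixes, and
every necklace except `k^n` can be read from the place where its aperiodic prefix starts
(`prefix_flatten_ap`).

Write `s = pq` with `qp` the necklace of `s`. The downward closed predicate `Low` cuts the sorted
list of necklaces in two so that the first necklace after the cut begins with `q`
(`qPart_prefix_of_least`) and the aperiodic prefix of the last one before it ends with `p`
(`pPart_suffix_of_greatest`). So `s` straddles the cut, and its rank is the number of strings with a
`Low` necklace, minus `|p|`, plus 1 (`hasRank_lowCount`). If no necklace is `Low` and `p` is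
nonempty, then `p` is a power of `k` and `s` is read across the end of the sequence, which ends with
`k^n`. Since all strings occur and there are as many positions as strings, each occurs once. The
same cut in the list of all necklaces gives the pair `(β₁, β₂)`, and `u < β₂` means exactly that `u`
is `Low` (`IsGranddaddyPair.lt_iff_low`).

Minimality (`granddaddy_le`): if a universal cycle `U` were smaller, the window ending at the first
difference would be a string that `granddaddy` has not read yet, although it differs from its own
window by a smaller last symbol. By the order in which strings occur this forces the window of `U`
into the wraparound, `k^i a₁ ⋯ a_j`. Each following symbol of `U` must then continue `a₁ ⋯ a_n`: a
smaller one gives a string below the first necklace, a larger one a string that was read before. So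
`U` contains the first necklace twice.

For the algorithm, `lowCount` is the total number of strings minus the number of strings all of
whose rotations exceed a threshold `x`. The threshold is the necklace of `s`, or, if `p` is a power
of `k`, a string obtained by lowering the last symbol of the Lyndon period of `q`
(`lowered_lt_iff`). Cutting a string where it first exceeds `x` gives a recursion over length and
weight (`card_exceeding`), and the cyclic count is a weighted sum of table entries
(`card_cyclic_exceeding`). The table has `O(nw)` entries at `O(nk)` steps each, and `w < kn`. The
recursion is written in a small structured language whose compilation to the machine is proved
correct (`Ex.sim`), with a program logic `Tri` that tracks time, addresses and word sizes. -/

theorem eqOn_or_first_ne (f g : ℕ → ℕ) (n : ℕ) :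
    (∀ e < n, f e = g e) ∨ ∃ d < n, (∀ e < d, f e = g e) ∧ f d ≠ g d := by
  by_cases h : ∃ d, d < n ∧ f d ≠ g d
  · right
    classical
    refine ⟨Nat.find h, (Nat.find_spec h).1, fun e he => ?_, (Nat.find_spec h).2⟩
    by_contra hne
    exact Nat.find_min h he ⟨he.trans (Nat.find_spec h).1, hne⟩
  · left
    push Not at h
    exact h

/-- Since `t` is not longer than `s`, the string `s` cannot be a proper prefix of `t`, so the
comparison is decided at a position inside both strings and the default value 0 is never used. -/
theorem lt_iff_getD {s t : List ℕ} (h : t.length ≤ s.length) :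
    s < t ↔ ∃ d < t.length, (∀ e < d, s.getD e 0 = t.getD e 0) ∧ s.getD d 0 < t.getD d 0 := by
  rw [List.lt_iff_exists]
  constructor
  · rintro (⟨-, h2⟩ | ⟨i, h1, h2, h3, h4⟩)
    · omega
    · refine ⟨i, h2, fun e he => ?_, ?_⟩
      · rw [List.getD_eq_getElem _ _ (he.trans h1), List.getD_eq_getElem _ _ (he.trans h2)]
        exact h3 e he
      · rwa [List.getD_eq_getElem _ _ h1, List.getD_eq_getElem _ _ h2]
  · rintro ⟨d, hd, h1, h2⟩
    right
    refine ⟨d, by omega, hd, fun e he => ?_, ?_⟩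
    · have := h1 e he
      rwa [List.getD_eq_getElem _ _ (by omega), List.getD_eq_getElem _ _ (by omega)] at this
    · rwa [List.getD_eq_getElem _ _ (by omega), List.getD_eq_getElem _ _ (by omega)] at h2

theorem prefix_iff_getD {s t : List ℕ} :
    s <+: t ↔ s.length ≤ t.length ∧ ∀ e < s.length, s.getD e 0 = t.getD e 0 := by
  constructor
  · rintro ⟨r, rfl⟩
    refine ⟨by simp, fun e he => ?_⟩
    rw [List.getD_append _ _ _ _ he]
  · rintro ⟨h1, h2⟩
    rw [List.prefix_iff_eq_take]
    apply List.ext_getElem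
    · simp [h1]
    · intro i hi hi'
      have := h2 i hi
      rw [List.getD_eq_getElem _ _ hi, List.getD_eq_getElem _ _ (by omega)] at this
      simpa using this

theorem eq_of_getD {s t : List ℕ} (h : s.length = t.length)
    (h' : ∀ e < s.length, s.getD e 0 = t.getD e 0) : s = t :=
  (prefix_iff_getD.2 ⟨h.le, h'⟩).eq_of_length h

theorem prefix_le {p s : List ℕ} (h : p <+: s) : p ≤ s := by
  by_contra! hlt
  obtain ⟨h1, h2⟩ := prefix_iff_getD.1 h
  obtain ⟨d, hd, -, h3⟩ := (lt_iff_getD h1).1 hlt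
  rw [h2 d hd] at h3
  exact lt_irrefl _ h3

/-- A string squeezed between a prefix and an extension of it has that prefix. -/
theorem prefix_of_le_of_le {p u z : List ℕ} (hp : p <+: z) (hu : u.length = z.length)
    (h1 : p ≤ u) (h2 : u ≤ z) : p <+: u := by
  obtain ⟨h3, h4⟩ := prefix_iff_getD.1 hp
  rw [prefix_iff_getD]
  refine ⟨by omega, ?_⟩
  rcases eqOn_or_first_ne (fun e => p.getD e 0) (fun e => u.getD e 0) p.length with h | ⟨d, hd, he, hne⟩
  · exact h
  · exfalso
    rcases lt_or_gt_of_ne hne with h | h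
    · refine absurd h2 (not_le.2 ((lt_iff_getD hu.le).2 ⟨d, by omega, fun e hed => ?_, ?_⟩))
      · rw [← h4 e (by omega)]; exact he e hed
      · rw [← h4 d hd]; exact h
    · refine absurd h1 (not_le.2 ((lt_iff_getD (by omega)).2 ⟨d, hd, fun e hed => ?_, h⟩))
      exact (he e hed).symm

/-! ### The periodic extension of a string -/

/-- The symbols of the infinite repetition of `s`. -/
def ext (s : List ℕ) (i : ℕ) : ℕ := s.getD (i % s.length) 0

theorem ext_of_lt {s : List ℕ} {i : ℕ} (h : i < s.length) : ext s i = s.getD i 0 := by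
  rw [ext, Nat.mod_eq_of_lt h]

theorem ext_mod (s : List ℕ) (i : ℕ) : ext s (i % s.length) = ext s i := by
  rw [ext, ext, Nat.mod_mod]

theorem ext_add_length (s : List ℕ) (i : ℕ) : ext s (i + s.length) = ext s i := by
  rw [ext, ext, Nat.add_mod_right]

theorem ext_mem {s : List ℕ} (h : s ≠ []) (i : ℕ) : ext s i ∈ s := by
  have := List.length_pos_of_ne_nil h
  rw [ext, List.getD_eq_getElem _ _ (Nat.mod_lt _ this)]
  exact List.getElem_mem _

/-- Turns rotation into a shift of the argument, so that statements about rotations need no case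
distinction at the end of the string. -/
theorem ext_rotate (s : List ℕ) (j i : ℕ) : ext (s.rotate j) i = ext s (i + j) := by
  rcases eq_or_ne s [] with rfl | h
  · simp [ext]
  have hs := List.length_pos_of_ne_nil h
  have h1 : i % s.length < (s.rotate j).length := by
    rw [List.length_rotate]; exact Nat.mod_lt _ hs
  rw [ext, ext, List.length_rotate, List.getD_eq_getElem _ _ h1, List.getElem_rotate,
    List.getD_eq_getElem _ _ (Nat.mod_lt _ hs)]
  congr 1
  rw [Nat.mod_add_mod]

theorem eq_of_ext {s t : List ℕ} (h : s.length = t.length)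
    (h' : ∀ e < s.length, ext s e = ext t e) : s = t :=
  eq_of_getD h fun e he => by rw [← ext_of_lt he, ← ext_of_lt (h ▸ he), h' e he]

theorem lt_iff_ext {s t : List ℕ} (h : s.length = t.length) :
    s < t ↔ ∃ d < s.length, (∀ e < d, ext s e = ext t e) ∧ ext s d < ext t d := by
  rw [lt_iff_getD h.ge, ← h]
  refine exists_congr fun d => and_congr_right fun hd => ?_
  rw [ext_of_lt hd, ext_of_lt (h ▸ hd)]
  refine and_congr_left' (forall₂_congr fun e he => ?_)
  rw [ext_of_lt (he.trans hd), ext_of_lt (h ▸ (he.trans hd))]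

/-- The string of length `n` with symbols `f 0, …, f (n - 1)`. -/
def word (n : ℕ) (f : ℕ → ℕ) : List ℕ := (List.range n).map f

@[simp] theorem length_word (n : ℕ) (f : ℕ → ℕ) : (word n f).length = n := by simp [word]

theorem getD_word {n i : ℕ} (f : ℕ → ℕ) (h : i < n) : (word n f).getD i 0 = f i := by
  rw [List.getD_eq_getElem _ _ (by simpa using h)]
  simp [word]

theorem ext_word {n i : ℕ} (f : ℕ → ℕ) (h : i < n) : ext (word n f) i = f i := by
  rw [ext_of_lt (by simpa using h), getD_word f h]

theorem mem_word {n : ℕ} {f : ℕ → ℕ} {a : ℕ} : a ∈ word n f ↔ ∃ i < n, f i = a := by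
  simp [word]

/-! ### Necklaces -/

/-- No shift of `f` is smaller than `f`. -/
def Neck (f : ℕ → ℕ) : Prop := ∀ i d, (∀ e < d, f (i + e) = f e) → f d ≤ f (i + d)

/-- Every suffix of `f 0, …, f (n - 1)` is at least the prefix of the same length. -/
def PreNeck (n : ℕ) (f : ℕ → ℕ) : Prop :=
  ∀ i d, i + d < n → (∀ e < d, f (i + e) = f e) → f d ≤ f (i + d)

theorem Neck.preNeck {f : ℕ → ℕ} (h : Neck f) (n : ℕ) : PreNeck n f := fun i d _ => h i d

theorem PreNeck.mono {f : ℕ → ℕ} {m n : ℕ} (h : PreNeck n f) (hmn : m ≤ n) : PreNeck m f :=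
  fun i d hid => h i d (hid.trans_le hmn)

theorem PreNeck.congr {f g : ℕ → ℕ} {n : ℕ} (h : PreNeck n f) (hfg : ∀ e < n, f e = g e) :
    PreNeck n g := by
  intro i d hid he
  rw [← hfg d (by omega), ← hfg _ hid]
  refine h i d hid fun e hed => ?_
  rw [hfg _ (by omega), hfg _ (by omega), he e hed]

theorem isNecklace_iff_rotate {s : List ℕ} : IsNecklace s ↔ ∀ i, s ≤ s.rotate i := by
  simp only [IsNecklace, List.mem_cyclicPermutations_iff]
  constructor
  · exact fun h i => h _ (List.IsRotated.symm ⟨i, rfl⟩)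
  · rintro h t ht
    obtain ⟨i, rfl⟩ := ht.symm
    exact h i

/-- Links the order on rotations to the symbolwise predicate `Neck`, which passes directly to
prefixes. -/
theorem isNecklace_iff {s : List ℕ} : IsNecklace s ↔ Neck (ext s) := by
  rw [isNecklace_iff_rotate]
  rcases eq_or_ne s [] with rfl | hne
  · simp [Neck, ext]
  have hs := List.length_pos_of_ne_nil hne
  constructor
  · intro h i d he
    by_contra! hlt
    rcases lt_or_ge d s.length with hd | hd
    · refine absurd (h i) (not_le.2 ((lt_iff_ext (by simp)).2 ⟨d, by simpa using hd, fun e hed => ?_, ?_⟩))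
      · rw [ext_rotate, add_comm, he e hed]
      · rwa [ext_rotate, add_comm]
    -- Both sequences have period `s.length`, so if they agree below `d ≥ s.length`, they already
    -- agree at `d`.
    · have h1 : d % s.length < d := (Nat.mod_lt _ hs).trans_le hd
      have h2 := he _ h1
      rw [ext_mod] at h2
      rw [← h2, ext, ext, Nat.add_mod_mod] at hlt
      exact lt_irrefl _ hlt
  · intro h i
    by_contra! hlt
    obtain ⟨d, hd, he, hlt⟩ := (lt_iff_ext (by simp)).1 hlt
    rw [ext_rotate, add_comm] at hlt
    refine absurd (h i d fun e hed => ?_) (not_le.2 hlt)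
    rw [← he e hed, ext_rotate, add_comm]

/-- Every proper shift of `f 0, …, f (n - 1)` gets larger than `f` before its end. -/
def StrictNeck (n : ℕ) (f : ℕ → ℕ) : Prop :=
  ∀ i, 1 ≤ i → i < n → ∃ d, i + d < n ∧ (∀ e < d, f (i + e) = f e) ∧ f d < f (i + d)

theorem StrictNeck.lt_rotate {s : List ℕ} (h : StrictNeck s.length (ext s)) {i : ℕ} (h1 : 1 ≤ i)
    (h2 : i < s.length) : s < s.rotate i := by
  obtain ⟨d, hd, he, hlt⟩ := h i h1 h2
  refine (lt_iff_ext (by simp)).2 ⟨d, by omega, fun e hed => ?_, ?_⟩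
  · rw [ext_rotate, add_comm, he e hed]
  · rwa [ext_rotate, add_comm]

theorem StrictNeck.isNecklace {s : List ℕ} (h : StrictNeck s.length (ext s)) : IsNecklace s := by
  rw [isNecklace_iff_rotate]
  intro i
  rcases eq_or_ne s [] with rfl | hne
  · simp
  have hs := List.length_pos_of_ne_nil hne
  rw [← List.rotate_mod]
  rcases Nat.eq_zero_or_pos (i % s.length) with h0 | h0
  · simp [h0]
  · exact (h.lt_rotate h0 (Nat.mod_lt _ hs)).le

/-- Increasing a symbol of a prenecklace and filling up with the largest symbol
gives an aperiodic necklace, unless all symbols are the largest one. -/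
theorem strictNeck_bump {n k d : ℕ} {a x : ℕ → ℕ} (hd : d < n) (ha : PreNeck (d + 1) a)
    (hx : ∀ e < d, x e = a e) (hlt : a d < x d) (hk : ∀ e, d < e → e < n → x e = k)
    (hle : ∀ e < n, x e ≤ k) : (∀ e < n, x e = k) ∨ StrictNeck n x := by
  rcases eq_or_ne (x 0) k with h0 | h0
  · left
    rcases Nat.eq_zero_or_pos d with rfl | hd0
    · intro e he
      rcases Nat.eq_zero_or_pos e with rfl | he0
      · exact h0
      · exact hk e he0 he
    · exfalso
      -- The prenecklace condition gives `a 0 ≤ a d < x d ≤ k`, so with `d > 0` the first symbol is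
      -- not `k`.
      have h1 := ha d 0 (by omega) (by simp)
      have h2 := hle d hd
      rw [← hx 0 hd0, h0, add_zero] at h1
      omega
  · right
    have h0' : x 0 < k := lt_of_le_of_ne (hle 0 (by omega)) h0
    intro i hi hin
    rcases lt_or_ge d i with hdi | hdi
    · exact ⟨0, by omega, by simp, by simpa [hk i hdi hin] using h0'⟩
    -- The suffix of `a` at `i` either outgrows `a` before position `d`, untouched by the change, or
    -- matches `a` up to position `d`, where the raised symbol makes it strictly larger.
    · rcases eqOn_or_first_ne (fun e => a (i + e)) a (d - i) with h | ⟨c, hc, he, hne⟩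
      · refine ⟨d - i, by omega, fun e he => ?_, ?_⟩
        · rw [hx _ (by omega), hx _ (by omega)]; exact h e he
        · have := ha i (d - i) (by omega) h
          rw [hx _ (by omega)]
          have e1 : i + (d - i) = d := by omega
          rw [e1] at this ⊢
          omega
      · refine ⟨c, by omega, fun e hec => ?_, ?_⟩
        · rw [hx _ (by omega), hx _ (by omega)]; exact he e hec
        · have := ha i c (by omega) he
          rw [hx _ (by omega), hx _ (by omega)]
          exact lt_of_le_of_ne this (Ne.symm hne)

/-! ### The necklace of a string -/

theorem foldr_min_mem (l : List (List ℕ)) (s : List ℕ) : l.foldr min s = s ∨ l.foldr min s ∈ l := by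
  induction l with
  | nil => simp
  | cons a l ih =>
    rw [List.foldr_cons, List.mem_cons]
    rcases min_choice a (l.foldr min s) with h | h
    · exact Or.inr (Or.inl h)
    · rw [h]; tauto

theorem foldr_min_le {l : List (List ℕ)} {s t : List ℕ} (h : t ∈ l) : l.foldr min s ≤ t := by
  induction l with
  | nil => simp at h
  | cons a l ih =>
    rw [List.foldr_cons]
    rcases List.mem_cons.1 h with rfl | h
    · exact min_le_left _ _
    · exact (min_le_right _ _).trans (ih h)

theorem neck_isRotated (s : List ℕ) : neck s ~r s := by
  rcases foldr_min_mem s.cyclicPermutations s with h | h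
  · rw [neck, h]
  · exact List.mem_cyclicPermutations_iff.1 h

theorem neck_le {s t : List ℕ} (h : t ~r s) : neck s ≤ t :=
  foldr_min_le (List.mem_cyclicPermutations_iff.2 h)

theorem isNecklace_neck (s : List ℕ) : IsNecklace (neck s) := fun _ ht =>
  neck_le ((List.mem_cyclicPermutations_iff.1 ht).trans (neck_isRotated s))

theorem neck_eq_of_isRotated {s α : List ℕ} (hα : IsNecklace α) (h : s ~r α) : neck s = α :=
  le_antisymm (neck_le h.symm) (hα _ (List.mem_cyclicPermutations_iff.2 ((neck_isRotated s).trans h)))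

theorem neck_eq_iff {s α : List ℕ} (hα : IsNecklace α) : neck s = α ↔ s ~r α :=
  ⟨fun h => h ▸ (neck_isRotated s).symm, neck_eq_of_isRotated hα⟩

theorem mem_strings_of_isRotated {k n w : ℕ} {s t : List ℕ} (h : s ~r t) (ht : t ∈ strings k n w) :
    s ∈ strings k n w := by
  rw [mem_strings] at ht ⊢
  refine ⟨h.perm.length_eq.trans ht.1, fun x hx => ht.2.1 x (h.mem_iff.1 hx), ?_⟩
  rw [h.perm.sum_eq]; exact ht.2.2

theorem neck_mem_strings {k n w : ℕ} {s : List ℕ} (hs : s ∈ strings k n w) :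
    neck s ∈ strings k n w := mem_strings_of_isRotated (neck_isRotated s) hs

/-! ### The aperiodic prefix -/

theorem iterate_rotate_one (s : List ℕ) (i : ℕ) :
    (fun l : List ℕ => l.rotate 1)^[i] s = s.rotate i := by
  induction i with
  | zero => simp
  | succ i ih => rw [Function.iterate_succ_apply', ih, List.rotate_rotate]

theorem isPeriodicPt_rotate_iff {s : List ℕ} {i : ℕ} :
    Function.IsPeriodicPt (fun l : List ℕ => l.rotate 1) i s ↔ s.rotate i = s := by
  rw [Function.IsPeriodicPt, Function.IsFixedPt, iterate_rotate_one]

/-- A word that commutes with `v` and is at least as long starts with `v`; removing this copy leaves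
a commuting word. -/
theorem eq_flatten_replicate_of_comm {v : List ℕ} (m : ℕ) : ∀ r : List ℕ, r.length = m * v.length →
    r ++ v = v ++ r → r = (List.replicate m v).flatten := by
  induction m with
  | zero => intro r hr _; simpa using hr
  | succ m ih =>
    intro r hr hc
    have hle : v.length ≤ r.length := by rw [hr]; nlinarith
    have hp : v <+: r := List.prefix_of_prefix_length_le (List.prefix_append v r)
      (hc ▸ List.prefix_append r v) hle
    obtain ⟨r', rfl⟩ := hp
    rw [List.replicate_succ, List.flatten_cons, ← ih r' ?_ ?_]
    · rw [List.length_append] at hr; linarith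
    · simpa [List.append_assoc] using hc

theorem rotate_eq_iff_flatten {s : List ℕ} {d : ℕ} (hd : 0 < d) (hds : d ≤ s.length) (hdvd : d ∣ s.length) :
    s.rotate d = s → ∃ j, 1 ≤ j ∧ s = (List.replicate j (s.take d)).flatten := by
  intro h
  obtain ⟨j, hj⟩ := hdvd
  rw [List.rotate_eq_drop_append_take hds] at h
  have hv : (s.take d).length = d := by simp [hds]
  obtain ⟨m, rfl⟩ : ∃ m, j = m + 1 := by
    refine ⟨j - 1, ?_⟩
    rcases Nat.eq_zero_or_pos j with rfl | h0
    · omega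
    · omega
  refine ⟨m + 1, by omega, ?_⟩
  have h2 := eq_flatten_replicate_of_comm (v := s.take d) m (s.drop d)
    (by rw [hv, List.length_drop, hj, mul_add, mul_one, Nat.add_sub_cancel, mul_comm])
    (by rw [h, List.take_append_drop])
  rw [List.replicate_succ, List.flatten_cons, ← h2, List.take_append_drop]

theorem rotate_flatten_replicate (v : List ℕ) (j : ℕ) :
    ((List.replicate j v).flatten).rotate v.length = (List.replicate j v).flatten := by
  rcases j with _ | j
  · simp
  · conv_lhs => rw [List.replicate_succ, List.flatten_cons, List.rotate_append_length_eq]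
    rw [List.replicate_succ', List.flatten_concat]

/-- A prefix length `d` dividing the length gives a power decomposition exactly when rotation by `d`
fixes `s`. So the infimum in `ap` is the minimal period of `s` under rotation by one, and the facts
about minimal periods apply. -/
theorem ap_spec {s : List ℕ} (hs : s ≠ []) :
    (ap s).length = Function.minimalPeriod (fun l : List ℕ => l.rotate 1) s ∧
    ∃ j, 1 ≤ j ∧ s = (List.replicate j (ap s)).flatten := by
  have hn := List.length_pos_of_ne_nil hs
  set m := Function.minimalPeriod (fun l : List ℕ => l.rotate 1) s with hm
  have hper : Function.IsPeriodicPt (fun l : List ℕ => l.rotate 1) s.length s :=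
    isPeriodicPt_rotate_iff.2 (List.rotate_length s)
  have hm0 : 0 < m := hper.minimalPeriod_pos hn
  have hmd : m ∣ s.length := hper.minimalPeriod_dvd
  have hmn : m ≤ s.length := Nat.le_of_dvd hn hmd
  set D := {d | ∃ j, 1 ≤ j ∧ s = (List.replicate j (s.take d)).flatten} with hD
  have hmem : m ∈ D := rotate_eq_iff_flatten hm0 hmn hmd
    (isPeriodicPt_rotate_iff.1 (Function.isPeriodicPt_minimalPeriod _ _))
  obtain ⟨j, hj, hj'⟩ : sInf D ∈ D := Nat.sInf_mem ⟨m, hmem⟩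
  have hle : sInf D ≤ m := Nat.sInf_le hmem
  have hlen : (s.take (sInf D)).length = sInf D := by simp [hle.trans hmn]
  have hrot : s.rotate (sInf D) = s := by
    have := rotate_flatten_replicate (s.take (sInf D)) j
    rwa [← hj', hlen] at this
  have hpos : 0 < sInf D := by
    rcases Nat.eq_zero_or_pos (sInf D) with h0 | h0
    · rw [h0] at hj'; simp at hj'; exact absurd hj' hs
    · exact h0
  have hge : m ≤ sInf D := Nat.le_of_dvd hpos
    (Function.IsPeriodicPt.minimalPeriod_dvd (isPeriodicPt_rotate_iff.2 hrot))
  exact ⟨hlen.trans (le_antisymm hle hge), j, hj, hj'⟩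

theorem ap_prefix (s : List ℕ) : ap s <+: s := List.take_prefix _ _

theorem rotate_length_ap (s : List ℕ) : s.rotate (ap s).length = s := by
  rcases eq_or_ne s [] with rfl | hs
  · simp
  rw [(ap_spec hs).1]
  exact isPeriodicPt_rotate_iff.1 (Function.isPeriodicPt_minimalPeriod _ _)

theorem ap_suffix (s : List ℕ) : ap s <:+ s := by
  rcases eq_or_ne s [] with rfl | hs
  · simp [ap]
  obtain ⟨j, hj, hj'⟩ := (ap_spec hs).2
  obtain ⟨m, rfl⟩ : ∃ m, j = m + 1 := ⟨j - 1, by omega⟩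
  rw [List.replicate_succ', List.flatten_concat] at hj'
  exact ⟨_, hj'.symm⟩

theorem length_ap_pos {s : List ℕ} (hs : s ≠ []) : 0 < (ap s).length := by
  rw [(ap_spec hs).1]
  exact Function.IsPeriodicPt.minimalPeriod_pos (List.length_pos_of_ne_nil hs)
    (isPeriodicPt_rotate_iff.2 (List.rotate_length s))

theorem rotate_injOn_ap {s : List ℕ} (hs : s ≠ []) :
    Set.InjOn (fun i => s.rotate i) (Set.Iio (ap s).length) := by
  have := Function.iterate_injOn_Iio_minimalPeriod (f := fun l : List ℕ => l.rotate 1) (x := s)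
  rw [← (ap_spec hs).1] at this
  intro i hi j hj hij
  refine this hi hj ?_
  simp only [iterate_rotate_one]
  exact hij

theorem rotate_mod_ap (s : List ℕ) (i : ℕ) : s.rotate (i % (ap s).length) = s.rotate i := by
  rcases eq_or_ne s [] with rfl | hs
  · simp
  have := Function.iterate_mod_minimalPeriod_eq (f := fun l : List ℕ => l.rotate 1) (x := s) (n := i)
  rwa [iterate_rotate_one, iterate_rotate_one, ← (ap_spec hs).1] at this

theorem length_ap_of_strictNeck {s : List ℕ} (hs : s ≠ []) (h : StrictNeck s.length (ext s)) :
    ap s = s := by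
  refine (ap_prefix s).eq_of_length (le_antisymm (ap_prefix s).length_le ?_)
  by_contra! hlt
  have := h.lt_rotate (length_ap_pos hs) hlt
  rw [rotate_length_ap] at this
  exact lt_irrefl _ this

/-! ### Counting strings by their necklaces -/

/-- The class of `α` is its rotation orbit, and rotations by `0, …, |ap α| - 1` run through this
orbit without repetition. -/
theorem card_filter_neck_eq {k n w : ℕ} (hn : 0 < n) {α : List ℕ} (hα : IsNecklace α)
    (hαs : α ∈ strings k n w) : ((strings k n w).filter fun s => neck s = α).card = (ap α).length := by
  have hne : α ≠ [] := by
    rintro rfl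
    have := (mem_strings.1 hαs).1
    simp at this; omega
  have : ((strings k n w).filter fun s => neck s = α) =
      (Finset.range (ap α).length).image fun i => α.rotate i := by
    ext s
    simp only [Finset.mem_filter, Finset.mem_image, Finset.mem_range, neck_eq_iff hα]
    constructor
    · rintro ⟨-, h⟩
      obtain ⟨i, rfl⟩ := h.symm
      exact ⟨i % (ap α).length, Nat.mod_lt _ (length_ap_pos hne), rotate_mod_ap α i⟩
    · rintro ⟨i, -, rfl⟩
      have hr : α.rotate i ~r α := (List.IsRotated.symm ⟨i, rfl⟩)
      exact ⟨mem_strings_of_isRotated hr hαs, hr⟩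
  rw [this, Finset.card_image_of_injOn, Finset.card_range]
  intro i hi j hj hij
  exact rotate_injOn_ap hne (by simpa using hi) (by simpa using hj) hij

theorem mem_necklaces {k n w : ℕ} {s : List ℕ} :
    s ∈ necklaces k n w ↔ s ∈ strings k n w ∧ IsNecklace s := by
  rw [necklaces, Finset.mem_sort, Finset.mem_filter]

theorem pairwise_necklaces (k n w : ℕ) : (necklaces k n w).Pairwise (· < ·) :=
  (Finset.sortedLT_sort _).pairwise

/-- Count the strings by the fibres of `neck`. The predicate is general because ranks need the
length of an initial segment of the sequence as well as that of the whole. -/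
theorem length_flatten_ap {k n w : ℕ} (hn : 0 < n) (p : List ℕ → Prop) [DecidablePred p] :
    (((necklaces k n w).filter p).map ap).flatten.length =
      ((strings k n w).filter fun s => p (neck s)).card := by
  have hmaps : Set.MapsTo neck ((strings k n w).filter fun s => p (neck s) : Finset (List ℕ))
      (((necklaces k n w).filter p).toFinset : Finset (List ℕ)) := by
    intro s hs
    simp only [Finset.coe_filter, Set.mem_ofPred_eq] at hs
    simp only [Finset.mem_coe, List.mem_toFinset, List.mem_filter, mem_necklaces,
      decide_eq_true_eq]
    exact ⟨⟨neck_mem_strings hs.1, isNecklace_neck s⟩, hs.2⟩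
  rw [Finset.card_eq_sum_card_fiberwise hmaps, List.length_flatten, List.map_map,
    List.sum_toFinset]
  · congr 1
    refine List.map_congr_left fun α hα => ?_
    simp only [List.mem_filter, mem_necklaces, decide_eq_true_eq] at hα
    rw [Function.comp_apply, ← card_filter_neck_eq hn hα.1.2 hα.1.1, Finset.filter_filter]
    congr 1
    refine Finset.filter_congr fun s _ => ?_
    constructor
    · exact fun h => ⟨h ▸ hα.2, h⟩
    · exact fun h => h.2
  · exact ((pairwise_necklaces k n w).imp ne_of_lt).filter _

theorem length_granddaddy {k n w : ℕ} (hn : 0 < n) :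
    (granddaddy k n w).length = (strings k n w).card := by
  have := length_flatten_ap (k := k) (n := n) (w := w) hn (fun _ => True)
  simpa [granddaddy] using this

theorem filter_append_filter_not {l : List (List ℕ)} (h : l.Pairwise (· < ·)) (p : List ℕ → Prop)
    [DecidablePred p] (hp : ∀ u v, u ≤ v → p v → p u) : l = l.filter p ++ l.filter (¬ p ·) := by
  induction l with
  | nil => simp
  | cons a l ih =>
    rw [List.pairwise_cons] at h
    by_cases ha : p a
    · rw [List.filter_cons_of_pos (by simpa using ha), List.filter_cons_of_neg (by simpa using ha),
        List.cons_append, ← ih h.2]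
    · rw [List.filter_cons_of_neg (by simpa using ha), List.filter_cons_of_pos (by simpa using ha)]
      have h0 : ∀ b ∈ l, ¬ p b := fun b hb hpb => ha (hp a b (h.1 b hb).le hpb)
      have h1 : l.filter p = [] := by
        rw [List.filter_eq_nil_iff]
        intro b hb
        simpa using h0 b hb
      have h2 : l.filter (¬ p ·) = l := by
        rw [List.filter_eq_self]
        intro b hb
        simpa using h0 b hb
      rw [h1, h2, List.nil_append]

theorem exists_eq_concat_of_pairwise {l : List (List ℕ)} (h : l.Pairwise (· < ·)) (hl : l ≠ []) :
    ∃ l' x, l = l' ++ [x] ∧ ∀ u ∈ l, u ≤ x := by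
  refine ⟨l.dropLast, l.getLast hl, (List.dropLast_concat_getLast hl).symm, fun u hu => ?_⟩
  rw [← List.dropLast_concat_getLast hl, List.pairwise_append] at h
  rw [← List.dropLast_concat_getLast hl, List.mem_append, List.mem_singleton] at hu
  rcases hu with hu | hu
  · exact (h.2.2 u hu _ (by simp)).le
  · exact hu.le

/-! ### Members of the list of necklaces -/

theorem getD_rep {n k e : ℕ} (h : e < n) : (List.replicate n k).getD e 0 = k := by
  rw [List.getD_eq_getElem _ _ (by simpa using h), List.getElem_replicate]

theorem sum_word (n : ℕ) (f : ℕ → ℕ) : (word n f).sum = ∑ i ∈ Finset.range n, f i := by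
  rw [word, Finset.sum_range]
  induction n with
  | zero => simp
  | succ n ih => rw [List.range_succ, List.map_append, List.sum_append, ih, Fin.sum_univ_castSucc]; simp

theorem word_getD {n : ℕ} {s : List ℕ} (h : s.length = n) : word n (fun e => s.getD e 0) = s :=
  eq_of_getD (by simp [h]) fun e he => getD_word _ (by simpa using he)

theorem getD_mem {s : List ℕ} {e : ℕ} (h : e < s.length) : s.getD e 0 ∈ s := by
  rw [List.getD_eq_getElem _ _ h]; exact List.getElem_mem h

theorem mem_strings_iff_getD {k n w : ℕ} {s : List ℕ} : s ∈ strings k n w ↔ s.length = n ∧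
    (∀ e < n, 1 ≤ s.getD e 0 ∧ s.getD e 0 ≤ k) ∧ w ≤ ∑ e ∈ Finset.range n, s.getD e 0 := by
  rw [mem_strings]
  refine and_congr_right fun h => and_congr ?_ ?_
  · constructor
    · exact fun h' e he => h' _ (getD_mem (h ▸ he))
    · intro h' x hx
      rw [← word_getD h, mem_word] at hx
      obtain ⟨i, hi, rfl⟩ := hx
      exact h' i hi
  · conv_lhs => rw [← word_getD h, sum_word]

theorem PreNeck.of_isNecklace {s : List ℕ} (h : IsNecklace s) {m : ℕ} (hm : m ≤ s.length) :
    PreNeck m (fun e => s.getD e 0) :=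
  ((isNecklace_iff.1 h).preNeck m).congr fun _ he => ext_of_lt (he.trans_le hm)

theorem exists_last_ne {k n : ℕ} {f : ℕ → ℕ} (h : ∃ i < n, f i ≠ k) :
    ∃ d < n, f d ≠ k ∧ ∀ e, d < e → e < n → f e = k := by
  induction n with
  | zero => obtain ⟨i, hi, -⟩ := h; omega
  | succ n ih =>
    by_cases hn : f n = k
    · obtain ⟨i, hi, hik⟩ := h
      have : i ≠ n := by rintro rfl; exact hik hn
      obtain ⟨d, hd, hdk, hl⟩ := ih ⟨i, by omega, hik⟩
      refine ⟨d, by omega, hdk, fun e he hen => ?_⟩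
      rcases eq_or_ne e n with rfl | hne
      · exact hn
      · exact hl e he (by omega)
    · exact ⟨n, by omega, hn, fun e he hen => by omega⟩

theorem isNecklace_replicate (n k : ℕ) : IsNecklace (List.replicate n k) := by
  rw [isNecklace_iff_rotate]
  intro i
  rw [List.rotate_replicate]

/-- The string `a₀ ⋯ a_{d-1} c k ⋯ k` of length `n`. -/
def bump (k n d c : ℕ) (a : ℕ → ℕ) : List ℕ :=
  word n fun e => if e < d then a e else if e = d then c else k

@[simp] theorem length_bump (k n d c : ℕ) (a : ℕ → ℕ) : (bump k n d c a).length = n := by simp [bump]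

theorem getD_bump {k n d c e : ℕ} {a : ℕ → ℕ} (h : e < n) :
    (bump k n d c a).getD e 0 = if e < d then a e else if e = d then c else k := by
  rw [bump, getD_word _ h]

theorem strictNeck_bump_ext {k n d c : ℕ} {a : ℕ → ℕ} (hd : d < n) (ha : PreNeck (d + 1) a)
    (hc : a d < c) (hck : c ≤ k) (hak : ∀ e < d, a e ≤ k) :
    bump k n d c a = List.replicate n k ∨ StrictNeck n (ext (bump k n d c a)) := by
  have hx : ∀ e < n, ext (bump k n d c a) e = if e < d then a e else if e = d then c else k :=
    fun e he => ext_word _ he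
  have hs : (∀ e < n, ext (bump k n d c a) e = k) ∨ StrictNeck n (ext (bump k n d c a)) := by
    refine strictNeck_bump hd ha (fun e he => ?_) ?_ (fun e he hen => ?_) (fun e he => ?_)
    · rw [hx e (by omega), if_pos he]
    · rwa [hx d hd, if_neg (lt_irrefl _), if_pos rfl]
    · rw [hx e hen, if_neg (by omega), if_neg (by omega)]
    · rw [hx e he]
      split_ifs with h1 h2
      · exact hak e h1
      · exact hck
      · exact le_rfl
  refine hs.imp_left fun h => eq_of_getD (by simp) fun e he => ?_
  rw [length_bump] at he
  rw [← ext_of_lt (by simpa using he), h e he, getD_rep he]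

theorem isNecklace_bump {k n d c : ℕ} {a : ℕ → ℕ} (hd : d < n) (ha : PreNeck (d + 1) a)
    (hc : a d < c) (hck : c ≤ k) (hak : ∀ e < d, a e ≤ k) : IsNecklace (bump k n d c a) := by
  rcases strictNeck_bump_ext hd ha hc hck hak with h | h
  · rw [h]; exact isNecklace_replicate n k
  · exact StrictNeck.isNecklace (by rwa [length_bump])

/-- Every symbol stays or grows, so a lower bound on the weight survives. Restricting the list to
heavy necklaces thus keeps all the bumped necklaces on which the neighbour arguments rely. -/
theorem bump_mem_necklaces {k n w d c : ℕ} {α : List ℕ} (hα : α ∈ strings k n w) (hd : d < n)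
    (ha : PreNeck (d + 1) (fun e => α.getD e 0)) (hc : α.getD d 0 < c) (hck : c ≤ k) :
    bump k n d c (fun e => α.getD e 0) ∈ necklaces k n w := by
  obtain ⟨h1, h2, h3⟩ := mem_strings_iff_getD.1 hα
  refine mem_necklaces.2 ⟨mem_strings_iff_getD.2 ⟨by simp, fun e he => ?_, h3.trans ?_⟩,
    isNecklace_bump hd ha hc hck fun e he => (h2 e (by omega)).2⟩
  · rw [getD_bump he]
    have := h2 d hd
    have := h2 e he
    split_ifs <;> omega
  · refine Finset.sum_le_sum fun e he => ?_
    rw [Finset.mem_range] at he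
    rw [getD_bump he]
    have := h2 e he
    split_ifs with h4 h5
    · exact le_rfl
    · subst h5; exact hc.le
    · exact this.2

theorem lt_bump {k n d c : ℕ} {α : List ℕ} (hα : α.length = n) (hd : d < n) (hc : α.getD d 0 < c) :
    α < bump k n d c (fun e => α.getD e 0) := by
  refine (lt_iff_getD (by simp [hα])).2 ⟨d, by simpa using hd, fun e he => ?_, ?_⟩
  · rw [getD_bump (by omega), if_pos he]
  · rwa [getD_bump hd, if_neg (lt_irrefl _), if_pos rfl]

theorem take_prefix_bump {k n d c m : ℕ} {α : List ℕ} (hα : α.length = n) (hm : m ≤ d) :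
    α.take m <+: bump k n d c (fun e => α.getD e 0) := by
  refine prefix_iff_getD.2 ⟨by simp; omega, fun e he => ?_⟩
  simp only [List.length_take, lt_inf_iff] at he
  rw [getD_bump (by omega), if_pos (by omega)]
  exact (prefix_iff_getD.1 (List.take_prefix m α)).2 e (by simp; omega)

/-- No symbol of a necklace is smaller than its first one. -/
theorem eq_replicate_of_getD_zero {k : ℕ} {α : List ℕ} (hα : IsNecklace α)
    (hk : ∀ x ∈ α, x ≤ k) (h0 : α.getD 0 0 = k) : α = List.replicate α.length k := by
  rw [List.eq_replicate_iff]
  refine ⟨rfl, fun x hx => le_antisymm (hk x hx) ?_⟩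
  obtain ⟨i, hi, rfl⟩ := List.mem_iff_getElem.1 hx
  have := isNecklace_iff.1 hα i 0 (by simp)
  rw [ext_of_lt (by omega), h0, add_zero, ext_of_lt hi, List.getD_eq_getElem _ _ hi] at this
  exact this

theorem le_replicate {k n : ℕ} {u : List ℕ} (hu : u.length ≤ n) (hk : ∀ x ∈ u, x ≤ k) :
    u ≤ List.replicate n k := by
  by_contra! h
  obtain ⟨d, hd, -, h2⟩ := (lt_iff_getD (by simpa using hu)).1 h
  rw [getD_rep (by omega)] at h2
  exact absurd (hk _ (getD_mem hd)) (not_le.2 h2)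

theorem replicate_mem_necklaces {k n w : ℕ} (hk : 1 ≤ k) (hw : w ≤ k * n) :
    List.replicate n k ∈ necklaces k n w := by
  refine mem_necklaces.2 ⟨mem_strings.2 ⟨by simp, fun x hx => ?_, by simpa [mul_comm] using hw⟩,
    isNecklace_replicate n k⟩
  rw [List.eq_of_mem_replicate hx]
  exact ⟨hk, le_rfl⟩

/-! ### Every necklace is read off at the start of its aperiodic prefix -/

/-- An aperiodic necklace is its own aperiodic prefix. If `α` has period `m < n`, what is missing
after `ap α` is the prefix of `α` of length `n - m`; the next necklace `α'` begins with it, and by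
induction `α'` is read off next. For `k^n` the claim may fail because nothing follows it. -/
theorem prefix_flatten_ap {k n w : ℕ} (hk : 1 ≤ k) (hw : w ≤ k * n) : ∀ (l : List (List ℕ)) (α : List ℕ),
    (α :: l) <:+ necklaces k n w → α ≠ List.replicate n k → α <+: ((α :: l).map ap).flatten := by
  intro l
  induction l with
  | nil =>
    rintro α ⟨l', hl'⟩ hne
    have hp := pairwise_necklaces k n w
    have hm := replicate_mem_necklaces (n := n) hk hw
    have hα : α ∈ necklaces k n w := by rw [← hl']; simp
    have hαs := mem_strings.1 (mem_necklaces.1 hα).1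
    rw [← hl', List.pairwise_append] at hp
    rw [← hl', List.mem_append, List.mem_singleton] at hm
    rcases hm with hm | hm
    · have h1 := hp.2.2 _ hm α (by simp)
      exact absurd h1 (not_lt.2 (le_replicate hαs.1.le fun x hx => (hαs.2.1 x hx).2))
    · exact absurd hm.symm hne
  | cons α' l ih =>
    intro α hsuf hne
    have hp := (pairwise_necklaces k n w).sublist hsuf.sublist
    have hα : α ∈ necklaces k n w := hsuf.subset (by simp)
    have hα' : α' ∈ necklaces k n w := hsuf.subset (by simp)
    obtain ⟨hαS, hαN⟩ := mem_necklaces.1 hα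
    obtain ⟨hα'S, hα'N⟩ := mem_necklaces.1 hα'
    obtain ⟨h1, h2, h3⟩ := mem_strings_iff_getD.1 hαS
    have h1' := (mem_strings.1 hα'S).1
    rw [List.map_cons, List.flatten_cons]
    by_cases hap : ap α = α
    · rw [hap]; exact List.prefix_append _ _
    set m := (ap α).length with hm
    have hαne : α ≠ [] := by rintro rfl; exact hap (by simp [ap])
    have hm0 : 0 < m := length_ap_pos hαne
    have hmn : m < n := by
      rw [← h1]
      exact lt_of_le_of_ne (ap_prefix α).length_le fun h => hap ((ap_prefix α).eq_of_length h)
    have hrot : α.drop m ++ α.take m = α := by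
      rw [← List.rotate_eq_drop_append_take (by omega)]
      exact rotate_length_ap α
    have htake : ap α = α.take m := List.prefix_iff_eq_take.1 (ap_prefix α)
    have hdrop : α.drop m = α.take (n - m) := by
      have : α.drop m <+: α := ⟨_, hrot⟩
      rw [List.prefix_iff_eq_take.1 this]
      simp [h1]
    have hshift : ∀ d, d < n - m → α.getD (d + m) 0 = α.getD d 0 := by
      intro d hd
      have h := ext_rotate α m d
      rw [rotate_length_ap, ext_of_lt (by omega), ext_of_lt (by omega)] at h
      exact h.symm
    have hex : ∃ i < n, α.getD i 0 ≠ k := by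
      by_contra! hall
      exact hne (eq_of_getD (by simp [h1]) fun e he => by
        rw [hall e (by omega), getD_rep (by omega)])
    obtain ⟨d, hd, hdk, hlast⟩ := exists_last_ne (f := fun i => α.getD i 0) hex
    -- The last symbol different from `k` lies in the last period, since otherwise its shift by `m`
    -- would be a later one. So the bump at `d` leaves the first `n - m` symbols intact.
    have hdm : n - m ≤ d := by
      by_contra! hlt
      have := hlast (d + m) (by omega) (by omega)
      rw [hshift d hlt] at this
      exact hdk this
    have hdk' : α.getD d 0 < k := lt_of_le_of_ne (h2 d hd).2 hdk
    set z := bump k n d (α.getD d 0 + 1) (fun e => α.getD e 0) with hz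
    have hzm : z ∈ necklaces k n w :=
      bump_mem_necklaces hαS hd (PreNeck.of_isNecklace hαN (by omega)) (by omega) (by omega)
    have hαz : α < z := lt_bump h1 hd (by omega)
    have hpz : α.take (n - m) <+: z := take_prefix_bump h1 hdm
    have hle : α' ≤ z := by
      obtain ⟨l', hl'⟩ := hsuf
      rw [← hl'] at hzm
      rw [List.pairwise_cons] at hp
      have hpp := pairwise_necklaces k n w
      rw [← hl', List.pairwise_append] at hpp
      rw [List.mem_append, List.mem_cons, List.mem_cons] at hzm
      rcases hzm with h | h | h | h
      · exact absurd (hpp.2.2 z h α (by simp)) (not_lt.2 hαz.le)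
      · exact absurd h hαz.ne'
      · exact h.ge
      · exact ((List.pairwise_cons.1 hp.2).1 z h).le
    have hαα' : α < α' := (List.pairwise_cons.1 hp).1 α' (by simp)
    -- The successor of `α` lies between `α` and the bumped necklace `z`, which share this prefix.
    have hpα' : α.take (n - m) <+: α' := prefix_of_le_of_le hpz (by simp [hz, h1'])
      ((prefix_le (List.take_prefix _ _)).trans hαα'.le) hle
    have hne' : α' ≠ List.replicate n k := by
      rintro rfl
      have h0 := (prefix_iff_getD.1 hpα').2 0 (by simp [h1]; omega)
      rw [getD_rep (by omega)] at h0
      have h4 := (prefix_iff_getD.1 (List.take_prefix (n - m) α)).2 0 (by simp [h1]; omega)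
      refine hne ?_
      have := eq_replicate_of_getD_zero hαN (fun x hx => ((mem_strings.1 hαS).2.1 x hx).2)
        (h4.symm.trans h0)
      rwa [h1] at this
    have hih := ih α' ((List.suffix_cons α (α' :: l)).trans hsuf) hne'
    have : α = ap α ++ α.take (n - m) := by
      conv_lhs => rw [← List.take_append_drop m α, hdrop, ← htake]
    rw [this]
    have h5 : ap (ap α ++ List.take (n - m) α) = ap α := by rw [← this]
    rw [h5]
    exact (List.prefix_append_right_inj _).2 (hpα'.trans hih)

/-! ### The factorization of a string -/

/-- Rotations repeat modulo the length, so the minimum over `i ≤ s.length` is the minimum over all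
`i`. -/
theorem splitIndex_spec (s : List ℕ) : splitIndex s ≤ s.length ∧ IsNecklace (s.rotate (splitIndex s)) ∧
    ∀ i, IsNecklace (s.rotate i) → splitIndex s ≤ i := by
  obtain ⟨i, hi⟩ := (neck_isRotated s).symm
  have hle : ∀ j, IsNecklace (s.rotate j) → splitIndex s ≤ j := by
    intro j hj
    rcases le_or_gt j s.length with h | h
    · refine Nat.sInf_le ⟨h, ?_⟩
      rwa [← List.rotate_eq_drop_append_take h]
    · rcases eq_or_ne s [] with rfl | hs
      · refine (Nat.sInf_le ?_ : splitIndex [] ≤ 0).trans (Nat.zero_le j)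
        exact ⟨le_rfl, by simp [IsNecklace]⟩
      · have hj' := (Nat.mod_lt j (List.length_pos_of_ne_nil hs)).le
        refine (Nat.sInf_le ?_ : splitIndex s ≤ j % s.length).trans (hj'.trans h.le)
        refine ⟨hj', ?_⟩
        rwa [← List.rotate_eq_drop_append_take hj', List.rotate_mod]
  have hmem : splitIndex s ∈ {i | i ≤ s.length ∧ IsNecklace (s.drop i ++ s.take i)} := by
    rcases eq_or_ne s [] with rfl | hs
    · exact Nat.sInf_mem ⟨0, by simp [IsNecklace]⟩
    refine Nat.sInf_mem ⟨i % s.length, ?_⟩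
    have := (Nat.mod_lt i (List.length_pos_of_ne_nil hs)).le
    refine ⟨this, ?_⟩
    rw [← List.rotate_eq_drop_append_take this, List.rotate_mod, hi]
    exact isNecklace_neck s
  exact ⟨hmem.1, by rw [List.rotate_eq_drop_append_take hmem.1]; exact hmem.2, hle⟩

theorem rotate_splitIndex (s : List ℕ) : s.rotate (splitIndex s) = neck s :=
  (neck_eq_of_isRotated (splitIndex_spec s).2.1 ⟨_, rfl⟩).symm

theorem qPart_append_pPart (s : List ℕ) : qPart s ++ pPart s = neck s := by
  rw [← rotate_splitIndex, List.rotate_eq_drop_append_take (splitIndex_spec s).1]; rfl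

theorem pPart_append_qPart (s : List ℕ) : pPart s ++ qPart s = s := List.take_append_drop _ _

theorem length_pPart (s : List ℕ) : (pPart s).length = splitIndex s := by
  simp [pPart, (splitIndex_spec s).1]

/-- If `|p|` were at least the period of the necklace, rotating by one period less would reach the
same necklace, against minimality. So `p` fits into a single aperiodic prefix. -/
theorem splitIndex_lt {s : List ℕ} (hs : s ≠ []) : splitIndex s < (ap (neck s)).length := by
  by_contra! h
  set d := (ap (neck s)).length with hd
  have hl : (neck s).length = s.length := (neck_isRotated s).perm.length_eq
  have hne : neck s ≠ [] := fun h0 => hs (List.eq_nil_of_length_eq_zero (by rw [← hl, h0]; rfl))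
  have hd0 : 0 < d := length_ap_pos hne
  have hi := (splitIndex_spec s).1
  have h1 : s = (neck s).rotate (s.length - splitIndex s) := by
    rw [← rotate_splitIndex, List.rotate_rotate, Nat.add_sub_cancel' hi, List.rotate_length]
  have h2 : s.rotate (splitIndex s - d) = neck s := by
    have h3 : d + (s.length - splitIndex s + (splitIndex s - d)) = (neck s).length := by omega
    calc s.rotate (splitIndex s - d)
        = (((neck s).rotate d).rotate (s.length - splitIndex s)).rotate (splitIndex s - d) := by
          rw [rotate_length_ap, ← h1]
      _ = neck s := by rw [List.rotate_rotate, List.rotate_rotate, h3, List.rotate_length]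
  have := (splitIndex_spec s).2.2 _ (h2 ▸ isNecklace_neck s)
  omega

theorem length_neck (s : List ℕ) : (neck s).length = s.length := (neck_isRotated s).perm.length_eq

theorem qPart_ne_nil {s : List ℕ} (hs : s ≠ []) : qPart s ≠ [] := by
  intro h
  have h1 := splitIndex_lt hs
  have h2 := (ap_prefix (neck s)).length_le
  have h3 := congrArg List.length (pPart_append_qPart s)
  rw [h, List.append_nil, length_pPart] at h3
  rw [length_neck] at h2
  omega

theorem qPart_prefix_neck (s : List ℕ) : qPart s <+: neck s :=
  qPart_append_pPart s ▸ List.prefix_append _ _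

theorem pPart_suffix_neck (s : List ℕ) : pPart s <:+ neck s :=
  qPart_append_pPart s ▸ List.suffix_append _ _

theorem neck_mem_necklaces {k n w : ℕ} {s : List ℕ} (hs : s ∈ strings k n w) :
    neck s ∈ necklaces k n w := mem_necklaces.2 ⟨neck_mem_strings hs, isNecklace_neck s⟩

/-- The necklaces that are completely read before the part `q` of `s = p q`. -/
def Low (k : ℕ) (s u : List ℕ) : Prop :=
  ((∀ x ∈ pPart s, x = k) ∧ u < qPart s) ∨ ((¬ ∀ x ∈ pPart s, x = k) ∧ u ≤ neck s)

noncomputable instance (k : ℕ) (s : List ℕ) : DecidablePred (Low k s) := Classical.decPred _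

theorem Low.mono {k : ℕ} {s u v : List ℕ} (huv : u ≤ v) (h : Low k s v) : Low k s u :=
  h.imp (And.imp_right huv.trans_lt) (And.imp_right huv.trans)

theorem Low.le_neck {k : ℕ} {s u : List ℕ} (h : Low k s u) : u ≤ neck s := by
  rcases h with h | h
  · exact h.2.le.trans (prefix_le (qPart_prefix_neck s))
  · exact h.2

theorem le_of_not_low {k : ℕ} {s u : List ℕ} (h : ¬ Low k s u) : qPart s ≤ u := by
  by_contra! hlt
  by_cases hp : ∀ x ∈ pPart s, x = k
  · exact h (Or.inl ⟨hp, hlt⟩)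
  · exact h (Or.inr ⟨hp, hlt.le.trans (prefix_le (qPart_prefix_neck s))⟩)

/-- The least necklace that is not `Low` starts with `q`. -/
theorem qPart_prefix_of_least {k n w : ℕ} {s β : List ℕ} (hs : s ∈ strings k n w)
    (hβ : β ∈ necklaces k n w) (hβl : ¬ Low k s β)
    (hmin : ∀ u ∈ necklaces k n w, ¬ Low k s u → β ≤ u) : qPart s <+: β := by
  have hlen := (mem_strings.1 (mem_necklaces.1 hβ).1).1
  have hαN := isNecklace_neck s
  have hαS := neck_mem_strings hs
  obtain ⟨h1, h2, h3⟩ := mem_strings_iff_getD.1 hαS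
  by_cases hp : ∀ x ∈ pPart s, x = k
  -- Here the necklace of `s` is itself not `Low`, so the least such `β` lies between `q` and the
  -- necklace `qp`.
  · refine prefix_of_le_of_le (qPart_prefix_neck s) (by omega) (le_of_not_low hβl)
      (hmin _ (neck_mem_necklaces hs) ?_)
    rintro (h | h)
    · exact absurd h.2 (not_lt.2 (prefix_le (qPart_prefix_neck s)))
    · exact h.1 hp
  · have hq : (qPart s).length + (pPart s).length = n := by
      rw [← h1, ← qPart_append_pPart, List.length_append]
    obtain ⟨i, hi, hik⟩ : ∃ i, i < (pPart s).length ∧ (pPart s).getD i 0 ≠ k := by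
      push Not at hp
      obtain ⟨x, hx, hxk⟩ := hp
      obtain ⟨i, hi, rfl⟩ := List.mem_iff_getElem.1 hx
      exact ⟨i, hi, by rwa [List.getD_eq_getElem _ _ hi]⟩
    have hi' : (neck s).getD ((qPart s).length + i) 0 ≠ k := by
      rw [← qPart_append_pPart, List.getD_append_right _ _ _ _ (by omega), Nat.add_sub_cancel_left]
      exact hik
    -- The last symbol of `qp` different from `k` belongs to `p`. Raising it gives a necklace above
    -- `qp`, hence not `Low`, that still begins with `q`; `β` lies between `q` and this necklace.
    obtain ⟨d, hd, hdk, hlast⟩ := exists_last_ne (n := n) (f := fun i => (neck s).getD i 0)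
      ⟨(qPart s).length + i, by omega, hi'⟩
    have hdq : (qPart s).length ≤ d := by
      by_contra! hlt
      exact hi' (hlast _ (by omega) (by omega))
    have hdk' : (neck s).getD d 0 < k := lt_of_le_of_ne (h2 d hd).2 hdk
    have hz := bump_mem_necklaces (c := (neck s).getD d 0 + 1) hαS hd
      (PreNeck.of_isNecklace hαN (by omega)) (by omega) (by omega)
    have hlt := lt_bump (k := k) (c := (neck s).getD d 0 + 1) h1 hd (by omega)
    have hpre := take_prefix_bump (k := k) (c := (neck s).getD d 0 + 1) h1 hdq
    rw [← List.prefix_iff_eq_take.1 (qPart_prefix_neck s)] at hpre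
    refine prefix_of_le_of_le hpre (by simp [hlen]) (le_of_not_low hβl) (hmin _ hz ?_)
    exact fun h => absurd h.le_neck (not_le.2 hlt)

/-- The aperiodic prefix of the largest `Low` necklace ends with `p`. -/
theorem pPart_suffix_of_greatest {k n w : ℕ} {s x : List ℕ} (hs : s ∈ strings k n w)
    (hx : x ∈ necklaces k n w) (hxl : Low k s x)
    (hmax : ∀ u ∈ necklaces k n w, Low k s u → u ≤ x) : pPart s <:+ ap x := by
  obtain ⟨hxS, hxN⟩ := mem_necklaces.1 hx
  obtain ⟨h1, h2, h3⟩ := mem_strings_iff_getD.1 hxS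
  have hlen := (mem_strings.1 hs).1
  have hq : (pPart s).length + (qPart s).length = n := by
    rw [← hlen, ← List.length_append, pPart_append_qPart]
  rcases hxl with hxl | hxl
  · obtain ⟨hp, hlt⟩ := hxl
    obtain ⟨d, hd, he, hlt'⟩ := (lt_iff_getD (by omega)).1 hlt
    -- After its first difference from `q`, the greatest `Low` necklace has only symbols `k`:
    -- raising another symbol there would give a larger necklace that is still below `q`. Therefore
    -- it ends with `p`, a power of `k`.
    have htail : ∀ e, d < e → e < n → x.getD e 0 = k := by
      by_contra! h
      obtain ⟨e, hde, hen, hek⟩ := h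
      obtain ⟨b, hb, hbk, hlast⟩ := exists_last_ne (f := fun i => x.getD i 0) ⟨e, hen, hek⟩
      have hdb : d < b := by
        by_contra! hbd
        exact hek (hlast e (by omega) hen)
      have hbk' : x.getD b 0 < k := lt_of_le_of_ne (h2 b hb).2 hbk
      have hz := bump_mem_necklaces (c := x.getD b 0 + 1) hxS hb
        (PreNeck.of_isNecklace hxN (by omega)) (by omega) (by omega)
      refine absurd (hmax _ hz (Or.inl ⟨hp, ?_⟩)) (not_le.2 (lt_bump h1 hb (by omega)))
      refine (lt_iff_getD (by simp; omega)).2 ⟨d, hd, fun e he' => ?_, ?_⟩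
      · rw [getD_bump (by omega), if_pos (by omega), he e he']
      · rwa [getD_bump (by omega), if_pos (by omega)]
    have hpk : pPart s = List.replicate (pPart s).length k := List.eq_replicate_iff.2 ⟨rfl, hp⟩
    have hps : pPart s <:+ x := by
      refine ⟨x.take (qPart s).length, ?_⟩
      refine eq_of_getD (by simp; omega) fun e he' => ?_
      have hl : (x.take (qPart s).length).length = (qPart s).length := by simp; omega
      rw [List.length_append, hl] at he'
      rcases lt_or_ge e (qPart s).length with h | h
      · rw [List.getD_append _ _ _ _ (by omega)]
        exact (prefix_iff_getD.1 (List.take_prefix _ x)).2 e (by omega)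
      · rw [List.getD_append_right _ _ _ _ (by omega), hl, hpk, getD_rep (by omega),
          htail e (by omega) (by omega)]
    rcases le_total (pPart s).length (ap x).length with h | h
    · exact List.suffix_of_suffix_length_le hps (ap_suffix x) h
    -- If `ap x` were shorter than `p`, it would be a power of `k`, and `x = k^n` could not be below
    -- `q`.
    · exfalso
      have hsuf := List.suffix_of_suffix_length_le (ap_suffix x) hps h
      have hxne : x ≠ [] := by rintro rfl; simp at h1; omega
      have h0 := (prefix_iff_getD.1 (ap_prefix x)).2 0 (length_ap_pos hxne)
      rw [hp _ (hsuf.subset (getD_mem (length_ap_pos hxne)))] at h0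
      have := eq_replicate_of_getD_zero hxN (fun y hy => ((mem_strings.1 hxS).2.1 y hy).2) h0.symm
      rw [h1] at this
      rw [this, getD_rep (by omega)] at hlt'
      have hqk := ((mem_strings.1 hs).2.1 _ ((List.drop_suffix _ _).subset (getD_mem hd))).2
      exact absurd hlt' (not_lt.2 hqk)
  · have hαx : neck s = x :=
      le_antisymm (hmax _ (neck_mem_necklaces hs) (Or.inr ⟨hxl.1, le_rfl⟩)) hxl.2
    have hsne : s ≠ [] := by
      rintro rfl
      simp [pPart] at hxl
    rw [← hαx]
    refine List.suffix_of_suffix_length_le (pPart_suffix_neck s) (ap_suffix _) ?_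
    rw [length_pPart]
    exact (splitIndex_lt hsne).le

/-! ### Occurrences in a cyclic sequence -/

theorem hasRank_of_append {A B p q : List ℕ} (hp : p <:+ A) (hq : q <+: B) (h : 0 < p.length + q.length) :
    HasRank (A ++ B) (p ++ q) (A.length - p.length + 1) := by
  obtain ⟨A, rfl⟩ := hp
  obtain ⟨B, rfl⟩ := hq
  refine ⟨by omega, by simp; omega, fun i hi => ?_⟩
  simp only [List.length_append] at hi ⊢
  rw [Nat.mod_eq_of_lt (by omega)]
  have h1 : A ++ p ++ (q ++ B) = A ++ ((p ++ q) ++ B) := by simp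
  rw [h1, List.getElem?_append_right (by omega)]
  have h2 : A.length + p.length - p.length + 1 - 1 + i - A.length = i := by omega
  rw [h2, List.getElem?_append_left (by simpa using hi)]

theorem hasRank_of_suffix_prefix {U p q : List ℕ} (hp : p <:+ U) (hq : q <+: U) (h : 0 < p.length) :
    HasRank U (p ++ q) (U.length - p.length + 1) := by
  have hpl := hp.length_le
  have hql := hq.length_le
  refine ⟨by omega, by omega, fun i hi => ?_⟩
  rw [List.length_append] at hi
  rcases lt_or_ge i p.length with h1 | h1
  · rw [Nat.mod_eq_of_lt (by omega), List.getElem?_append_left h1]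
    obtain ⟨A, rfl⟩ := hp
    simp only [List.length_append] at hpl ⊢
    rw [List.getElem?_append_right (by omega)]
    congr 1
    omega
  · have h2 : U.length - p.length + 1 - 1 + i = (i - p.length) + U.length := by omega
    rw [h2, Nat.add_mod_right, Nat.mod_eq_of_lt (by omega), List.getElem?_append_right h1]
    obtain ⟨B, rfl⟩ := hq
    rw [List.getElem?_append_left (by omega)]

theorem eq_of_hasRank {U s t : List ℕ} {r : ℕ} (hs : HasRank U s r) (ht : HasRank U t r)
    (h : s.length = t.length) : s = t := by
  apply List.ext_getElem? fun i => ?_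
  rcases lt_or_ge i s.length with hi | hi
  · rw [← hs.2.2 i hi, ht.2.2 i (h ▸ hi)]
  · rw [List.getElem?_eq_none hi, List.getElem?_eq_none (h ▸ hi)]

/-! ### The bounded-weight sequence is a universal cycle -/

/-- The number of strings whose necklaces are completely read before the part `q` of `s = p q`. -/
noncomputable def lowCount (k n w : ℕ) (s : List ℕ) : ℕ :=
  ((strings k n w).filter fun u => Low k s (neck u)).card

/-- The necklace `(k-1)k^{n-1}` has weight `kn - 1`; this is what the hypothesis `w < k * n`
provides, so that `k^n` is not the only necklace in the list. -/
theorem penultimate_mem_necklaces {k n w : ℕ} (hn : 1 ≤ n) (hk : 2 ≤ k) (hw : w < k * n) :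
    bump k n 0 (k - 1) (fun _ => 0) ∈ necklaces k n w := by
  refine mem_necklaces.2 ⟨mem_strings_iff_getD.2 ⟨by simp, fun e he => ?_, ?_⟩,
    isNecklace_bump (by omega) (fun i d _ _ => le_rfl) (by omega) (by omega) (by simp)⟩
  · rw [getD_bump he]
    split_ifs <;> omega
  · obtain ⟨m, rfl⟩ : ∃ m, n = m + 1 := ⟨n - 1, by omega⟩
    rw [Finset.sum_range_succ', getD_bump (by omega)]
    have : ∑ e ∈ Finset.range m, (bump k (m + 1) 0 (k - 1) (fun _ => 0)).getD (e + 1) 0 =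
        ∑ e ∈ Finset.range m, k := by
      refine Finset.sum_congr rfl fun e he => ?_
      rw [Finset.mem_range] at he
      rw [getD_bump (by omega)]
      simp
    rw [this, Finset.sum_const, Finset.card_range, smul_eq_mul, if_neg (by omega), if_pos rfl]
    rw [mul_add, mul_comm] at hw
    omega

theorem penultimate_lt {k n : ℕ} (hn : 1 ≤ n) (hk : 2 ≤ k) :
    bump k n 0 (k - 1) (fun _ => 0) < List.replicate n k := by
  refine (lt_iff_getD (by simp)).2 ⟨0, by simp; omega, by simp, ?_⟩
  rw [getD_bump (by omega), getD_rep (by omega), if_neg (by omega), if_pos rfl]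
  omega

theorem exists_first_necklace {k n w : ℕ} (hn : 1 ≤ n) (hk : 2 ≤ k) (hw : w < k * n) :
    ∃ α, (necklaces k n w).head? = some α ∧ α ∈ necklaces k n w ∧ α ≠ List.replicate n k ∧
      (∀ u ∈ necklaces k n w, α ≤ u) ∧ α <+: granddaddy k n w := by
  have hz := penultimate_mem_necklaces hn hk hw
  have hp := pairwise_necklaces k n w
  rcases h : necklaces k n w with _ | ⟨α, l⟩
  · rw [h] at hz; simp at hz
  · rw [h] at hz hp
    have hmin : ∀ u ∈ α :: l, α ≤ u := by
      intro u hu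
      rcases List.mem_cons.1 hu with rfl | hu
      · exact le_rfl
      · exact ((List.pairwise_cons.1 hp).1 u hu).le
    have hne : α ≠ List.replicate n k := by
      rintro rfl
      exact absurd (hmin _ hz) (not_le.2 (penultimate_lt hn hk))
    refine ⟨α, rfl, by simp, hne, hmin, ?_⟩
    have := prefix_flatten_ap (by omega) hw.le l α (by rw [h]) hne
    rwa [granddaddy, h]

/-- The last two necklaces are `(k-1)k^{n-1}` and `k^n`. The first is aperiodic and contributes `n -
1` copies of `k`, and the second adds at least one more. -/
theorem replicate_suffix_granddaddy {k n w : ℕ} (hn : 1 ≤ n) (hk : 2 ≤ k) (hw : w < k * n) :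
    List.replicate n k <:+ granddaddy k n w := by
  have hz := penultimate_mem_necklaces hn hk hw
  have hK := replicate_mem_necklaces (n := n) (by omega : 1 ≤ k) hw.le
  have hlt := penultimate_lt hn hk
  set z := bump k n 0 (k - 1) (fun _ => 0) with hzdef
  obtain ⟨A, x, hA, hx⟩ := exists_eq_concat_of_pairwise (pairwise_necklaces k n w)
    (List.ne_nil_of_mem hK)
  have hmemS : ∀ u ∈ necklaces k n w, u ∈ strings k n w := fun u hu => (mem_necklaces.1 hu).1
  have hxS := mem_strings.1 (hmemS x (by rw [hA]; simp))
  have hxK : x = List.replicate n k :=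
    le_antisymm (le_replicate hxS.1.le fun y hy => (hxS.2.1 y hy).2) (hx _ hK)
  subst hxK
  have hzA : z ∈ A := by
    rw [hA, List.mem_append, List.mem_singleton] at hz
    exact hz.resolve_right hlt.ne
  have hp := pairwise_necklaces k n w
  rw [hA, List.pairwise_append] at hp
  obtain ⟨A', y, hA', hy⟩ := exists_eq_concat_of_pairwise hp.1 (List.ne_nil_of_mem hzA)
  have hyA : y ∈ A := by rw [hA']; simp
  have hyn : y ∈ necklaces k n w := by rw [hA]; exact List.mem_append_left _ hyA
  obtain ⟨hyl, hyd, -⟩ := mem_strings_iff_getD.1 (hmemS y hyn)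
  -- A necklace above `z` must have a larger first symbol, namely `k`, and is then `k^n`.
  have hyz : y = z := by
    refine le_antisymm (not_lt.1 fun hlt' => ?_) (hy z hzA)
    obtain ⟨d, hd, he, hdlt⟩ := (lt_iff_getD (by simp [hzdef, hyl])).1 hlt'
    have hyk := hyd d (by omega)
    rw [hzdef, getD_bump (by omega)] at hdlt
    split_ifs at hdlt with h1 h2
    · omega
    · subst h2
      have := eq_replicate_of_getD_zero (mem_necklaces.1 hyn).2 (k := k)
        (fun x hx => ((mem_strings.1 (hmemS y hyn)).2.1 x hx).2) (by omega)
      rw [hyl] at this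
      exact (hp.2.2 y hyA (List.replicate n k) (by simp)).ne this
    · omega
  have hapz : ap z = z := by
    have hzn : z.length = n := by simp [hzdef]
    refine length_ap_of_strictNeck (fun h => by rw [h] at hzn; simp at hzn; omega) ?_
    rw [hzn]
    exact (strictNeck_bump_ext (by omega) (fun i d _ _ => le_rfl) (by omega) (by omega)
      (by simp)).resolve_left hlt.ne
  -- It suffices that this aperiodic prefix is a nonempty power of `k`; its exact length is not
  -- needed.
  obtain ⟨m, hm⟩ : ∃ m, ap (List.replicate n k) = List.replicate (m + 1) k := by
    have hne : List.replicate n k ≠ [] := by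
      rw [Ne, List.replicate_eq_nil_iff]; omega
    have := length_ap_pos hne
    refine ⟨(ap (List.replicate n k)).length - 1, ?_⟩
    rw [Nat.sub_add_cancel this, List.eq_replicate_iff]
    exact ⟨rfl, fun b hb => List.eq_of_mem_replicate ((ap_prefix _).subset hb)⟩
  have hzk : z = (k - 1) :: List.replicate (n - 1) k := by
    refine eq_of_getD (by simp [hzdef]; omega) fun e he => ?_
    have he' : e < n := by simpa [hzdef] using he
    rw [hzdef, getD_bump he', if_neg (by omega)]
    rcases e with _ | e
    · simp
    · rw [if_neg (by omega), List.getD_cons_succ, getD_rep (by omega)]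
  have hG : granddaddy k n w = ((A'.map ap).flatten ++ (k - 1) :: List.replicate m k) ++
      List.replicate n k := by
    rw [granddaddy, hA, hA', hyz]
    simp only [List.map_append, List.map_cons, List.map_nil, List.flatten_append, List.flatten_cons,
      List.flatten_nil, hapz, hm, List.append_nil, List.append_assoc]
    rw [hzk, List.cons_append, List.cons_append, ← List.replicate_add, ← List.replicate_add,
      show n - 1 + (m + 1) = m + n by omega]
  exact hG ▸ List.suffix_append _ _

/-- The sequence ends with `k^n` and begins with the first necklace, so the string is read across
the end, starting `n - j` symbols before it. -/
theorem hasRank_of_isWraparound {k n w : ℕ} (hn : 1 ≤ n) (hk : 2 ≤ k) (hw : w < k * n) {s : List ℕ}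
    {j : ℕ} (h : IsWraparound k n w s j) :
    HasRank (granddaddy k n w) s ((strings k n w).card - (n - j) + 1) := by
  obtain ⟨hj, α, hα, rfl⟩ := h
  obtain ⟨α', hα', -, -, -, hpre⟩ := exists_first_necklace hn hk hw
  obtain rfl : α = α' := by rw [hα] at hα'; exact Option.some.inj hα'
  have h1 : List.replicate (n - j) k <:+ granddaddy k n w := by
    refine List.IsSuffix.trans ⟨List.replicate j k, ?_⟩ (replicate_suffix_granddaddy hn hk hw)
    rw [← List.replicate_add]; congr 1; omega
  have := hasRank_of_suffix_prefix h1 ((List.take_prefix j α).trans hpre) (by simp; omega)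
  rwa [length_granddaddy (by omega), List.length_replicate] at this

/-- The `n` distinct rotations of `(k-1)k^{n-1}`, together with `k^n`. This keeps the truncated
subtractions in the rank formulas exact. -/
theorem le_card_strings {k n w : ℕ} (hn : 1 ≤ n) (hk : 2 ≤ k) (hw : w < k * n) :
    n + 1 ≤ (strings k n w).card := by
  have hz := penultimate_mem_necklaces hn hk hw
  have hlt := penultimate_lt hn hk
  have hK := replicate_mem_necklaces (n := n) (by omega : 1 ≤ k) hw.le
  set z := bump k n 0 (k - 1) (fun _ => 0) with hzdef
  have hzn : z.length = n := by simp [hzdef]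
  have hzne : z ≠ [] := fun h => by rw [h] at hzn; simp at hzn; omega
  have hapz : ap z = z := by
    refine length_ap_of_strictNeck hzne ?_
    rw [hzn]
    exact (strictNeck_bump_ext (by omega) (fun i d _ _ => le_rfl) (by omega) (by omega)
      (by simp)).resolve_left hlt.ne
  have hc := card_filter_neck_eq (by omega) (mem_necklaces.1 hz).2 (mem_necklaces.1 hz).1
  rw [hapz, hzn] at hc
  have hmem : List.replicate n k ∉ (strings k n w).filter fun s => neck s = z := by
    simp only [Finset.mem_filter, not_and]
    intro _ h
    rw [neck_eq_of_isRotated (mem_necklaces.1 hK).2 (List.IsRotated.refl _)] at h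
    exact hlt.ne' h
  have := Finset.card_le_card
    (Finset.insert_subset (mem_necklaces.1 hK).1 (Finset.filter_subset (fun s => neck s = z) _))
  rwa [Finset.card_insert_of_notMem hmem, hc] at this

theorem length_flatten_ap_low {k n w : ℕ} (hn : 0 < n) (s : List ℕ) :
    (((necklaces k n w).filter (Low k s ·)).map ap).flatten.length = lowCount k n w s :=
  length_flatten_ap hn _

/-- The position at which a string occurs in the bounded-weight sequence. -/
theorem hasRank_lowCount {k n w : ℕ} (hn : 1 ≤ n) (hk : 2 ≤ k) (hw : w < k * n) {s : List ℕ}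
    (hs : s ∈ strings k n w) (hne : s ≠ List.replicate n k) :
    (splitIndex s ≤ lowCount k n w s ∧
      HasRank (granddaddy k n w) s (lowCount k n w s - splitIndex s + 1)) ∨
    (lowCount k n w s = 0 ∧ 0 < splitIndex s ∧ splitIndex s ≤ n ∧
      IsWraparound k n w s (n - splitIndex s)) := by
  have hlen := (mem_strings.1 hs).1
  have hsne : s ≠ [] := by rintro rfl; simp at hlen; omega
  have hi := (splitIndex_spec s).1
  have hα := neck_mem_necklaces hs
  set A := (necklaces k n w).filter (Low k s ·) with hA
  set B := (necklaces k n w).filter (¬ Low k s ·) with hB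
  have hAB : necklaces k n w = A ++ B :=
    filter_append_filter_not (pairwise_necklaces k n w) _ fun _ _ huv => Low.mono huv
  have hAmem : ∀ u, u ∈ A ↔ u ∈ necklaces k n w ∧ Low k s u := fun u => by simp [hA]
  have hBmem : ∀ u, u ∈ B ↔ u ∈ necklaces k n w ∧ ¬ Low k s u := fun u => by simp [hB]
  have hKne : neck s ≠ List.replicate n k := by
    intro h
    have h1 := (neck_isRotated s).symm
    rw [h] at h1
    obtain ⟨i, hi⟩ := h1.symm
    rw [List.rotate_replicate] at hi
    exact hne hi.symm
  have hK : List.replicate n k ∈ B := by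
    refine (hBmem _).2 ⟨replicate_mem_necklaces (by omega) hw.le, fun h => ?_⟩
    have h2 := mem_strings.1 (mem_necklaces.1 hα).1
    exact hKne (le_antisymm (le_replicate h2.1.le fun x hx => (h2.2.1 x hx).2) h.le_neck)
  obtain ⟨β, l, hβl⟩ := List.exists_cons_of_ne_nil (List.ne_nil_of_mem hK)
  have hβ : β ∈ B := by rw [hβl]; simp
  have hmin : ∀ u ∈ necklaces k n w, ¬ Low k s u → β ≤ u := by
    intro u hu hul
    have huB := (hBmem u).2 ⟨hu, hul⟩
    have hpB := ((pairwise_necklaces k n w).filter (p := fun u => decide (¬ Low k s u)))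
    change List.Pairwise _ B at hpB
    rw [hβl] at huB hpB
    rcases List.mem_cons.1 huB with rfl | h
    · exact le_rfl
    · exact ((List.pairwise_cons.1 hpB).1 u h).le
  have hq := qPart_prefix_of_least hs ((hBmem β).1 hβ).1 ((hBmem β).1 hβ).2 hmin
  -- Otherwise `q`, hence the necklace of `s`, would start with `k`, making `s` equal to `k^n`.
  have hβne : β ≠ List.replicate n k := by
    rintro rfl
    have hqne := qPart_ne_nil hsne
    have hq0 := List.length_pos_of_ne_nil hqne
    have h1 := (prefix_iff_getD.1 hq).2 0 hq0
    rw [(prefix_iff_getD.1 (qPart_prefix_neck s)).2 0 hq0, getD_rep (by omega)] at h1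
    have h2 := mem_strings.1 (mem_necklaces.1 hα).1
    have := eq_replicate_of_getD_zero (isNecklace_neck s) (fun x hx => (h2.2.1 x hx).2) h1
    rw [h2.1] at this
    exact hKne this
  have hqB : qPart s <+: (B.map ap).flatten := by
    rw [hβl]
    refine hq.trans (prefix_flatten_ap (by omega) hw.le l β ?_ hβne)
    rw [hAB, hβl]
    exact List.suffix_append _ _
  have hG : granddaddy k n w = (A.map ap).flatten ++ (B.map ap).flatten := by
    rw [granddaddy, hAB, List.map_append, List.flatten_append]
  have hAlen : (A.map ap).flatten.length = lowCount k n w s := length_flatten_ap_low (by omega) s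
  have hpq : 0 < (pPart s).length + (qPart s).length := by
    have := List.length_pos_of_ne_nil (qPart_ne_nil hsne)
    omega
  have hmain : pPart s <:+ (A.map ap).flatten → splitIndex s ≤ lowCount k n w s ∧
      HasRank (granddaddy k n w) s (lowCount k n w s - splitIndex s + 1) := by
    intro hp
    have h1 := hasRank_of_append hp hqB hpq
    rw [← hG, pPart_append_qPart, hAlen, length_pPart] at h1
    have h2 := hp.length_le
    rw [hAlen, length_pPart] at h2
    exact ⟨h2, h1⟩
  -- If nothing is `Low`, an empty `p` causes no trouble. A nonempty `p` must be a power of `k`,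
  -- since otherwise the necklace of `s` would be `Low`, and `q` is a prefix of the first necklace:
  -- `s` is in the wraparound.
  by_cases hA0 : A = []
  · rcases Nat.eq_zero_or_pos (splitIndex s) with h0 | h0
    · left
      refine hmain ?_
      rw [List.eq_nil_of_length_eq_zero ((length_pPart s).trans h0)]
      exact List.nil_suffix
    · right
      rw [hA0] at hAlen
      refine ⟨by simpa using hAlen.symm, h0, by omega, by omega, β, ?_, ?_⟩
      · rw [hAB, hA0, hβl]; rfl
      · have hall : ∀ x ∈ pPart s, x = k := by
          by_contra h
          have : neck s ∈ A := (hAmem _).2 ⟨hα, Or.inr ⟨h, le_rfl⟩⟩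
          rw [hA0] at this
          simp at this
        have hql : (qPart s).length = n - splitIndex s := by simp [qPart, hlen]
        conv_lhs => rw [← pPart_append_qPart s]
        congr 1
        · rw [List.eq_replicate_iff, length_pPart]
          exact ⟨by omega, hall⟩
        · rw [List.prefix_iff_eq_take.1 hq, hql]
  · left
    obtain ⟨A', x, hA', hx⟩ := exists_eq_concat_of_pairwise
      ((pairwise_necklaces k n w).filter (p := fun u => decide (Low k s u))) hA0
    change A = A' ++ [x] at hA'
    have hxA : x ∈ A := by rw [hA']; simp
    refine hmain ?_
    have hsuf := pPart_suffix_of_greatest hs ((hAmem x).1 hxA).1 ((hAmem x).1 hxA).2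
      fun u hu hul => hx u ((hAmem u).2 ⟨hu, hul⟩)
    rw [hA', List.map_append, List.flatten_append]
    refine hsuf.trans ?_
    simp

theorem replicate_isWraparound {k n w : ℕ} (hn : 1 ≤ n) (hk : 2 ≤ k) (hw : w < k * n) :
    IsWraparound k n w (List.replicate n k) 0 := by
  obtain ⟨α, hα, -⟩ := exists_first_necklace hn hk hw
  exact ⟨by omega, α, hα, by simp⟩

theorem exists_hasRank {k n w : ℕ} (hn : 1 ≤ n) (hk : 2 ≤ k) (hw : w < k * n) {s : List ℕ}
    (hs : s ∈ strings k n w) : ∃ r, HasRank (granddaddy k n w) s r := by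
  by_cases hne : s = List.replicate n k
  · exact ⟨_, hasRank_of_isWraparound hn hk hw (hne ▸ replicate_isWraparound hn hk hw)⟩
  · rcases hasRank_lowCount hn hk hw hs hne with h | h
    · exact ⟨_, h.2⟩
    · exact ⟨_, hasRank_of_isWraparound hn hk hw h.2.2.2⟩

/-- Pigeonhole: strings of equal length with the same rank coincide, so the rank map is injective
from `S` into an interval of the same size, and therefore onto. -/
theorem image_rank {S : Finset (List ℕ)} {U : List ℕ} {n : ℕ} (hS : ∀ s ∈ S, s.length = n)
    (hU : U.length = S.card) {f : List ℕ → ℕ} (hf : ∀ s ∈ S, HasRank U s (f s)) :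
    S.image f = Finset.Icc 1 U.length := by
  have hinj : Set.InjOn f S := fun s hs t ht hst =>
    eq_of_hasRank (hf s hs) (hst ▸ hf t ht) ((hS s hs).trans (hS t ht).symm)
  refine Finset.eq_of_subset_of_card_le ?_ ?_
  · intro r hr
    obtain ⟨s, hs, rfl⟩ := Finset.mem_image.1 hr
    exact Finset.mem_Icc.2 ⟨(hf s hs).1, (hf s hs).2.1⟩
  · rw [Finset.card_image_of_injOn hinj, Nat.card_Icc, hU]
    omega

/-- In a cyclic sequence of length `|S|` that contains all strings of `S`, every position is the rank
of a string of `S`. -/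
theorem exists_mem_of_hasRank {S : Finset (List ℕ)} {U : List ℕ} {n : ℕ} (hS : ∀ s ∈ S, s.length = n)
    (hU : U.length = S.card) (h : ∀ s ∈ S, ∃ r, HasRank U s r) {r : ℕ} (h1 : 1 ≤ r)
    (h2 : r ≤ U.length) : ∃ s ∈ S, HasRank U s r := by
  choose! f hf using h
  have : r ∈ S.image f := image_rank hS hU hf ▸ Finset.mem_Icc.2 ⟨h1, h2⟩
  obtain ⟨s, hs, rfl⟩ := Finset.mem_image.1 this
  exact ⟨s, hs, hf s hs⟩

theorem isUniversalCycle_of_exists {S : Finset (List ℕ)} {U : List ℕ} {n : ℕ} (hS : ∀ s ∈ S, s.length = n)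
    (hU : U.length = S.card) (h : ∀ s ∈ S, ∃ r, HasRank U s r) : IsUniversalCycle S U := by
  choose! f hf using h
  refine ⟨hU, fun s hs => ⟨f s, hf s hs, fun r hr => ?_⟩⟩
  have : r ∈ S.image f := image_rank hS hU hf ▸ Finset.mem_Icc.2 ⟨hr.1, hr.2.1⟩
  obtain ⟨t, ht, rfl⟩ := Finset.mem_image.1 this
  rw [eq_of_hasRank (hf t ht) hr ((hS t ht).trans (hS s hs).symm)]

theorem isUniversalCycle_granddaddy {k n w : ℕ} (hn : 1 ≤ n) (hk : 2 ≤ k) (hw : w < k * n) :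
    IsUniversalCycle (strings k n w) (granddaddy k n w) :=
  isUniversalCycle_of_exists (fun _ hs => (mem_strings.1 hs).1) (length_granddaddy (by omega))
    fun _ hs => exists_hasRank hn hk hw hs

theorem IsUniversalCycle.hasRank_iff {S : Finset (List ℕ)} {U s : List ℕ} (hU : IsUniversalCycle S U)
    (hs : s ∈ S) {r : ℕ} (h : HasRank U s r) (r' : ℕ) : HasRank U s r' ↔ r' = r :=
  ⟨fun h' => (hU.2 s hs).unique h' h, fun h' => h' ▸ h⟩

/-! ### Consecutive necklaces around a string -/

theorem pPart_suffix_prefix_of_split {n : ℕ} {β p q : List ℕ} (hβ : β.length = n)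
    (hn : p.length + q.length = n) (hp : p <:+ β) {e : ℕ} (he : q.length ≤ e) :
    β.getD e 0 = p.getD (e - q.length) 0 := by
  obtain ⟨r, rfl⟩ := hp
  rw [List.length_append] at hβ
  rw [List.getD_append_right _ _ _ _ (by omega)]
  congr 1
  omega

/-- The necklaces before `β₂` are exactly those that are read before the part `q`. -/
theorem IsGranddaddyPair.lt_iff_low {k n w : ℕ} (hk : 2 ≤ k) {s β₁ β₂ : List ℕ}
    (hs : s ∈ strings k n w) (h : IsGranddaddyPair k n s β₁ β₂) {u : List ℕ}
    (hu : u ∈ necklaces k n 0) : u < β₂ ↔ Low k s u := by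
  obtain ⟨⟨i, hi, h1, h2⟩, hp, hq⟩ := h
  set N := necklaces k n 0 with hN
  have hpw : N.Pairwise (· < ·) := pairwise_necklaces k n 0
  have hmono : ∀ a b, ∀ hab : a < b, ∀ hb : b < N.length, N[a]'(hab.trans hb) < N[b] := fun a b hab hb =>
    List.pairwise_iff_getElem.1 hpw a b _ _ hab
  have hmem : ∀ v ∈ N, v.length = n ∧ (∀ x ∈ v, 1 ≤ x ∧ x ≤ k) ∧ IsNecklace v := fun v hv =>
    ⟨(mem_strings.1 (mem_necklaces.1 hv).1).1, (mem_strings.1 (mem_necklaces.1 hv).1).2.1,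
      (mem_necklaces.1 hv).2⟩
  have hβ₁ : β₁ ∈ N := List.mem_of_getElem? h1
  have hβ₂ : β₂ ∈ N := List.mem_of_getElem? h2
  have hs0 : s ∈ strings k n 0 := mem_strings.2 ⟨(mem_strings.1 hs).1, (mem_strings.1 hs).2.1, by simp⟩
  have hα : neck s ∈ N := neck_mem_necklaces hs0
  have hlen := (mem_strings.1 hs).1
  have hpq : (pPart s).length + (qPart s).length = n := by
    rw [← hlen, ← List.length_append, pPart_append_qPart]
  have hβ₁l := (hmem _ hβ₁).1
  have hβ₂l := (hmem _ hβ₂).1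
  rw [List.getElem?_eq_getElem hi, Option.some.injEq] at h1
  -- Either `β₁` is the immediate predecessor of `β₂`, or the pair closes the cycle and `β₁` is the
  -- greatest and `β₂` the least necklace.
  have hcons : (i + 1 < N.length ∧ β₁ < β₂ ∧ ∀ v ∈ N, v < β₂ → v ≤ β₁) ∨
      ((∀ v ∈ N, v ≤ β₁) ∧ ∀ v ∈ N, β₂ ≤ v) := by
    rcases lt_or_ge (i + 1) N.length with hi' | hi'
    · left
      rw [Nat.mod_eq_of_lt hi', List.getElem?_eq_getElem hi', Option.some.injEq] at h2
      refine ⟨hi', ?_, fun v hv hlt => ?_⟩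
      · rw [← h1, ← h2]; exact hmono _ _ (by omega) hi'
      · obtain ⟨j, hj, rfl⟩ := List.mem_iff_getElem.1 hv
        have hji : j ≤ i := by
          by_contra! hij
          rcases eq_or_lt_of_le (show i + 1 ≤ j by omega) with he | he
          · subst he; exact absurd hlt (by rw [h2]; exact lt_irrefl _)
          · have := hmono _ _ he hj
            rw [h2] at this
            exact absurd hlt (not_lt.2 this.le)
        rw [← h1]
        rcases eq_or_lt_of_le hji with he | he
        · subst he; exact le_rfl
        · exact (hmono _ _ he hi).le
    · right
      have hi2 : i + 1 = N.length := by omega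
      rw [hi2, Nat.mod_self, List.getElem?_eq_getElem (by omega), Option.some.injEq] at h2
      constructor <;> intro v hv <;> obtain ⟨j, hj, rfl⟩ := List.mem_iff_getElem.1 hv
      · rw [← h1]
        rcases eq_or_lt_of_le (show j ≤ i by omega) with he | he
        · subst he; exact le_rfl
        · exact (hmono _ _ he hi).le
      · rw [← h2]
        rcases Nat.eq_zero_or_pos j with he | he
        · subst he; exact le_rfl
        · exact (hmono _ _ he hj).le
  by_cases hall : ∀ x ∈ pPart s, x = k
  · have hLow : Low k s u ↔ u < qPart s := by
      constructor
      · rintro (h | h)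
        · exact h.2
        · exact absurd hall h.1
      · exact fun h => Or.inl ⟨hall, h⟩
    rw [hLow]
    refine ⟨fun hlt => ?_, fun hlt => hlt.trans_le (prefix_le hq)⟩
    by_contra! hqu
    rcases hcons with ⟨-, hlt12, hcons⟩ | ⟨-, hmin⟩
    · have hpre : qPart s <+: β₁ := prefix_of_le_of_le hq (by omega)
        (hqu.trans (hcons u hu hlt)) hlt12.le
      -- Now `β₁` begins with `q` and ends with `p`, a power of `k`, so it is the greatest string
      -- with prefix `q` and cannot be below `β₂`.
      obtain ⟨d, hd, he, hdlt⟩ := (lt_iff_getD (by omega)).1 hlt12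
      rcases lt_or_ge d (qPart s).length with hdq | hdq
      · rw [← (prefix_iff_getD.1 hpre).2 d hdq, ← (prefix_iff_getD.1 hq).2 d hdq] at hdlt
        exact lt_irrefl _ hdlt
      · rw [pPart_suffix_prefix_of_split hβ₁l hpq hp hdq,
          hall _ (getD_mem (by omega))] at hdlt
        exact absurd hdlt (not_lt.2 ((hmem _ hβ₂).2.1 _ (getD_mem hd)).2)
    · exact absurd hlt (not_lt.2 (hmin u hu))
  · have hLow : Low k s u ↔ u ≤ neck s := by
      constructor
      · rintro (h | h)
        · exact absurd h.1 hall
        · exact h.2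
      · exact fun h => Or.inr ⟨hall, h⟩
    have hex : ∃ e, (qPart s).length ≤ e ∧ e < n ∧ β₁.getD e 0 ≠ k := by
      push Not at hall
      obtain ⟨x, hx, hxk⟩ := hall
      obtain ⟨j, hj, rfl⟩ := List.mem_iff_getElem.1 hx
      refine ⟨(qPart s).length + j, by omega, by omega, ?_⟩
      rw [pPart_suffix_prefix_of_split hβ₁l hpq hp (by omega), Nat.add_sub_cancel_left,
        List.getD_eq_getElem _ _ hj]
      exact hxk
    obtain ⟨e, heq, hen, hek⟩ := hex
    rcases hcons with ⟨-, hlt12, hcons⟩ | ⟨hmax, -⟩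
    -- The two necklaces agree on the length of `q`: if they differed earlier, raising the last
    -- symbol of `β₁` other than `k`, which lies in the part `p`, would give a necklace strictly
    -- between them. So `β₁` also begins with `q`, and equals `qp`.
    · have hβ₁α : β₁ = neck s := by
        refine eq_of_getD (by rw [length_neck]; omega) fun c hc => ?_
        rw [← qPart_append_pPart]
        rcases lt_or_ge c (qPart s).length with hcq | hcq
        · rw [List.getD_append _ _ _ _ hcq, (prefix_iff_getD.1 hq).2 c hcq]
          rcases eqOn_or_first_ne (fun e => β₁.getD e 0) (fun e => β₂.getD e 0)
            (qPart s).length with h | ⟨d, hd, hde, hdne⟩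
          · exact h c hcq
          · exfalso
            rcases lt_or_gt_of_ne hdne with hdlt | hdlt
            · obtain ⟨b, hb, hbk, hlast⟩ := exists_last_ne (n := n) (f := fun i => β₁.getD i 0)
                ⟨e, hen, hek⟩
              have heb : e ≤ b := by
                by_contra! h
                exact hek (hlast e h hen)
              have hbk' : β₁.getD b 0 < k :=
                lt_of_le_of_ne ((hmem _ hβ₁).2.1 _ (getD_mem (by omega))).2 hbk
              have hz := bump_mem_necklaces (c := β₁.getD b 0 + 1) (mem_necklaces.1 hβ₁).1 hb
                (PreNeck.of_isNecklace (hmem _ hβ₁).2.2 (by omega)) (by omega) (by omega)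
              refine absurd (hcons _ hz ?_) (not_le.2 (lt_bump hβ₁l hb (by omega)))
              refine (lt_iff_getD (by simp; omega)).2 ⟨d, by omega, fun e' he' => ?_, ?_⟩
              · rw [getD_bump (by omega), if_pos (by omega)]; exact hde e' he'
              · rw [getD_bump (by omega), if_pos (by omega)]; exact hdlt
            · refine absurd hlt12 (not_lt.2 ((lt_iff_getD (by omega)).2
                ⟨d, by omega, fun e' he' => (hde e' he').symm, hdlt⟩).le)
        · rw [List.getD_append_right _ _ _ _ hcq,
            pPart_suffix_prefix_of_split hβ₁l hpq hp hcq]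
      rw [hLow, ← hβ₁α]
      exact ⟨fun h => hcons u hu h, fun h => h.trans_lt hlt12⟩
    · exfalso
      have hle := hmax _ (replicate_mem_necklaces (by omega) (by simp))
      have := le_antisymm hle (le_replicate hβ₁l.le fun x hx => ((hmem _ hβ₁).2.1 x hx).2)
      rw [← this, getD_rep hen] at hek
      exact hek rfl

/-- Take the last `Low` necklace and the first one that is not. The latter exists because `k^n` is
never `Low`. If no necklace is `Low`, then `p` is a power of `k`, and `k^n`, the cyclic predecessor
of the first necklace, ends with it. -/
theorem exists_isGranddaddyPair {k n w : ℕ} (hk : 2 ≤ k) {s : List ℕ}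
    (hs : s ∈ strings k n w) : ∃ β₁ β₂, IsGranddaddyPair k n s β₁ β₂ := by
  have hs0 : s ∈ strings k n 0 := mem_strings.2 ⟨(mem_strings.1 hs).1, (mem_strings.1 hs).2.1, by simp⟩
  have hlen := (mem_strings.1 hs).1
  set N := necklaces k n 0 with hN
  set A := N.filter (Low k s ·) with hA
  set B := N.filter (¬ Low k s ·) with hB
  have hpw : N.Pairwise (· < ·) := pairwise_necklaces k n 0
  have hAB : N = A ++ B := filter_append_filter_not hpw _ fun _ _ huv => Low.mono huv
  have hAmem : ∀ u, u ∈ A ↔ u ∈ N ∧ Low k s u := fun u => by simp [hA]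
  have hBmem : ∀ u, u ∈ B ↔ u ∈ N ∧ ¬ Low k s u := fun u => by simp [hB]
  have hα : neck s ∈ N := neck_mem_necklaces hs0
  have hαs := mem_strings.1 (mem_necklaces.1 hα).1
  have hKN : List.replicate n k ∈ N := replicate_mem_necklaces (by omega) (by simp)
  have hK : List.replicate n k ∈ B := by
    refine (hBmem _).2 ⟨hKN, fun h => ?_⟩
    have h1 := le_antisymm h.le_neck (le_replicate hαs.1.le fun x hx => (hαs.2.1 x hx).2)
    have hps : ∀ x ∈ pPart s, x = k := fun x hx =>
      List.eq_of_mem_replicate (h1 ▸ (pPart_suffix_neck s).subset hx)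
    rcases h with h | h
    · have := h.2
      rw [h1] at this
      exact absurd this (not_lt.2 (prefix_le (qPart_prefix_neck s)))
    · exact h.1 hps
  obtain ⟨β, l, hβl⟩ := List.exists_cons_of_ne_nil (List.ne_nil_of_mem hK)
  have hβ : β ∈ B := by rw [hβl]; simp
  have hmin : ∀ u ∈ N, ¬ Low k s u → β ≤ u := by
    intro u hu hul
    have huB := (hBmem u).2 ⟨hu, hul⟩
    have hpB := hpw.filter (p := fun u => decide (¬ Low k s u))
    change List.Pairwise _ B at hpB
    rw [hβl] at huB hpB
    rcases List.mem_cons.1 huB with rfl | h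
    · exact le_rfl
    · exact ((List.pairwise_cons.1 hpB).1 u h).le
  have hq := qPart_prefix_of_least hs0 ((hBmem β).1 hβ).1 ((hBmem β).1 hβ).2 hmin
  by_cases hA0 : A = []
  · have hall : ∀ x ∈ pPart s, x = k := by
      by_contra h
      have : neck s ∈ A := (hAmem _).2 ⟨hα, Or.inr ⟨h, le_rfl⟩⟩
      rw [hA0] at this
      simp at this
    obtain ⟨N', x, hN', hx⟩ := exists_eq_concat_of_pairwise hpw (List.ne_nil_of_mem hα)
    have hxN : x ∈ N := by rw [hN']; simp
    have hxs := mem_strings.1 (mem_necklaces.1 hxN).1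
    have hxK : x = List.replicate n k :=
      le_antisymm (le_replicate hxs.1.le fun y hy => (hxs.2.1 y hy).2) (hx _ hKN)
    refine ⟨x, β, ⟨N'.length, ?_, ?_, ?_⟩, ?_, hq⟩
    · rw [← hN, hN']; simp
    · rw [← hN, hN']; simp
    · have : N.length = N'.length + 1 := by rw [hN']; simp
      rw [← hN, this, Nat.mod_self, hAB, hA0, hβl]
      rfl
    · rw [List.eq_replicate_iff.2 ⟨rfl, hall⟩, hxK, length_pPart]
      have hi := (splitIndex_spec s).1
      refine ⟨List.replicate (n - splitIndex s) k, ?_⟩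
      rw [← List.replicate_add]; congr 1; omega
  · obtain ⟨A', x, hA', hx⟩ := exists_eq_concat_of_pairwise
      (hpw.filter (p := fun u => decide (Low k s u))) hA0
    change A = A' ++ [x] at hA'
    have hxA : x ∈ A := by rw [hA']; simp
    have hsuf := pPart_suffix_of_greatest hs0 ((hAmem x).1 hxA).1 ((hAmem x).1 hxA).2
      fun u hu hul => hx u ((hAmem u).2 ⟨hu, hul⟩)
    have hNl : N.length = A'.length + 1 + (l.length + 1) := by
      rw [hAB, hA', hβl]; simp; omega
    refine ⟨x, β, ⟨A'.length, by rw [← hN]; omega, ?_, ?_⟩, hsuf.trans (ap_suffix x), hq⟩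
    · rw [← hN, hAB, hA']; simp
    · rw [← hN, Nat.mod_eq_of_lt (by omega), hAB, hA', hβl]; simp

/-- The necklaces below `β₂` are the `Low` ones, whatever the pair. This fixes `β₂`, and `β₁` is its
cyclic predecessor. -/
theorem existsUnique_isGranddaddyPair {k n w : ℕ} (hk : 2 ≤ k) {s : List ℕ}
    (hs : s ∈ strings k n w) : ∃! β : List ℕ × List ℕ, IsGranddaddyPair k n s β.1 β.2 := by
  obtain ⟨β₁, β₂, h⟩ := exists_isGranddaddyPair hk hs
  refine ⟨(β₁, β₂), h, ?_⟩
  rintro ⟨γ₁, γ₂⟩ h'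
  have hN := (pairwise_necklaces k n 0)
  have h2 : γ₂ = β₂ := by
    obtain ⟨⟨i, hi, -, hi2⟩, -⟩ := id h
    obtain ⟨⟨j, hj, -, hj2⟩, -⟩ := id h'
    have hβ := List.mem_of_getElem? hi2
    have hγ := List.mem_of_getElem? hj2
    rcases lt_trichotomy γ₂ β₂ with hlt | heq | hlt
    · have := (IsGranddaddyPair.lt_iff_low hk hs h hγ).1 hlt
      exact absurd ((IsGranddaddyPair.lt_iff_low hk hs h' hγ).2 this) (lt_irrefl _)
    · exact heq
    · have := (IsGranddaddyPair.lt_iff_low hk hs h' hβ).1 hlt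
      exact absurd ((IsGranddaddyPair.lt_iff_low hk hs h hβ).2 this) (lt_irrefl _)
  subst h2
  obtain ⟨⟨i, hi, hi1, hi2⟩, -⟩ := h
  obtain ⟨⟨j, hj, hj1, hj2⟩, -⟩ := h'
  have hnd : (necklaces k n 0).Nodup := hN.imp ne_of_lt
  set L := (necklaces k n 0).length
  have hm : (i + 1) % L = (j + 1) % L := by
    have hi' : (i + 1) % L < L := Nat.mod_lt _ (by omega)
    have hj' : (j + 1) % L < L := Nat.mod_lt _ (by omega)
    rw [List.getElem?_eq_getElem hi', Option.some.injEq] at hi2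
    rw [List.getElem?_eq_getElem hj', Option.some.injEq] at hj2
    exact (hnd.getElem_inj_iff).1 (hi2.trans hj2.symm)
  have hij : i = j := by
    have h1 : (i + 1) ≡ (j + 1) [MOD L] := hm
    have h2 := Nat.ModEq.add_right_cancel' 1 h1
    rwa [Nat.ModEq, Nat.mod_eq_of_lt hi, Nat.mod_eq_of_lt hj] at h2
  subst hij
  rw [hi1] at hj1
  rw [Option.some.inj hj1]

theorem IsGranddaddyPair.smallerCount_eq {k n w : ℕ} (hk : 2 ≤ k) {s β₁ β₂ : List ℕ}
    (hs : s ∈ strings k n w) (h : IsGranddaddyPair k n s β₁ β₂) :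
    smallerCount k n w β₂ = lowCount k n w s := by
  rw [smallerCount, lowCount]
  congr 1
  refine Finset.filter_congr fun u hu => ?_
  refine h.lt_iff_low hk hs (mem_necklaces.2 ⟨?_, isNecklace_neck u⟩)
  have := mem_strings.1 (neck_mem_strings hu)
  exact mem_strings.2 ⟨this.1, this.2.1, by simp⟩

/-! ### The order in which strings occur -/

theorem lt_of_getD {s t : List ℕ} {d : ℕ} (hs : d < s.length) (ht : d < t.length)
    (he : ∀ e < d, s.getD e 0 = t.getD e 0) (h : s.getD d 0 < t.getD d 0) : s < t := by
  refine List.lt_iff_exists.2 (Or.inr ⟨d, hs, ht, fun e hed => ?_, ?_⟩)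
  · have := he e hed
    rwa [List.getD_eq_getElem _ _ (hed.trans hs), List.getD_eq_getElem _ _ (hed.trans ht)] at this
  · rwa [List.getD_eq_getElem _ _ hs, List.getD_eq_getElem _ _ ht] at h

theorem getD_qPart (s : List ℕ) (e : ℕ) : (qPart s).getD e 0 = s.getD (splitIndex s + e) 0 := by
  simp [qPart, List.getD_eq_getElem?_getD, List.getElem?_drop]

theorem length_qPart (s : List ℕ) : (qPart s).length = s.length - splitIndex s := by simp [qPart]

theorem ext_neck (s : List ℕ) (e : ℕ) : ext (neck s) e = ext s (splitIndex s + e) := by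
  rw [← rotate_splitIndex, ext_rotate, add_comm]

theorem lowCount_mono {k n w : ℕ} {s s' : List ℕ} (h : neck s < qPart s') :
    lowCount k n w s ≤ lowCount k n w s' := by
  refine Finset.card_le_card (Finset.monotone_filter_right _ fun u _ hu => ?_)
  by_contra hu'
  exact absurd (le_of_not_low hu') (not_le.2 (hu.le_neck.trans_lt h))

/-- Increasing the last symbol of a string does not increase the length of the part `p`, and the
part `q` is larger than the old necklace. -/
theorem neck_lt_qPart_of_last_lt {s s' : List ℕ} {n : ℕ} (hs : s.length = n + 1) (hs' : s'.length = n + 1)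
    (heq : ∀ e < n, s.getD e 0 = s'.getD e 0) (hlt : s.getD n 0 < s'.getD n 0) :
    splitIndex s' ≤ splitIndex s ∧ neck s < qPart s' := by
  set i := splitIndex s with hi
  set j := splitIndex s' with hj
  have hsne : s ≠ [] := fun h => by rw [h] at hs; simp at hs
  have hsne' : s' ≠ [] := fun h => by rw [h] at hs'; simp at hs'
  have hin : i < n + 1 := by
    have h1 := splitIndex_lt hsne
    have h2 := (ap_prefix (neck s)).length_le
    rw [length_neck] at h2
    omega
  have hjn : j < n + 1 := by
    have h1 := splitIndex_lt hsne'
    have h2 := (ap_prefix (neck s')).length_le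
    rw [length_neck] at h2
    omega
  have hf : ∀ e < n, ext s e = ext s' e := fun e he => by
    rw [ext_of_lt (by omega), ext_of_lt (by omega), heq e he]
  have hl : ext s n < ext s' n := by rwa [ext_of_lt (by omega), ext_of_lt (by omega)]
  have hN := isNecklace_iff.1 (isNecklace_neck s)
  have hN' := isNecklace_iff.1 (isNecklace_neck s')
  -- Suppose `i < j`. Since the rotation of `s` at `i` is minimal, the symbols from `i` on do not
  -- exceed those from `j` on up to the last symbol, and that symbol only grows in passing to `s'`.
  -- So the rotation of `s'` at `i` would be smaller than its necklace.
  have hji : j ≤ i := by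
    by_contra! hij
    have hrot : s'.rotate i < s'.rotate j := by
      rcases eqOn_or_first_ne (fun e => ext s (i + e)) (fun e => ext s (j + e)) (n - j)
        with h | ⟨d, hd, he, hne⟩
      · refine (lt_iff_ext (by simp)).2 ⟨n - j, by simp; omega, fun e he => ?_, ?_⟩
        · rw [ext_rotate, ext_rotate, ← hf _ (by omega), ← hf _ (by omega), add_comm e i,
            add_comm e j, h e he]
        · rw [ext_rotate, ext_rotate, Nat.sub_add_cancel (by omega), ← hf _ (by omega)]
          refine lt_of_le_of_lt ?_ hl
          have := hN (j - i) (n - j) fun e he => by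
            rw [ext_neck, ext_neck, ← hi, h e he]; congr 1; omega
          rw [ext_neck, ext_neck, ← hi] at this
          have e1 : i + (j - i + (n - j)) = n := by omega
          rw [e1] at this
          rwa [add_comm (n - j) i]
      · refine (lt_iff_ext (by simp)).2 ⟨d, by simp; omega, fun e he' => ?_, ?_⟩
        · rw [ext_rotate, ext_rotate, ← hf _ (by omega), ← hf _ (by omega), add_comm e i,
            add_comm e j, he e he']
        · rw [ext_rotate, ext_rotate, ← hf _ (by omega), ← hf _ (by omega), add_comm d i,
            add_comm d j]
          have := hN (j - i) d fun e he' => by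
            rw [ext_neck, ext_neck, ← hi, he e he']; congr 1; omega
          rw [ext_neck, ext_neck, ← hi] at this
          have e1 : i + (j - i + d) = j + d := by omega
          rw [e1] at this
          exact lt_of_le_of_ne this hne
    have := neck_le (List.IsRotated.symm ⟨i, rfl⟩ : s'.rotate i ~r s')
    rw [hj, rotate_splitIndex] at hrot
    exact absurd this (not_le.2 hrot)
  refine ⟨hji, ?_⟩
  have key : ∀ d, d ≤ n - j → (∀ e < d, ext s (i + e) = ext s (j + e)) →
      ext s (i + d) < ext s' (j + d) → neck s < qPart s' := by
    intro d hd he hlt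
    refine lt_of_getD (d := d) (by rw [length_neck]; omega) (by rw [length_qPart]; omega)
      (fun e hed => ?_) ?_
    · rw [getD_qPart, ← ext_of_lt (by rw [length_neck]; omega), ← ext_of_lt (by omega), ext_neck,
        ← hi, ← hj, he e hed, hf _ (by omega)]
    · rw [getD_qPart, ← ext_of_lt (by rw [length_neck]; omega), ← ext_of_lt (by omega), ext_neck,
        ← hi, ← hj]
      exact hlt
  rcases eqOn_or_first_ne (fun e => ext s (i + e)) (fun e => ext s (j + e)) (n - j)
    with h | ⟨d, hd, he, hne⟩
  · rcases le_or_gt (ext s (i + (n - j))) (ext s n) with h1 | h1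
    · refine key (n - j) le_rfl h ?_
      have e1 : j + (n - j) = n := by omega
      rw [e1]
      exact h1.trans_lt hl
    · exfalso
      have hlt' : s.rotate j < s.rotate i := (lt_iff_ext (by simp)).2 ⟨n - j, by simp; omega,
        fun e he => by rw [ext_rotate, ext_rotate, add_comm e i, add_comm e j, h e he], by
          rw [ext_rotate, ext_rotate, Nat.sub_add_cancel (by omega), add_comm]; exact h1⟩
      rw [hi, rotate_splitIndex] at hlt'
      exact absurd (neck_le (List.IsRotated.symm ⟨j, rfl⟩ : s.rotate j ~r s)) (not_le.2 hlt')
  · rcases lt_or_gt_of_ne hne with h1 | h1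
    · refine key d hd.le he ?_
      rw [← hf _ (by omega)]
      exact h1
    · exfalso
      have hlt' : s.rotate j < s.rotate i := (lt_iff_ext (by simp)).2 ⟨d, by simp; omega,
        fun e he' => by rw [ext_rotate, ext_rotate, add_comm e i, add_comm e j, he e he'], by
          rw [ext_rotate, ext_rotate, add_comm d i, add_comm d j]; exact h1⟩
      rw [hi, rotate_splitIndex] at hlt'
      exact absurd (neck_le (List.IsRotated.symm ⟨j, rfl⟩ : s.rotate j ~r s)) (not_le.2 hlt')

/-- The factorization of `k^i a₁ ⋯ a_{n-1-i} y` where `a` is a necklace and `y > a_{n-i}`. -/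
theorem split_of_bump {k n i : ℕ} {α x : List ℕ} (hα : IsNecklace α) (hαl : α.length = n)
    (hαk : ∀ y ∈ α, y ≤ k) (hx : x.length = n) (hxk : ∀ y ∈ x, y ≤ k) (hi : i < n)
    (hne : x ≠ List.replicate n k)
    (hd : ∀ e < n - 1, x.getD e 0 = if e < i then k else α.getD (e - i) 0)
    (hlt : α.getD (n - 1 - i) 0 < x.getD (n - 1) 0) :
    splitIndex x = i ∧ (∀ y ∈ pPart x, y = k) ∧ ap (neck x) = neck x := by
  set z := bump k n (n - 1 - i) (x.getD (n - 1) 0) (fun e => α.getD e 0) with hz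
  have hrot : x.rotate i = z := by
    refine eq_of_ext (by simp [hz, hx]) fun e he => ?_
    rw [List.length_rotate, hx] at he
    have hze : ext z e = _ := ext_of_lt (by simpa [hz] using he)
    rw [ext_rotate, hze, hz, getD_bump he]
    rcases lt_trichotomy e (n - 1 - i) with h | h | h
    · rw [if_pos h, ext_of_lt (by omega), hd _ (by omega), if_neg (by omega), Nat.add_sub_cancel]
    · rw [if_neg (by omega), if_pos h, ext_of_lt (by omega)]
      congr 1
      omega
    · have e1 : e + i = (e + i - n) + x.length := by omega
      rw [if_neg (by omega), if_neg (by omega), e1, ext_add_length, ext_of_lt (by omega),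
        hd _ (by omega), if_pos (by omega)]
  have hyk : x.getD (n - 1) 0 ≤ k := hxk _ (getD_mem (by omega))
  have hstrict := strictNeck_bump_ext (k := k) (n := n) (c := x.getD (n - 1) 0)
    (by omega : n - 1 - i < n) (PreNeck.of_isNecklace hα (by omega)) hlt hyk
    fun e he => hαk _ (getD_mem (by omega))
  rw [← hz] at hstrict
  have hznr : z ≠ List.replicate n k := by
    intro h
    refine hne ?_
    have h1 : x ~r z := ⟨i, hrot⟩
    rw [h] at h1
    obtain ⟨j, hj⟩ := h1.symm
    rw [List.rotate_replicate] at hj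
    exact hj.symm
  have hzl : z.length = n := by simp [hz]
  have hzS : StrictNeck z.length (ext z) := hzl.symm ▸ hstrict.resolve_left hznr
  have hzN : IsNecklace z := hzS.isNecklace
  have hsplit : splitIndex x = i := by
    refine le_antisymm ((splitIndex_spec x).2.2 i (hrot ▸ hzN)) ?_
    -- Splitting earlier than `i` would give a necklace that starts with `k`, hence `k^n`.
    by_contra! hlt'
    have h1 := (splitIndex_spec x).2.1
    have h2 : (x.rotate (splitIndex x)).getD 0 0 = k := by
      rw [← ext_of_lt (by simp; omega), ext_rotate, zero_add, ext_of_lt (by omega),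
        hd _ (by omega), if_pos hlt']
    have h3 := eq_replicate_of_getD_zero h1 (fun y hy => hxk y (List.mem_rotate.1 hy)) h2
    rw [List.length_rotate, hx] at h3
    have h4 : x ~r List.replicate n k := ⟨_, h3⟩
    obtain ⟨j, hj⟩ := h4.symm
    rw [List.rotate_replicate] at hj
    exact hne hj.symm
  have hneck : neck x = z := by rw [← rotate_splitIndex, hsplit, hrot]
  refine ⟨hsplit, fun y hy => ?_, ?_⟩
  · obtain ⟨e, he, rfl⟩ := List.mem_iff_getElem.1 hy
    have he' : e < i := by rwa [length_pPart, hsplit] at he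
    have hpp : pPart x <+: x := List.take_prefix _ _
    rw [← List.getD_eq_getElem _ 0 he, (prefix_iff_getD.1 hpp).2 e he,
      hd _ (by omega), if_pos he']
  · rw [hneck]
    exact length_ap_of_strictNeck (fun h => by rw [h] at hzl; simp at hzl; omega) hzS

/-- As `p` is a power of `k`, the necklace of `t` is not `Low` for `t`, but it is `Low` for `s'`. It
is aperiodic, so all its `n` rotations are counted in addition. -/
theorem lowCount_add_le {k n w : ℕ} (hn : 1 ≤ n) {t s' : List ℕ} (ht : t ∈ strings k n w)
    (hp : ∀ y ∈ pPart t, y = k) (hap : ap (neck t) = neck t) (h : neck t < qPart s') :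
    lowCount k n w t + n ≤ lowCount k n w s' := by
  have hc := card_filter_neck_eq hn (isNecklace_neck t) (neck_mem_strings ht)
  rw [hap, length_neck, (mem_strings.1 ht).1] at hc
  have hdisj : Disjoint ((strings k n w).filter fun u => Low k t (neck u))
      ((strings k n w).filter fun u => neck u = neck t) := by
    rw [Finset.disjoint_filter]
    rintro u - hlow heq
    rw [heq] at hlow
    rcases hlow with h | h
    · exact absurd h.2 (not_lt.2 (prefix_le (qPart_prefix_neck t)))
    · exact h.1 hp
  have hle := Finset.card_le_card (s := ((strings k n w).filter fun u => Low k t (neck u)) ∪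
      ((strings k n w).filter fun u => neck u = neck t))
      (t := (strings k n w).filter fun u => Low k s' (neck u)) fun u hu => by
    rw [Finset.mem_union, Finset.mem_filter, Finset.mem_filter] at hu
    rw [Finset.mem_filter]
    refine ⟨hu.elim And.left And.left, ?_⟩
    by_contra hu'
    have h1 := le_of_not_low hu'
    rcases hu with hu | hu
    · exact absurd h1 (not_le.2 (hu.2.le_neck.trans_lt h))
    · rw [hu.2] at h1
      exact absurd h1 (not_le.2 h)
  rwa [Finset.card_union_of_disjoint hdisj, hc] at hle

/-! ### The sequence is the lexicographically smallest universal cycle -/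

theorem hasRank_iff_ext {U s : List ℕ} {r : ℕ} : HasRank U s r ↔
    1 ≤ r ∧ r ≤ U.length ∧ ∀ i < s.length, ext U (r - 1 + i) = s.getD i 0 := by
  refine and_congr_right fun h1 => and_congr_right fun h2 => forall₂_congr fun i hi => ?_
  have hm : (r - 1 + i) % U.length < U.length := Nat.mod_lt _ (by omega)
  rw [List.getElem?_eq_getElem hm, List.getElem?_eq_getElem hi, Option.some.injEq, ext,
    List.getD_eq_getElem _ _ hm, List.getD_eq_getElem _ _ hi]

/-- Every position is the rank of some string of `S`, so all windows of a universal cycle lie in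
`S`. -/
theorem IsUniversalCycle.word_mem {S : Finset (List ℕ)} {U : List ℕ} {n : ℕ}
    (hU : IsUniversalCycle S U) (hS : ∀ s ∈ S, s.length = n) {p : ℕ} (hp : p < U.length) :
    word n (fun i => ext U (p + i)) ∈ S ∧ HasRank U (word n fun i => ext U (p + i)) (p + 1) := by
  obtain ⟨s, hs, hr⟩ := exists_mem_of_hasRank hS hU.1 (fun s hs => (hU.2 s hs).exists)
    (show 1 ≤ p + 1 by omega) hp
  have : word n (fun i => ext U (p + i)) = s := by
    refine eq_of_getD (by simp [hS s hs]) fun e he => ?_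
    rw [length_word] at he
    rw [getD_word _ he, ← (hasRank_iff_ext.1 hr).2.2 e (by rw [hS s hs]; exact he)]
    rfl
  rw [this]
  exact ⟨hs, hr⟩

/-- A string that is not in the wraparound occurs before all strings of the wraparound, and its
position is determined by its factorization. -/
theorem rank_of_not_isWraparound {k n w : ℕ} (hn : 1 ≤ n) (hk : 2 ≤ k) (hw : w < k * n) {s : List ℕ}
    (hs : s ∈ strings k n w) (h : ¬ ∃ j, IsWraparound k n w s j) : splitIndex s ≤ lowCount k n w s ∧
    HasRank (granddaddy k n w) s (lowCount k n w s - splitIndex s + 1) := by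
  rcases hasRank_lowCount hn hk hw hs (fun he => h ⟨0, he ▸ replicate_isWraparound hn hk hw⟩)
    with h1 | h1
  · exact h1
  · exact absurd ⟨_, h1.2.2.2⟩ h

/-- The wraparound strings occupy the last `n` ranks, so a string whose rank is among these is
itself in the wraparound. -/
theorem rank_lt_of_isWraparound {k n w : ℕ} (hn : 1 ≤ n) (hk : 2 ≤ k) (hw : w < k * n)
    {s s' : List ℕ} (hs : s ∈ strings k n w) (hs' : s' ∈ strings k n w)
    (h : ¬ ∃ j, IsWraparound k n w s j) (h' : ∃ j, IsWraparound k n w s' j) {r r' : ℕ}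
    (hr : HasRank (granddaddy k n w) s r) (hr' : HasRank (granddaddy k n w) s' r') : r < r' := by
  have hU := isUniversalCycle_granddaddy hn hk hw
  obtain ⟨α, hα, -⟩ := exists_first_necklace hn hk hw
  obtain ⟨j, hj⟩ := h'
  rw [hU.hasRank_iff hs' (hasRank_of_isWraparound hn hk hw hj)] at hr'
  by_contra! hle
  have hM := le_card_strings hn hk hw
  have hrM := hr.2.1
  rw [hU.1] at hrM
  have hjn := hj.1
  obtain ⟨α, hα, -⟩ := exists_first_necklace hn hk hw
  -- The index `j = r + n - 1 - |S|` solves `|S| - (n - j) + 1 = r`.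
  have hwr : IsWraparound k n w (List.replicate (n - (r + n - 1 - (strings k n w).card)) k ++
      α.take (r + n - 1 - (strings k n w).card)) (r + n - 1 - (strings k n w).card) :=
    ⟨by omega, α, hα, rfl⟩
  have hr2 := hasRank_of_isWraparound hn hk hw hwr
  have e1 : (strings k n w).card - (n - (r + n - 1 - (strings k n w).card)) + 1 = r := by omega
  rw [e1] at hr2
  have hαl : α.length = n := by
    have := List.mem_of_mem_head? hα
    exact (mem_strings.1 (mem_necklaces.1 this).1).1
  have := eq_of_hasRank hr hr2 (by simp [(mem_strings.1 hs).1, hαl]; omega)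
  exact h ⟨_, this ▸ hwr⟩

/-- Among strings that differ only in the last symbol, the smaller one occurs first, unless it is in
the wraparound. -/
theorem rank_lt_of_last_lt {k n w : ℕ} (hk : 2 ≤ k) (hw : w < k * (n + 1))
    {s s' : List ℕ} (hs : s ∈ strings k (n + 1) w) (hs' : s' ∈ strings k (n + 1) w)
    (h : ¬ ∃ j, IsWraparound k (n + 1) w s j)
    (heq : ∀ e < n, s.getD e 0 = s'.getD e 0) (hlt : s.getD n 0 < s'.getD n 0) {r r' : ℕ}
    (hr : HasRank (granddaddy k (n + 1) w) s r) (hr' : HasRank (granddaddy k (n + 1) w) s' r') :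
    r < r' := by
  by_cases h' : ∃ j, IsWraparound k (n + 1) w s' j
  · exact rank_lt_of_isWraparound (by omega) hk hw hs hs' h h' hr hr'
  · have hU := isUniversalCycle_granddaddy (by omega) hk hw
    have h1 := rank_of_not_isWraparound (by omega) hk hw hs h
    have h2 := rank_of_not_isWraparound (by omega) hk hw hs' h'
    have hl := (mem_strings.1 hs).1
    have hl' := (mem_strings.1 hs').1
    obtain ⟨h3, h4⟩ := neck_lt_qPart_of_last_lt hl hl' heq hlt
    have h5 := lowCount_mono (k := k) (n := n + 1) (w := w) h4
    have hne : r ≠ r' := by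
      rintro rfl
      rw [eq_of_hasRank hr hr' (by omega)] at hlt
      exact lt_irrefl _ hlt
    rw [hU.hasRank_iff hs h1.2] at hr
    rw [hU.hasRank_iff hs' h2.2] at hr'
    omega

/-- Strings that leave the wraparound later, with a larger symbol, occur earlier. -/
theorem rank_lt_of_leave_wraparound {k n w i i' : ℕ} (hn : 1 ≤ n) (hk : 2 ≤ k) (hw : w < k * n)
    {α s' t : List ℕ} (hα : (necklaces k n w).head? = some α) (hαk : α.getD 0 0 < k)
    (hs' : s' ∈ strings k n w) (ht : t ∈ strings k n w) (hi : i' < i) (hin : i < n)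
    (hd' : ∀ e < n - 1, s'.getD e 0 = if e < i then k else α.getD (e - i) 0)
    (hlt' : α.getD (n - 1 - i) 0 < s'.getD (n - 1) 0)
    (hd : ∀ e < n - 1, t.getD e 0 = if e < i' then k else α.getD (e - i') 0)
    (hlt : α.getD (n - 1 - i') 0 < t.getD (n - 1) 0) {r r' : ℕ}
    (hr : HasRank (granddaddy k n w) t r) (hr' : HasRank (granddaddy k n w) s' r') : r < r' := by
  have hαm := mem_necklaces.1 (List.mem_of_mem_head? hα)
  have hαs := mem_strings.1 hαm.1
  have hsl := (mem_strings.1 hs').1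
  have htl := (mem_strings.1 ht).1
  have ht0 : t.getD i' 0 = α.getD 0 0 := by
    rw [hd i' (by omega), if_neg (by omega), Nat.sub_self]
  -- In a wraparound string, the number of leading symbols `k` determines the rest because `α`
  -- starts with a smaller symbol; for `t` this number is `i'`, but its last symbol is larger than
  -- prescribed.
  have htw : ¬ ∃ j, IsWraparound k n w t j := by
    rintro ⟨j, hj, β, hβ, hjt⟩
    obtain rfl : α = β := by rw [hα] at hβ; exact Option.some.inj hβ
    have hdig : ∀ e < n, t.getD e 0 = if e < n - j then k else α.getD (e - (n - j)) 0 := by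
      intro e he
      rw [hjt]
      split_ifs with h
      · rw [List.getD_append _ _ _ _ (by simpa using h), getD_rep h]
      · rw [List.getD_append_right _ _ _ _ (by simp; omega), List.length_replicate]
        exact (prefix_iff_getD.1 (List.take_prefix j α)).2 _ (by simp; omega)
    have h1 : n - j ≤ i' := by
      by_contra! h
      rw [hdig i' (by omega), if_pos h] at ht0
      omega
    have h2 : i' ≤ n - j := by
      by_contra! h
      have h3 := hdig (n - j) (by omega)
      rw [if_neg (by omega), Nat.sub_self, hd _ (by omega), if_pos h] at h3
      omega
    have h3 := hdig (n - 1) (by omega)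
    rw [if_neg (by omega), le_antisymm h1 h2] at h3
    omega
  by_cases hw' : ∃ j, IsWraparound k n w s' j
  · exact rank_lt_of_isWraparound hn hk hw ht hs' htw hw' hr hr'
  · have hU := isUniversalCycle_granddaddy hn hk hw
    have h1 := rank_of_not_isWraparound hn hk hw ht htw
    have h2 := rank_of_not_isWraparound hn hk hw hs' hw'
    have hne : s' ≠ List.replicate n k := fun h => hw' ⟨0, h ▸ replicate_isWraparound hn hk hw⟩
    have hnet : t ≠ List.replicate n k := fun h => htw ⟨0, h ▸ replicate_isWraparound hn hk hw⟩
    have hak : ∀ y ∈ α, y ≤ k := fun y hy => (hαs.2.1 y hy).2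
    obtain ⟨g1, -, -⟩ := split_of_bump hαm.2 hαs.1 hak hsl
      (fun y hy => ((mem_strings.1 hs').2.1 y hy).2) hin hne hd' hlt'
    obtain ⟨f1, f2, f3⟩ := split_of_bump hαm.2 hαs.1 hak htl
      (fun y hy => ((mem_strings.1 ht).2.1 y hy).2) (hi.trans hin) hnet hd hlt
    have hnq : neck t < qPart s' := by
      have hnt : ∀ e < n - 1 - i', (neck t).getD e 0 = α.getD e 0 := by
        intro e he
        rw [← ext_of_lt (by rw [length_neck]; omega), ext_neck, f1, ext_of_lt (by omega),
          hd _ (by omega), if_neg (by omega), Nat.add_sub_cancel_left]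
      refine lt_of_getD (d := n - 1 - i) (by rw [length_neck]; omega) (by rw [length_qPart, g1]; omega)
        (fun e he => ?_) ?_
      · rw [hnt e (by omega), getD_qPart, g1, hd' _ (by omega), if_neg (by omega),
          Nat.add_sub_cancel_left]
      · rw [hnt _ (by omega), getD_qPart, g1]
        have e1 : i + (n - 1 - i) = n - 1 := by omega
        rwa [e1]
    -- The ranks are `lowCount - |p| + 1`. Passing from `t` to `s'` adds at least `n` to the count
    -- and subtracts only `i - i' < n` for the longer `p`.
    have h5 := lowCount_add_le hn ht f2 f3 hnq
    rw [hU.hasRank_iff ht h1.2] at hr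
    rw [hU.hasRank_iff hs' h2.2] at hr'
    omega

/-- Compares a smaller universal cycle `U` with the sequence `G` at the first difference. Strings
have length `n + 1` here, so that `n` is the index of the last symbol. -/
theorem granddaddy_le {k n w : ℕ} (hk : 2 ≤ k) (hw : w < k * (n + 1)) {U : List ℕ}
    (hU : IsUniversalCycle (strings k (n + 1) w) U) : granddaddy k (n + 1) w ≤ U := by
  by_contra! hlt
  have hG := isUniversalCycle_granddaddy (by omega) hk hw
  have hM := le_card_strings (n := n + 1) (by omega) hk hw
  obtain ⟨α, hα, hαm, hαK, hαmin, hαG⟩ := exists_first_necklace (n := n + 1) (by omega) hk hw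
  set G := granddaddy k (n + 1) w with hGdef
  have hS : ∀ s ∈ strings k (n + 1) w, s.length = n + 1 := fun s hs => (mem_strings.1 hs).1
  have hUG : U.length = G.length := hU.1.trans hG.1.symm
  have hUM := hU.1
  obtain ⟨hαS, hαN⟩ := mem_necklaces.1 hαm
  have hαs := mem_strings.1 hαS
  have hαk : α.getD 0 0 < k := by
    refine lt_of_le_of_ne (hαs.2.1 _ (getD_mem (by omega))).2 fun h => hαK ?_
    have := eq_replicate_of_getD_zero hαN (fun y hy => (hαs.2.1 y hy).2) h
    rwa [hαs.1] at this
  have hαle : ∀ s ∈ strings k (n + 1) w, α ≤ s := fun s hs =>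
    (hαmin _ (neck_mem_necklaces hs)).trans (neck_le (List.IsRotated.refl s))
  obtain ⟨m, hm, heq, hm'⟩ := (lt_iff_ext hUG).1 hlt
  have hGα : ∀ e < n + 1, ext G e = α.getD e 0 := fun e he => by
    rw [ext_of_lt (by omega), ← (prefix_iff_getD.1 hαG).2 e (by omega)]
  -- `G` begins with the first necklace, which is the least of all strings, so `U` cannot be smaller
  -- within the first window.
  have hnm : n + 1 ≤ m := by
    by_contra! h
    obtain ⟨h1, -⟩ := hU.word_mem hS (show 0 < U.length by omega)
    refine absurd (hαle _ h1) (not_le.2 (lt_of_getD (d := m) (by simpa using h) (by omega)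
      (fun e he => ?_) ?_))
    · rw [getD_word _ (by omega), zero_add, heq e he, hGα e (by omega)]
    · rw [getD_word _ h, zero_add, ← hGα m h]
      exact hm'
  obtain ⟨p, rfl⟩ : ∃ p, m = p + n := ⟨m - n, by omega⟩
  obtain ⟨hsS, hsU⟩ := hU.word_mem hS (show p < U.length by omega)
  obtain ⟨hsS', hsG'⟩ := hG.word_mem hS (show p < G.length by omega)
  set s := word (n + 1) (fun i => ext U (p + i)) with hs
  set s' := word (n + 1) (fun i => ext G (p + i)) with hs'
  have hsd : ∀ e < n + 1, s.getD e 0 = ext U (p + e) := fun e he => getD_word _ he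
  have hsd' : ∀ e < n + 1, s'.getD e 0 = ext G (p + e) := fun e he => getD_word _ he
  have hss : ∀ e < n, s.getD e 0 = s'.getD e 0 := fun e he => by
    rw [hsd e (by omega), hsd' e (by omega), heq _ (by omega)]
  have hsl : s.getD n 0 < s'.getD n 0 := by
    rw [hsd n (by omega), hsd' n (by omega)]; exact hm'
  -- Windows that start before position `p` end before the first difference, so both cycles have the
  -- same strings there.
  have hearly : ∀ t ∈ strings k (n + 1) w, ∀ r, HasRank G t r → r < p + 1 → HasRank U t r := by
    intro t ht r hr hrp
    obtain ⟨h1, h2, h3⟩ := hasRank_iff_ext.1 hr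
    refine hasRank_iff_ext.2 ⟨h1, by omega, fun i hi => ?_⟩
    rw [hS t ht] at hi
    rw [← h3 i (by rw [hS t ht]; exact hi), heq _ (by omega)]
  have hnear : ∀ t ∈ strings k (n + 1) w, ∀ r, HasRank G t r → ∀ r', HasRank U t r' → p + 1 ≤ r' →
      p + 1 ≤ r := by
    intro t ht r hr r' hr' hpr
    by_contra! h
    have := (hU.2 t ht).unique (hearly t ht r hr h) hr'
    omega
  obtain ⟨rs, hrs⟩ := exists_hasRank (by omega) hk hw hsS
  -- Outside the wraparound, `s` would precede `s'` in `G`, hence also occur in `U` before position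
  -- `p + 1`, where it is read a second time.
  have hwrap : ∃ j, IsWraparound k (n + 1) w s j := by
    by_contra h
    have h1 := rank_lt_of_last_lt hk hw hsS hsS' h hss hsl hrs hsG'
    have h2 := hnear s hsS rs hrs _ hsU le_rfl
    omega
  obtain ⟨j, hj, β, hβ, hjs⟩ := hwrap
  obtain rfl : α = β := by rw [hα] at hβ; exact Option.some.inj hβ
  obtain ⟨i, hi⟩ : ∃ i, i = n + 1 - j := ⟨_, rfl⟩
  have hdig : ∀ e < n + 1, ext U (p + e) = if e < i then k else α.getD (e - i) 0 := by
    intro e he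
    rw [← hsd e he, hjs, ← hi]
    split_ifs with h
    · rw [List.getD_append _ _ _ _ (by simpa using h), getD_rep h]
    · rw [List.getD_append_right _ _ _ _ (by simp; omega), List.length_replicate]
      exact (prefix_iff_getD.1 (List.take_prefix j α)).2 _ (by simp; omega)
  have hs'k : s'.getD n 0 ≤ k := ((mem_strings.1 hsS').2.1 _ (getD_mem (by simp [hs']))).2
  have hin : i < n + 1 := by
    by_contra! h
    have := hdig n (by omega)
    rw [if_pos (by omega), ← hsd n (by omega)] at this
    omega
  have hd' : ∀ e < n + 1 - 1, s'.getD e 0 = if e < i then k else α.getD (e - i) 0 := fun e he => by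
    rw [← hss e (by omega), hsd e (by omega), hdig e (by omega)]
  have hlt' : α.getD (n + 1 - 1 - i) 0 < s'.getD (n + 1 - 1) 0 := by
    have := hdig n (by omega)
    rw [if_neg (by omega), ← hsd n (by omega)] at this
    rw [Nat.add_sub_cancel, ← this]
    exact hsl
  -- Shifting the window by `l` removes `l` leading symbols `k`; the symbols that enter are forced
  -- to continue the first necklace.
  have hind : ∀ l ≤ i, ∀ e < n + 1, ext U (p + l + e) =
      if e < i - l then k else α.getD (e - (i - l)) 0 := by
    intro l
    induction l with
    | zero => exact fun _ => hdig
    | succ l ih =>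
      intro hl
      have ih := ih (by omega)
      have hpl : p + (l + 1) < U.length := by omega
      obtain ⟨htS, htU⟩ := hU.word_mem hS hpl
      set t := word (n + 1) (fun i => ext U (p + (l + 1) + i)) with ht
      have htd : ∀ e < n + 1, t.getD e 0 = ext U (p + (l + 1) + e) := fun e he => getD_word _ he
      have hd : ∀ e < n + 1 - 1, t.getD e 0 =
          if e < i - (l + 1) then k else α.getD (e - (i - (l + 1))) 0 := by
        intro e he
        have h1 := ih (e + 1) (by omega)
        have e1 : p + l + (e + 1) = p + (l + 1) + e := by omega
        rw [e1] at h1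
        rw [htd e (by omega), h1]
        split_ifs with h2 h3 h3
        · rfl
        · omega
        · omega
        · congr 1; omega
      have hlast : t.getD n 0 = α.getD (n - (i - (l + 1))) 0 := by
        rcases lt_trichotomy (t.getD n 0) (α.getD (n - (i - (l + 1))) 0) with h | h | h
        · exfalso
          have hrot : t.rotate (i - (l + 1)) ∈ strings k (n + 1) w :=
            mem_strings_of_isRotated (List.IsRotated.symm ⟨_, rfl⟩) htS
          have htl : t.length = n + 1 := by simp [ht]
          refine absurd (hαle _ hrot) (not_le.2 (lt_of_getD (d := n - (i - (l + 1)))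
            (by simp [htl]) (by omega) (fun e he => ?_) ?_))
          · rw [← ext_of_lt (by simp [htl]; omega), ext_rotate, ext_of_lt (by omega),
              hd _ (by omega), if_neg (by omega), Nat.add_sub_cancel]
          · rw [← ext_of_lt (by simp [htl]), ext_rotate, ext_of_lt (by omega),
              Nat.sub_add_cancel (by omega)]
            exact h
        · exact h
        -- With a larger symbol, `t` leaves the wraparound with fewer symbols `k` than `s'`, so it
        -- precedes `s'` in `G` and would occur twice in `U`.
        · exfalso
          obtain ⟨r, hr⟩ := exists_hasRank (by omega) hk hw htS
          have h1 := rank_lt_of_leave_wraparound (by omega) hk hw hα hαk hsS' htS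
            (show i - (l + 1) < i by omega) hin hd' hlt' hd
            (by rw [Nat.add_sub_cancel]; exact h) hr hsG'
          have h2 := hnear t htS r hr _ htU (by omega)
          omega
      intro e he
      rw [← htd e he]
      rcases lt_or_ge e n with h | h
      · exact hd e (by omega)
      · obtain rfl : e = n := by omega
        rw [hlast, if_neg (by omega)]
  -- After `i` shifts the window is the first necklace, which `U` also has at its start: two
  -- occurrences of the same string.
  have hpi : p + i < U.length := by omega
  have h1 : HasRank U α (p + i + 1) := by
    refine hasRank_iff_ext.2 ⟨by omega, by omega, fun e he => ?_⟩
    have := hind i le_rfl e (by omega)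
    rwa [Nat.sub_self, if_neg (by omega), Nat.sub_zero] at this
  have h2 : HasRank U α 1 := by
    refine hasRank_iff_ext.2 ⟨le_rfl, by omega, fun e he => ?_⟩
    rw [Nat.sub_self, zero_add, heq e (by omega), hGα e (by omega)]
  have := (hU.2 α hαS).unique h1 h2
  omega

/-! ### Counting strings all of whose rotations exceed a given string -/

/-- Read from position `i`, the sequence `f` first differs from `x` after `d` symbols,
and is larger there. -/
def Exceeds (x f : ℕ → ℕ) (i d : ℕ) : Prop := (∀ e < d, f (i + e) = x e) ∧ x d < f (i + d)

theorem Exceeds.unique {x f : ℕ → ℕ} {i d d' : ℕ} (h : Exceeds x f i d) (h' : Exceeds x f i d') :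
    d = d' := by
  rcases lt_trichotomy d d' with hlt | heq | hlt
  · have h1 := h'.1 d hlt; have h2 := h.2; omega
  · exact heq
  · have h1 := h.1 d' hlt; have h2 := h'.2; omega

theorem Exceeds.congr {x f g : ℕ → ℕ} {i j d : ℕ} (h : Exceeds x f i d)
    (hfg : ∀ e ≤ d, f (i + e) = g (j + e)) : Exceeds x g j d :=
  ⟨fun e he => by rw [← hfg e he.le, h.1 e he], by rw [← hfg d le_rfl]; exact h.2⟩

/-- If `f` exceeds `x` at `i`, then it does so no later when read from a position in between. -/
theorem Exceeds.shift {x f : ℕ → ℕ} {i d e : ℕ} (hx : PreNeck (d + 1) x) (h : Exceeds x f i d)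
    (he : e ≤ d) : ∃ d', e + d' ≤ d ∧ Exceeds x f (i + e) d' := by
  rcases Nat.eq_zero_or_pos e with rfl | he0
  · exact ⟨d, by omega, h⟩
  rcases eqOn_or_first_ne (fun c => x (e + c)) x (d - e) with h1 | ⟨c, hc, hce, hne⟩
  · refine ⟨d - e, by omega, fun c hc => ?_, ?_⟩
    · rw [← h1 c hc, ← h.1 (e + c) (by omega), add_assoc]
    · have h2 := hx e (d - e) (by omega) h1
      rw [Nat.add_sub_cancel' he] at h2
      rw [add_assoc, Nat.add_sub_cancel' he]
      exact h2.trans_lt h.2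
  · refine ⟨c, by omega, fun c' hc' => ?_, ?_⟩
    · rw [← hce c' hc', ← h.1 (e + c') (by omega), add_assoc]
    · have h2 := hx e c (by omega) hce
      rw [add_assoc, h.1 (e + c) (by omega)]
      exact lt_of_le_of_ne h2 (Ne.symm hne)

/-- The strings of length `t` and weight at least `v` that exceed `x` from every position
before their end. -/
noncomputable def exceeding (k : ℕ) (x : ℕ → ℕ) (t v : ℕ) : Finset (List ℕ) := by
  classical
  exact (strings k t v).filter fun g => ∀ i < t, ∃ d, i + d < t ∧ Exceeds x (fun e => g.getD e 0) i d

theorem mem_exceeding {k : ℕ} {x : ℕ → ℕ} {t v : ℕ} {g : List ℕ} : g ∈ exceeding k x t v ↔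
    g ∈ strings k t v ∧ ∀ i < t, ∃ d, i + d < t ∧ Exceeds x (fun e => g.getD e 0) i d := by
  classical
  rw [exceeding, Finset.mem_filter]

/-- The string `x₀ ⋯ x_{j-1} c` followed by `g`. -/
def block (x : ℕ → ℕ) (j c : ℕ) (g : List ℕ) : List ℕ := word j x ++ c :: g

@[simp] theorem length_block (x : ℕ → ℕ) (j c : ℕ) (g : List ℕ) :
    (block x j c g).length = j + (g.length + 1) := by simp [block]

theorem getD_block_lt {x : ℕ → ℕ} {j c e : ℕ} {g : List ℕ} (h : e < j) :
    (block x j c g).getD e 0 = x e := by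
  rw [block, List.getD_append _ _ _ _ (by simpa using h), getD_word _ h]

theorem getD_block_self {x : ℕ → ℕ} {j c : ℕ} {g : List ℕ} : (block x j c g).getD j 0 = c := by
  rw [block, List.getD_append_right _ _ _ _ (by simp)]
  simp

theorem getD_block_gt {x : ℕ → ℕ} {j c e : ℕ} {g : List ℕ} :
    (block x j c g).getD (j + 1 + e) 0 = g.getD e 0 := by
  rw [block, List.getD_append_right _ _ _ _ (by simp; omega)]
  rw [length_word, show j + 1 + e - j = e + 1 by omega, List.getD_cons_succ]

theorem exceeds_block {x : ℕ → ℕ} {j c : ℕ} {g : List ℕ} (h : x j < c) :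
    Exceeds x (fun e => (block x j c g).getD e 0) 0 j :=
  ⟨fun e he => by simp only [zero_add]; exact getD_block_lt he,
    by simp only [zero_add]; rwa [getD_block_self]⟩

theorem block_inj {x : ℕ → ℕ} {j j' c c' : ℕ} {g g' : List ℕ} (h : x j < c) (h' : x j' < c')
    (he : block x j c g = block x j' c' g') : j = j' ∧ c = c' ∧ g = g' := by
  have h1 := exceeds_block (g := g) h
  have h2 := exceeds_block (g := g') h'
  rw [he] at h1
  obtain rfl := h1.unique h2
  rw [block, block, List.append_cancel_left_eq, List.cons.injEq] at he
  exact ⟨rfl, he⟩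

/-- From positions up to `j` the string exceeds `x` no later than position `j`, by `Exceeds.shift`;
from later positions this is inherited from `g`. The truncated subtraction drops the weight demand
to 0 once `x₀ ⋯ x_{j-1} c` already meets it. -/
theorem block_mem_exceeding {k n t v j c : ℕ} {x : ℕ → ℕ} {g : List ℕ} (hx : PreNeck n x)
    (htn : t ≤ n) (hxk : ∀ e < n, x e ≤ k) (hx0 : ∀ e < j, 1 ≤ x e) (hj : j < t) (hc : x j < c)
    (hck : c ≤ k) (hg : g ∈ exceeding k x (t - 1 - j) (v - (∑ e ∈ Finset.range j, x e + c))) :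
    block x j c g ∈ exceeding k x t v := by
  obtain ⟨hgS, hgE⟩ := mem_exceeding.1 hg
  obtain ⟨hgl, hgd, hgw⟩ := mem_strings.1 hgS
  refine mem_exceeding.2 ⟨mem_strings.2 ⟨by simp [hgl]; omega, fun y hy => ?_, ?_⟩, fun i hi => ?_⟩
  · rw [block, List.mem_append, List.mem_cons, mem_word] at hy
    rcases hy with ⟨e, he, rfl⟩ | rfl | hy
    · exact ⟨hx0 e he, hxk e (by omega)⟩
    · omega
    · exact hgd y hy
  · rw [block, List.sum_append, List.sum_cons, sum_word]
    omega
  · rcases le_or_gt i j with hij | hij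
    · obtain ⟨d, hd, hd'⟩ := (exceeds_block (g := g) hc).shift (hx.mono (by omega)) hij
      rw [zero_add] at hd'
      exact ⟨d, by omega, hd'⟩
    · obtain ⟨d, hd, hd'⟩ := hgE (i - (j + 1)) (by omega)
      refine ⟨d, by omega, hd'.congr fun e _ => ?_⟩
      rw [← getD_block_gt (x := x) (j := j) (c := c)]
      congr 1
      omega

theorem exists_block {k t v : ℕ} {x : ℕ → ℕ} {G : List ℕ} (hG : G ∈ exceeding k x t v) {j : ℕ}
    (hj : j < t) (h : Exceeds x (fun e => G.getD e 0) 0 j) : ∃ c g, x j < c ∧ c ≤ k ∧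
    g ∈ exceeding k x (t - 1 - j) (v - (∑ e ∈ Finset.range j, x e + c)) ∧ G = block x j c g := by
  obtain ⟨hGS, hGE⟩ := mem_exceeding.1 hG
  obtain ⟨hGl, hGd, hGw⟩ := mem_strings.1 hGS
  have h1 := h.1
  have h2 := h.2
  simp only [zero_add] at h1 h2
  have hdrop : ∀ e, (G.drop (j + 1)).getD e 0 = G.getD (j + 1 + e) 0 := fun e => by
    simp [List.getD_eq_getElem?_getD, List.getElem?_drop]
  have heq : G = block x j (G.getD j 0) (G.drop (j + 1)) := by
    refine eq_of_getD (by simp [hGl]; omega) fun e he => ?_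
    rcases lt_trichotomy e j with hej | rfl | hej
    · rw [getD_block_lt hej, h1 e hej]
    · rw [getD_block_self]
    · rw [show e = j + 1 + (e - (j + 1)) by omega, getD_block_gt, hdrop]
  refine ⟨G.getD j 0, G.drop (j + 1), h2, (hGd _ (getD_mem (by omega))).2,
    mem_exceeding.2 ⟨mem_strings.2 ⟨by simp [hGl]; omega, fun y hy => hGd y (List.mem_of_mem_drop hy), ?_⟩,
      fun i hi => ?_⟩, heq⟩
  · have h3 : G.sum = (block x j (G.getD j 0) (G.drop (j + 1))).sum := by rw [← heq]
    rw [block, List.sum_append, List.sum_cons, sum_word] at h3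
    omega
  · obtain ⟨d, hd, hd'⟩ := hGE (j + 1 + i) (by omega)
    refine ⟨d, by omega, hd'.congr fun e _ => ?_⟩
    rw [hdrop]
    congr 1
    omega

theorem card_exceeding_zero (k : ℕ) (x : ℕ → ℕ) (v : ℕ) :
    (exceeding k x 0 v).card = if v = 0 then 1 else 0 := by
  have : exceeding k x 0 v = if v = 0 then {[]} else ∅ := by
    ext g
    rw [mem_exceeding, mem_strings, List.length_eq_zero_iff]
    split_ifs with h
    · simp only [Finset.mem_singleton]
      constructor
      · exact fun h => h.1.1
      · rintro rfl; simp [h]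
    · simp only [Finset.notMem_empty, iff_false, not_and]
      rintro ⟨rfl, -, h2⟩
      simp at h2
      exact absurd h2 h
  rw [this]
  split_ifs <;> simp

/-- Cut at the position `j` where the string first exceeds `x`. The symbol there is one of `x j + 1,
…, k`, and the remainder satisfies the same condition with shorter length and reduced weight demand.
-/
theorem card_exceeding {k n t v : ℕ} {x : ℕ → ℕ} (hx : PreNeck n x) (htn : t ≤ n) (ht : 1 ≤ t)
    (hxk : ∀ e < n, x e ≤ k) (hx0 : ∀ j < n, x j < k → ∀ e < j, 1 ≤ x e) :
    (exceeding k x t v).card = ∑ j ∈ Finset.range t, ∑ i ∈ Finset.range (k - x j),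
      (exceeding k x (t - 1 - j) (v - (∑ e ∈ Finset.range (j + 1), x e + 1 + i))).card := by
  have hA : ∀ j i, ∑ e ∈ Finset.range (j + 1), x e + 1 + i =
      ∑ e ∈ Finset.range j, x e + (x j + 1 + i) := fun j i => by
    rw [Finset.sum_range_succ]; omega
  simp only [hA]
  simp only [← Finset.card_sigma]
  symm
  refine Finset.card_bij (fun p _ => block x p.1 (x p.1 + 1 + p.2.1) p.2.2) ?_ ?_ ?_
  · rintro ⟨j, i, g⟩ hp
    simp only [Finset.mem_sigma, Finset.mem_range] at hp
    change block x j (x j + 1 + i) g ∈ _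
    exact block_mem_exceeding hx htn hxk (hx0 j (by omega) (by omega)) hp.1 (by omega) (by omega) hp.2.2
  · rintro ⟨j, i, g⟩ - ⟨j', i', g'⟩ - heq
    obtain ⟨h1, h2, h3⟩ := block_inj (by simp only; omega) (by simp only; omega) heq
    simp only at h1 h2 h3
    subst h1 h3
    obtain rfl : i = i' := by omega
    rfl
  · intro G hG
    obtain ⟨j, hj, hj'⟩ := (mem_exceeding.1 hG).2 0 ht
    rw [zero_add] at hj
    obtain ⟨c, g, hc, hck, hg, rfl⟩ := exists_block hG hj hj'
    have e1 : x j + 1 + (c - (x j + 1)) = c := by omega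
    refine ⟨⟨j, c - (x j + 1), g⟩, ?_, ?_⟩
    · simp only [Finset.mem_sigma, Finset.mem_range, e1]
      exact ⟨hj, by omega, hg⟩
    · simp only [e1]

/-- The strings of length `n` and weight at least `w` whose rotations all exceed `x`. -/
theorem card_cyclic_exceeding {k n w : ℕ} {x : ℕ → ℕ} (hn : 1 ≤ n) (hx : PreNeck n x)
    (hxk : ∀ e < n, x e ≤ k) (hx0 : ∀ j < n, x j < k → ∀ e < j, 1 ≤ x e) :
    ((strings k n w).filter fun u => word n x < neck u).card =
      ∑ j ∈ Finset.range n, (j + 1) * ∑ i ∈ Finset.range (k - x j),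
      (exceeding k x (n - 1 - j) (w - (∑ e ∈ Finset.range (j + 1), x e + 1 + i))).card := by
  have hA : ∀ j i, ∑ e ∈ Finset.range (j + 1), x e + 1 + i =
      ∑ e ∈ Finset.range j, x e + (x j + 1 + i) := fun j i => by
    rw [Finset.sum_range_succ]; omega
  -- The necklace is the least rotation, so it exceeds `x` exactly when the periodic extension
  -- exceeds `x` from every position, in fewer than `n` symbols.
  have hcyc : ∀ u ∈ strings k n w, word n x < neck u ↔ ∀ i, ∃ d < n, Exceeds x (ext u) i d := by
    intro u hu
    have hul := (mem_strings.1 hu).1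
    constructor
    · intro h i
      have h1 : word n x < u.rotate i :=
        h.trans_le (neck_le (List.IsRotated.symm ⟨i, rfl⟩))
      obtain ⟨d, hd, he, hlt⟩ := (lt_iff_ext (by simp [hul])).1 h1
      rw [length_word] at hd
      refine ⟨d, hd, fun e hed => ?_, ?_⟩
      · have := he e hed
        rw [ext_word _ (by omega), ext_rotate, add_comm] at this
        exact this.symm
      · rwa [ext_word _ hd, ext_rotate, add_comm] at hlt
    · intro h
      obtain ⟨d, hd, h1, h2⟩ := h (splitIndex u)
      refine (lt_iff_ext (by simp [length_neck, hul])).2 ⟨d, by simpa using hd, fun e he => ?_, ?_⟩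
      · rw [ext_word _ (by omega), ext_neck, h1 e he]
      · rwa [ext_word _ hd, ext_neck]
  simp only [hA, ← Finset.card_sigma]
  have hmul : ∀ j : ℕ, ∀ s : Finset ((_ : ℕ) × List ℕ), (j + 1) * s.card =
      ((Finset.range (j + 1)) ×ˢ s).card := fun j s => by
    rw [Finset.card_product, Finset.card_range]
  simp only [hmul, ← Finset.card_sigma]
  symm
  refine Finset.card_bij
    (fun p _ => (block x p.1 (x p.1 + 1 + p.2.2.1) p.2.2.2).rotate p.2.1) ?_ ?_ ?_
  · rintro ⟨j, o, i, g⟩ hp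
    simp only [Finset.mem_sigma, Finset.mem_product, Finset.mem_range] at hp
    have hG := block_mem_exceeding hx le_rfl hxk (hx0 j (by omega) (by omega)) hp.1 (by omega)
      (by omega) hp.2.2.2
    simp only
    set G := block x j (x j + 1 + i) g
    obtain ⟨hGS, hGE⟩ := mem_exceeding.1 hG
    have hGl := (mem_strings.1 hGS).1
    have hmem := mem_strings_of_isRotated (List.IsRotated.symm ⟨o, rfl⟩ : G.rotate o ~r G) hGS
    rw [Finset.mem_filter, hcyc _ hmem]
    refine ⟨hmem, fun a => ?_⟩
    obtain ⟨d, hd, hd'⟩ := hGE ((a + o) % n) (Nat.mod_lt _ (by omega))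
    refine ⟨d, by omega, hd'.congr fun e he => ?_⟩
    rw [ext_rotate, ← ext_of_lt (by omega), ext, ext, hGl, Nat.mod_add_mod]
    congr 2
    omega
  -- Offsets are determined by the rotated string. If `o < o'`, the start of the block of `G'` falls
  -- at position `n - (o' - o)` of `G`. From there `G` must exceed `x` before its end, but these
  -- fewer than `j'` symbols are copied from `x`.
  · have key : ∀ j o c g j' o' c' g', o ≤ j → j < n → x j < c → c ≤ k → o' ≤ j' → j' < n → x j' < c' →
        c' ≤ k → g ∈ exceeding k x (n - 1 - j) (w - (∑ e ∈ Finset.range j, x e + c)) →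
        g' ∈ exceeding k x (n - 1 - j') (w - (∑ e ∈ Finset.range j', x e + c')) →
        (block x j c g).rotate o = (block x j' c' g').rotate o' → o' ≤ o := by
      intro j o c g j' o' c' g' hoj hj hc hck hoj' hj' hc' hck' hg hg' heq
      by_contra! hlt
      have hG := block_mem_exceeding hx le_rfl hxk (hx0 j (by omega) (by omega)) hj hc hck hg
      have hGl := (mem_strings.1 (mem_exceeding.1 hG).1).1
      have hG' := block_mem_exceeding hx le_rfl hxk (hx0 j' (by omega) (by omega)) hj' hc' hck' hg'
      have hGl' := (mem_strings.1 (mem_exceeding.1 hG').1).1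
      have hE := exceeds_block (g := g') hc'
      set G := block x j c g
      set G' := block x j' c' g'
      obtain ⟨d, hd, hd'⟩ := (mem_exceeding.1 hG).2 (n - (o' - o)) (by omega)
      have hrot : ∀ a, ext G (a + o) = ext G' (a + o') := fun a => by
        rw [← ext_rotate, ← ext_rotate, heq]
      have h2 := hd'.2
      have h3 : ext G' d = x d := by
        rw [ext_of_lt (by omega)]
        have := hE.1 d (by omega)
        simpa using this
      simp only at h2
      rw [← ext_of_lt (by omega)] at h2
      have h4 := hrot (n - (o' - o) + d + (n - o))
      rw [show n - (o' - o) + d + (n - o) + o = n - (o' - o) + d + G.length by omega, ext_add_length,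
        show n - (o' - o) + d + (n - o) + o' = d + G'.length + G'.length by omega, ext_add_length,
        ext_add_length] at h4
      omega
    rintro ⟨j, o, i, g⟩ hp ⟨j', o', i', g'⟩ hp' heq
    simp only [Finset.mem_sigma, Finset.mem_product, Finset.mem_range] at hp hp'
    simp only at heq
    have ho : o = o' := le_antisymm
      (key _ _ _ _ _ _ _ _ (by omega) hp'.1 (by omega) (by omega) (by omega) hp.1 (by omega) (by omega)
        hp'.2.2.2 hp.2.2.2 heq.symm)
      (key _ _ _ _ _ _ _ _ (by omega) hp.1 (by omega) (by omega) (by omega) hp'.1 (by omega) (by omega)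
        hp.2.2.2 hp'.2.2.2 heq)
    subst ho
    obtain ⟨h1, h2, h3⟩ := block_inj (by omega) (by omega) (List.rotate_injective o heq)
    subst h1 h3
    obtain rfl : i = i' := by omega
    rfl
  · intro u hu
    rw [Finset.mem_filter] at hu
    obtain ⟨huS, hu⟩ := hu
    rw [hcyc u huS] at hu
    have hul := (mem_strings.1 huS).1
    have hex : ∃ a, 1 ≤ a ∧ ∃ d, Exceeds x (ext u) a d ∧ n ≤ a + d := by
      obtain ⟨d, -, h2⟩ := hu n
      exact ⟨n, hn, d, h2, by omega⟩
    classical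
    -- The least starting position `a ≥ 1` whose block reaches the end of the string or beyond. The
    -- block of length `j + 1` starting at `a` gives the `j + 1` possible offsets `n - a ≤ j`.
    obtain ⟨a, ⟨ha1, j, hEj, haj⟩, hmin⟩ : ∃ a, (1 ≤ a ∧ ∃ d, Exceeds x (ext u) a d ∧ n ≤ a + d) ∧
        ∀ b < a, ¬ (1 ≤ b ∧ ∃ d, Exceeds x (ext u) b d ∧ n ≤ b + d) :=
      ⟨Nat.find hex, Nat.find_spec hex, fun b hb => Nat.find_min hex hb⟩
    have han : a ≤ n := by
      by_contra! h
      obtain ⟨d, -, h2⟩ := hu n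
      exact hmin n h ⟨hn, d, h2, by omega⟩
    have hjn : j < n := by
      obtain ⟨d, hd, h2⟩ := hu a
      rwa [hEj.unique h2]
    have hGS := mem_strings_of_isRotated (List.IsRotated.symm ⟨a, rfl⟩ : u.rotate a ~r u) huS
    have hGd : ∀ e < n, (u.rotate a).getD e 0 = ext u (a + e) := fun e he => by
      rw [← ext_of_lt (by simp; omega), ext_rotate, add_comm]
    have hG : u.rotate a ∈ exceeding k x n w := by
      refine mem_exceeding.2 ⟨hGS, fun e he => ?_⟩
      rcases le_or_gt e j with hej | hej
      · obtain ⟨d, hd, hd'⟩ := hEj.shift (hx.mono (by omega)) hej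
        refine ⟨d, by omega, hd'.congr fun c hc => ?_⟩
        rw [hGd _ (by omega), add_assoc]
      · have hper : ∀ c, ext u (a + e - n + c) = ext u (a + (e + c)) := fun c => by
          rw [← ext_add_length u (a + e - n + c), hul]
          congr 1
          omega
        obtain ⟨d, -, hd'⟩ := hu (a + e - n)
        have h1 : a + e - n + d < n := by
          by_contra! h
          exact hmin (a + e - n) (by omega) ⟨by omega, d, hd', h⟩
        -- A block starting before `a` cannot run past `a`: by shifting, the one starting at `a`
        -- would end no later, hence before position `n`.
        have h2 : a + e - n + d < a := by
          by_contra! h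
          obtain ⟨d', hd1, hd2⟩ := hd'.shift (e := a - (a + e - n)) (hx.mono (by omega)) (by omega)
          rw [Nat.add_sub_cancel' (by omega)] at hd2
          have := hd2.unique hEj
          omega
        refine ⟨d, by omega, hd'.congr fun c hc => ?_⟩
        rw [hper, hGd _ (by omega)]
    have hE0 : Exceeds x (fun e => (u.rotate a).getD e 0) 0 j := hEj.congr fun e he => by
      rw [zero_add, hGd _ (by omega)]
    obtain ⟨c, g, hc, hck, hg, heq⟩ := exists_block hG hjn hE0
    have e1 : x j + 1 + (c - (x j + 1)) = c := by omega
    refine ⟨⟨j, n - a, c - (x j + 1), g⟩, ?_, ?_⟩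
    · simp only [Finset.mem_sigma, Finset.mem_product, Finset.mem_range, e1]
      exact ⟨hjn, by omega, by omega, hg⟩
    · simp only [e1]
      rw [← heq, List.rotate_rotate, Nat.add_sub_cancel' han, ← hul, List.rotate_length]

/-! ### A threshold for the necklaces that follow a string -/

/-- `a₀ ⋯ a_{p-1}` is unbordered and `p` is a period of `a₀ ⋯ a_{L-1}`. -/
structure IsLyndonPeriod (a : ℕ → ℕ) (L p : ℕ) : Prop where
  pos : 1 ≤ p
  le : p ≤ L
  period : ∀ e, p ≤ e → e < L → a e = a (e - p)
  unbordered : ∀ i, 1 ≤ i → i < p → ∃ e, i + e < p ∧ a (i + e) ≠ a e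

theorem isLyndonPeriod_one (a : ℕ → ℕ) : IsLyndonPeriod a 1 1 :=
  ⟨le_rfl, le_rfl, fun e h1 h2 => by omega, fun i h1 h2 => by omega⟩

/-- The step of Duval's algorithm. If the period breaks, the prenecklace condition makes the new
symbol larger than `a (j - p)`, and no border survives: shifts below `p` fail by the old
unborderedness, the shift `p` at the new symbol, and larger shifts by comparison with a shift by `p`
less. -/
theorem IsLyndonPeriod.succ {a : ℕ → ℕ} {j p : ℕ} (h : IsLyndonPeriod a j p) (ha : PreNeck (j + 1) a) :
    IsLyndonPeriod a (j + 1) (if a j = a (j - p) then p else j + 1) := by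
  obtain ⟨h1, h2, h3, h4⟩ := h
  split_ifs with heq
  · refine ⟨h1, by omega, fun e he hej => ?_, h4⟩
    rcases eq_or_lt_of_le (show e ≤ j by omega) with rfl | hlt
    · exact heq
    · exact h3 e he hlt
  · refine ⟨by omega, le_rfl, fun e he hej => by omega, fun i hi hij => ?_⟩
    by_contra! hb
    have hgt : a (j - p) < a j := by
      refine lt_of_le_of_ne ?_ (Ne.symm heq)
      have := ha p (j - p) (by omega) fun e he => by
        rw [h3 (p + e) (by omega) (by omega), Nat.add_sub_cancel_left]
      rwa [Nat.add_sub_cancel' h2] at this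
    rcases lt_trichotomy i p with hip | rfl | hip
    · obtain ⟨e, he, hne⟩ := h4 i hi hip
      exact hne (hb e (by omega))
    · have := hb (j - i) (by omega)
      rw [Nat.add_sub_cancel' h2] at this
      exact heq this
    · have h5 := ha (i - p) (j - i) (by omega) fun e he => by
        rw [← hb e (by omega), h3 (i + e) (by omega) (by omega)]
        congr 1
        omega
      have h6 := hb (j - i) (by omega)
      rw [Nat.add_sub_cancel' (by omega)] at h6
      rw [show i - p + (j - i) = j - p by omega] at h5
      omega

/-- The largest string below all strings with a prefix at least `a₀ ⋯ a_{L-1}`, where `p` is the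
Lyndon period of this prefix. -/
def lowered (k p : ℕ) (a : ℕ → ℕ) (e : ℕ) : ℕ :=
  if e + 1 < p then a e else if e + 1 = p then a e - 1 else k

/-- The only delicate suffixes are those ending at the lowered symbol. By unborderedness, one that
has matched so far was strictly larger at its end, and lowering by 1 leaves it at least as large.
Beyond the period all symbols are `k`. -/
theorem preNeck_lowered {k n L p : ℕ} {a : ℕ → ℕ} (h : IsLyndonPeriod a L p) (ha : PreNeck L a)
    (hak : ∀ e, a e ≤ k) : PreNeck n (lowered k p a) := by
  obtain ⟨h1, h2, h3, h4⟩ := h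
  have hle : ∀ e, lowered k p a e ≤ k := by
    intro e
    have := hak e
    rw [lowered]
    split_ifs <;> omega
  intro i d hid he
  rcases Nat.eq_zero_or_pos i with rfl | hi
  · rw [zero_add]
  rcases lt_trichotomy (i + d + 1) p with hlt | heq | hlt
  · have := ha i d (by omega) fun e hed => by
      have := he e hed
      rwa [lowered, lowered, if_pos (by omega), if_pos (by omega)] at this
    rw [lowered, lowered, if_pos (by omega), if_pos (by omega)]
    exact this
  · have hm : ∀ e < d, a (i + e) = a e := fun e hed => by
      have := he e hed
      rwa [lowered, lowered, if_pos (by omega), if_pos (by omega)] at this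
    have h5 := ha i d (by omega) hm
    obtain ⟨e, hep, hne⟩ := h4 i hi (by omega)
    have hed : e = d := by
      by_contra h
      exact hne (hm e (by omega))
    rw [hed] at hne
    rw [lowered, lowered, if_pos (by omega), if_neg (by omega), if_pos heq]
    omega
  · have := hle d
    rwa [lowered.eq_1 k p a (i + d), if_neg (by omega), if_neg (by omega)]

/-- To exceed the lowered string, a necklace must have a prefix of length `p` that is at least `a₀ ⋯
a_{p-1}`. In case of equality, the necklace condition for shifts by `p` prevents it from falling
below the periodic continuation, hence below `a₀ ⋯ a_{L-1}`. -/
theorem lowered_lt_iff {k n L p : ℕ} {a : ℕ → ℕ} {u : List ℕ} (h : IsLyndonPeriod a L p) (hL : L ≤ n)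
    (ha1 : ∀ e, 1 ≤ a e) (hul : u.length = n) (hu : IsNecklace u)
    (huk : ∀ y ∈ u, y ≤ k) : word n (lowered k p a) < u ↔ word L a ≤ u := by
  obtain ⟨h1, h2, h3, h4⟩ := h
  constructor
  · intro hlt
    by_contra! hlt'
    obtain ⟨d, hd, he, hdl⟩ := (lt_iff_getD (by simp [hul])).1 hlt
    obtain ⟨d', hd', he', hdl'⟩ := (lt_iff_getD (by simp [hul, hL])).1 hlt'
    rw [length_word] at hd'
    rw [getD_word _ hd'] at hdl'
    rw [getD_word _ (by omega)] at hdl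
    have he : ∀ e < d, lowered k p a e = u.getD e 0 := fun e hed => by
      rw [← he e hed, getD_word _ (by omega)]
    have he' : ∀ e < d', u.getD e 0 = a e := fun e hed => by
      rw [he' e hed, getD_word _ (by omega)]
    have hdp : d < p := by
      by_contra! h
      rw [lowered, if_neg (by omega), if_neg (by omega)] at hdl
      exact absurd (huk _ (getD_mem hd)) (not_le.2 hdl)
    have hau : ∀ e < d, u.getD e 0 = a e := fun e hed => by
      rw [← he e hed, lowered, if_pos (by omega)]
    rcases lt_trichotomy d' d with hdd | rfl | hdd
    · rw [hau _ hdd] at hdl'; exact lt_irrefl _ hdl'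
    · rw [lowered] at hdl
      split_ifs at hdl <;> omega
    · have hud := he' d hdd
      rw [hud, lowered] at hdl
      split_ifs at hdl with g1 g2
      · exact lt_irrefl _ hdl
      · have hN := isNecklace_iff.1 hu p (d' - p) fun e hed => by
          rw [ext_of_lt (by omega), ext_of_lt (by omega), he' _ (by omega), he' _ (by omega),
            h3 _ (by omega) (by omega), Nat.add_sub_cancel_left]
        rw [Nat.add_sub_cancel' (by omega), ext_of_lt (by omega), ext_of_lt (by omega),
          he' _ (by omega), ← h3 d' (by omega) (by omega)] at hN
        omega
      · omega
  · intro hle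
    rcases eqOn_or_first_ne (fun e => u.getD e 0) a p with h | ⟨d, hd, he, hne⟩
    · refine (lt_iff_getD (by simp [hul])).2 ⟨p - 1, by omega, fun e he => ?_, ?_⟩
      · rw [getD_word _ (by omega), lowered, if_pos (by omega)]
        exact (h e (by omega)).symm
      · have h5 := h (p - 1) (by omega)
        have h6 := ha1 (p - 1)
        rw [getD_word _ (by omega), lowered, if_neg (by omega), if_pos (by omega), h5]
        omega
    · have hgt : a d < u.getD d 0 := by
        by_contra! hlt
        refine absurd hle (not_le.2 ((lt_iff_getD (by simp [hul, hL])).2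
          ⟨d, by rw [length_word]; omega, fun e hed => ?_, ?_⟩))
        · rw [getD_word _ (by omega)]; exact he e hed
        · rw [getD_word _ (by omega)]; exact lt_of_le_of_ne hlt hne
      refine (lt_iff_getD (by simp [hul])).2 ⟨d, by omega, fun e hed => ?_, ?_⟩
      · rw [getD_word _ (by omega), lowered, if_pos (by omega)]; exact (he e hed).symm
      · rw [getD_word _ (by omega), lowered]
        split_ifs <;> omega

/-! ### The rank in terms of counts -/

/-- `x` is a string such that the necklaces larger than `x` are those not read before the part `q`
of `s = p q`. -/
structure IsThreshold (k : ℕ) (s : List ℕ) (x : ℕ → ℕ) : Prop where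
  of_ne : (∃ e < splitIndex s, s.getD e 0 ≠ k) → ∀ e < s.length, x e = ext s (splitIndex s + e)
  of_eq : (∀ e < splitIndex s, s.getD e 0 = k) →
    ∃ p, IsLyndonPeriod (fun e => ext s (splitIndex s + e)) (s.length - splitIndex s) p ∧
      ∀ e < s.length, x e = lowered k p (fun e => ext s (splitIndex s + e)) e

theorem forall_mem_pPart {s : List ℕ} {k : ℕ} :
    (∀ y ∈ pPart s, y = k) ↔ ∀ e < splitIndex s, s.getD e 0 = k := by
  have h : pPart s <+: s := List.take_prefix _ _
  constructor
  · intro hp e he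
    rw [← (prefix_iff_getD.1 h).2 e (by rwa [length_pPart])]
    exact hp _ (getD_mem (by rwa [length_pPart]))
  · intro hp y hy
    obtain ⟨e, he, rfl⟩ := List.mem_iff_getElem.1 hy
    rw [← List.getD_eq_getElem _ 0 he, (prefix_iff_getD.1 h).2 e he]
    exact hp e (by rwa [length_pPart] at he)

theorem neck_ext_splitIndex (s : List ℕ) : Neck fun e => ext s (splitIndex s + e) := by
  have := isNecklace_iff.1 (isNecklace_neck s)
  intro i d he
  simpa only [ext_neck] using this i d (by simpa only [ext_neck] using he)

/-- If `p` is a power of `k`, not being `Low` means being at least `q`, and `lowered` turns this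
into a strict inequality; otherwise it means exceeding `qp`. The other conclusions are what the
counting recursion requires of `x`. -/
theorem IsThreshold.spec {k n w : ℕ} (hn : 1 ≤ n) {s : List ℕ} {x : ℕ → ℕ} (hs : s ∈ strings k n w)
    (h : IsThreshold k s x) : PreNeck n x ∧ (∀ e < n, x e ≤ k) ∧
      (∀ j < n, x j < k → ∀ e < j, 1 ≤ x e) ∧
      ((strings k n w).filter fun u => word n x < neck u).card + lowCount k n w s =
        (strings k n w).card := by
  have hsl := (mem_strings.1 hs).1
  have hsne : s ≠ [] := fun h => by rw [h] at hsl; simp at hsl; omega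
  have hsd : ∀ e, 1 ≤ ext s e ∧ ext s e ≤ k := fun e => (mem_strings.1 hs).2.1 _ (ext_mem hsne e)
  have hN := neck_ext_splitIndex s
  have hi := (splitIndex_spec s).1
  have hlow : (∀ u ∈ strings k n w, word n x < neck u ↔ ¬ Low k s (neck u)) →
      ((strings k n w).filter fun u => word n x < neck u).card + lowCount k n w s =
        (strings k n w).card := by
    intro h
    rw [Finset.filter_congr h, lowCount, add_comm]
    exact Finset.card_filter_add_card_filter_not _
  by_cases hall : ∀ e < splitIndex s, s.getD e 0 = k
  · obtain ⟨p, hp, hx⟩ := h.of_eq hall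
    rw [hsl] at hp hx
    refine ⟨(preNeck_lowered hp (hN.preNeck _) fun e => (hsd _).2).congr fun e he => (hx e he).symm,
      fun e he => ?_, fun j hj hjk e he => ?_, hlow fun u hu => ?_⟩
    · rw [hx e he, lowered]
      have := hsd (splitIndex s + e)
      split_ifs <;> omega
    · rw [hx j hj, lowered] at hjk
      have hjp : j + 1 ≤ p := by
        by_contra! h
        rw [if_neg (by omega), if_neg (by omega)] at hjk
        exact lt_irrefl _ hjk
      rw [hx e (by omega), lowered, if_pos (by omega)]
      exact (hsd _).1
    · have hus := mem_strings.1 (neck_mem_strings hu)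
      have hwx : word n x = word n (lowered k p fun e => ext s (splitIndex s + e)) :=
        eq_of_getD (by simp) fun e he => by
          rw [length_word] at he
          rw [getD_word _ he, getD_word _ he, hx e he]
      have hq : word (n - splitIndex s) (fun e => ext s (splitIndex s + e)) = qPart s :=
        eq_of_getD (by simp [length_qPart, hsl]) fun e he => by
          rw [length_word] at he
          rw [getD_word _ he, getD_qPart, ext_of_lt (by omega)]
      rw [hwx, lowered_lt_iff hp (by omega) (fun e => (hsd _).1) hus.1 (isNecklace_neck u)
        (fun y hy => (hus.2.1 y hy).2), hq]
      refine ⟨fun hle hl => ?_, le_of_not_low⟩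
      rcases hl with hl | hl
      · exact absurd hle (not_le.2 hl.2)
      · exact hl.1 (forall_mem_pPart.2 hall)
  · have hx := h.of_ne (by push Not at hall; exact hall)
    rw [hsl] at hx
    refine ⟨(hN.preNeck n).congr fun e he => (hx e he).symm, fun e he => ?_, fun j hj _ e he => ?_,
      hlow fun u hu => ?_⟩
    · rw [hx e he]; exact (hsd _).2
    · rw [hx e (by omega)]; exact (hsd _).1
    · have hwx : word n x = neck s := eq_of_ext (by simp [length_neck, hsl]) fun e he => by
        rw [length_word] at he
        rw [ext_word _ he, ext_neck, hx e he]
      rw [hwx]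
      refine ⟨fun hlt hl => absurd hl.le_neck (not_le.2 hlt), fun hl => ?_⟩
      by_contra! hle
      exact hl (Or.inr ⟨fun h => hall (forall_mem_pPart.1 h), hle⟩)

/-- The rank of a string, computed from the number `g` of strings whose necklace exceeds the
threshold, the total number `tot` of strings, and the length `b` of the part `p`. -/
def rankFormula (tot g b : ℕ) : ℕ :=
  if b ≤ tot - g then tot - g + 1 - b else tot + (tot - g) + 1 - b

/-- `tot - g` is `lowCount`, and it is smaller than `|p|` only in the wraparound. The string `k^n`
needs a correction: there `p` is empty and `lowCount = tot - 1`, while the rank is `tot - n + 1`, so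
`|p|` is replaced by `n - 1`. It is recognized by its necklace starting with `k`. -/
theorem hasRank_rankFormula {k n w : ℕ} (hn : 1 ≤ n) (hk : 2 ≤ k) (hw : w < k * n) {s : List ℕ}
    {x : ℕ → ℕ} (hs : s ∈ strings k n w) (h : IsThreshold k s x) :
    HasRank (granddaddy k n w) s (rankFormula (strings k n w).card
      ((strings k n w).filter fun u => word n x < neck u).card
      (if ext s (splitIndex s) = k then n - 1 else splitIndex s)) := by
  obtain ⟨-, -, -, hcard⟩ := h.spec hn hs
  have hM := le_card_strings hn hk hw
  have hsl := (mem_strings.1 hs).1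
  have hfirst : ext s (splitIndex s) = (neck s).getD 0 0 := by
    rw [← ext_of_lt (by rw [length_neck]; omega), ext_neck, add_zero]
  by_cases hK : s = List.replicate n k
  · have hlow : lowCount k n w s = (strings k n w).card - 1 := by
      have hKm : List.replicate n k ∈ strings k n w := hK ▸ hs
      have hneck : neck s = List.replicate n k := by
        rw [neck_eq_iff (isNecklace_replicate n k), hK]
      have hsplit : splitIndex s = 0 := Nat.le_zero.1 ((splitIndex_spec s).2.2 0 (by
        rw [List.rotate_zero, hK]; exact isNecklace_replicate n k))
      have hq : qPart s = s := by simp [qPart, hsplit]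
      have : ((strings k n w).filter fun u => Low k s (neck u)) =
          (strings k n w).erase (List.replicate n k) := by
        ext u
        rw [Finset.mem_filter, Finset.mem_erase, and_comm]
        refine and_congr_left fun hu => ?_
        have hus := mem_strings.1 (neck_mem_strings hu)
        have hle := le_replicate hus.1.le fun y hy => (hus.2.1 y hy).2
        have hiff : u = List.replicate n k ↔ neck u = List.replicate n k := by
          rw [neck_eq_iff (isNecklace_replicate n k)]
          constructor
          · rintro rfl; exact List.IsRotated.refl _
          · intro h
            obtain ⟨i, hi⟩ := h.symm
            rw [List.rotate_replicate] at hi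
            exact hi.symm
        rw [Ne, hiff]
        constructor
        · rintro (h | h)
          · have := h.2
            rw [hq, hK] at this
            exact this.ne
          · refine absurd (fun y hy => ?_) h.1
            rw [pPart, hsplit] at hy
            simp at hy
        · intro hne
          refine Or.inl ⟨fun y hy => ?_, ?_⟩
          · rw [pPart, hsplit] at hy
            simp at hy
          · rw [hq, hK]
            exact lt_of_le_of_ne hle hne
      rw [lowCount, this, Finset.card_erase_of_mem hKm]
    have hr := hasRank_of_isWraparound hn hk hw (replicate_isWraparound hn hk hw)
    have h0 : ext s (splitIndex s) = k := by
      have := ext_mem (s := s) (fun h => by rw [h] at hsl; simp at hsl; omega) (splitIndex s)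
      rw [hK] at this
      rw [hK]
      exact List.eq_of_mem_replicate this
    rw [if_pos h0, hK, rankFormula, if_pos (by omega)]
    convert hr using 1
    omega
  · have h0 : ext s (splitIndex s) ≠ k := by
      rw [hfirst]
      intro h0
      have hns := mem_strings.1 (neck_mem_strings hs)
      have h1 := eq_replicate_of_getD_zero (isNecklace_neck s) (fun y hy => (hns.2.1 y hy).2) h0
      rw [hns.1, neck_eq_iff (isNecklace_replicate n k)] at h1
      obtain ⟨i, hi⟩ := h1.symm
      rw [List.rotate_replicate] at hi
      exact hK hi.symm
    rw [if_neg h0, rankFormula]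
    rcases hasRank_lowCount hn hk hw hs hK with h1 | h1
    · rw [if_pos (by omega)]
      convert h1.2 using 1
      omega
    · have hr := hasRank_of_isWraparound hn hk hw h1.2.2.2
      rw [if_neg (by omega)]
      convert hr using 1
      omega

/-! ### Comparing strings as numbers -/

/-- The value of the digits `f 0, …, f (m - 1)` in base `K`. -/
def horner (K : ℕ) (f : ℕ → ℕ) : ℕ → ℕ
  | 0 => 0
  | m + 1 => horner K f m * K + f m

theorem horner_congr {K m : ℕ} {f g : ℕ → ℕ} (h : ∀ e < m, f e = g e) : horner K f m = horner K g m := by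
  induction m with
  | zero => rfl
  | succ m ih => rw [horner, horner, ih fun e he => h e (by omega), h m (by omega)]

/-- Only the digits of the smaller number need to be below the base. -/
theorem horner_lt_of_lt {K m d : ℕ} {f g : ℕ → ℕ} (hf : ∀ e, f e < K) (hd : d < m)
    (he : ∀ e < d, f e = g e) (h : f d < g d) : horner K f m < horner K g m := by
  induction m with
  | zero => omega
  | succ m ih =>
    rw [horner, horner]
    rcases eq_or_lt_of_le (show d ≤ m by omega) with rfl | hlt
    · rw [horner_congr he]; omega
    · have h1 := ih hlt
      have h2 := hf m
      calc horner K f m * K + f m < (horner K f m + 1) * K := by rw [add_mul, one_mul]; omega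
        _ ≤ horner K g m * K := Nat.mul_le_mul_right _ h1
        _ ≤ _ := Nat.le_add_right _ _

theorem horner_lt_pow {K m : ℕ} {f : ℕ → ℕ} (hf : ∀ e, f e < K) : horner K f m < K ^ m := by
  induction m with
  | zero => simp [horner]
  | succ m ih =>
    rw [horner, pow_succ]
    have h2 := hf m
    calc horner K f m * K + f m < (horner K f m + 1) * K := by rw [add_mul, one_mul]; omega
      _ ≤ _ := Nat.mul_le_mul_right _ ih

/-- The first rotation with the smallest value gives the factorization. -/
theorem splitIndex_eq_of_horner {K b : ℕ} {s : List ℕ} (hK : ∀ e, ext s e < K) (hb : b < s.length)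
    (hle : ∀ i < s.length, horner K (fun e => ext s (b + e)) s.length ≤
      horner K (fun e => ext s (i + e)) s.length)
    (hlt : ∀ i < b, horner K (fun e => ext s (b + e)) s.length <
      horner K (fun e => ext s (i + e)) s.length) : splitIndex s = b := by
  have key : ∀ i j, s.rotate i < s.rotate j → horner K (fun e => ext s (i + e)) s.length <
      horner K (fun e => ext s (j + e)) s.length := by
    intro i j h
    obtain ⟨d, hd, he, hlt⟩ := (lt_iff_ext (by simp)).1 h
    rw [List.length_rotate] at hd
    simp only [ext_rotate] at he hlt
    refine horner_lt_of_lt (fun e => hK _) hd (fun e hed => ?_) ?_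
    · rw [add_comm i, add_comm j, he e hed]
    · rwa [add_comm i, add_comm j]
  have hlt' : splitIndex s < s.length := by
    have hne : s ≠ [] := fun h => by rw [h] at hb; simp at hb
    have h1 := splitIndex_lt hne
    have h2 := (ap_prefix (neck s)).length_le
    rw [length_neck] at h2
    omega
  have hN : IsNecklace (s.rotate b) := by
    rw [isNecklace_iff_rotate]
    intro i
    rw [List.rotate_rotate, ← List.rotate_mod s (b + i)]
    by_contra! h
    exact absurd (hle _ (Nat.mod_lt (b + i) (by omega))) (not_le.2 (key _ _ h))
  refine le_antisymm ((splitIndex_spec s).2.2 b hN) ?_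
  by_contra! h
  have h1 := hlt _ h
  have h2 : s.rotate (splitIndex s) = s.rotate b := by
    rw [rotate_splitIndex, neck_eq_iff hN]
    exact ⟨b, rfl⟩
  refine absurd h1 (Eq.not_lt (horner_congr fun e he => ?_))
  have := congrArg (ext · e) h2
  simp only [ext_rotate] at this
  rw [add_comm b, add_comm (splitIndex s), this]

/-- The string `0 k ⋯ k` is below all necklaces. -/
theorem threshold_zero {k n w : ℕ} (hn : 1 ≤ n) : ∃ x : ℕ → ℕ, x = (fun e => if e = 0 then 0 else k) ∧
    PreNeck n x ∧ (∀ e < n, x e ≤ k) ∧ (∀ j < n, x j < k → ∀ e < j, 1 ≤ x e) ∧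
    ((strings k n w).filter fun u => word n x < neck u).card = (strings k n w).card := by
  refine ⟨_, rfl, fun i d _ _ => ?_, fun e _ => ?_, fun j _ hj e he => ?_, ?_⟩
  · simp only
    split_ifs <;> omega
  · split_ifs <;> omega
  · rw [if_neg (by omega)] at hj
    exact absurd hj (lt_irrefl _)
  · rw [Finset.filter_true_of_mem]
    intro u hu
    have hus := mem_strings.1 (neck_mem_strings hu)
    refine (lt_iff_getD (by simp [hus.1])).2 ⟨0, by omega, by simp, ?_⟩
    rw [getD_word _ (by omega), if_pos rfl]
    exact (hus.2.1 _ (getD_mem (by omega))).1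

/-! ### A structured language for the random access machine -/

/-- The state of a structured program: variables and memory. -/
structure St where
  v : ℕ → ℕ
  m : ℕ → ℕ

/-- Assign a variable. -/
def St.set (σ : St) (i x : ℕ) : St := ⟨Function.update σ.v i x, σ.m⟩

/-- Assign a memory cell. -/
def St.write (σ : St) (a x : ℕ) : St := ⟨σ.v, Function.update σ.m a x⟩

theorem St.set_v (σ : St) (i x j : ℕ) : (σ.set i x).v j = if j = i then x else σ.v j := by
  simp [St.set, Function.update_apply]

theorem St.set_m (σ : St) (i x : ℕ) : (σ.set i x).m = σ.m := rfl

theorem St.write_v (σ : St) (a x : ℕ) : (σ.write a x).v = σ.v := rfl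

theorem St.write_m (σ : St) (a x b : ℕ) : (σ.write a x).m b = if b = a then x else σ.m b := by
  simp [St.write, Function.update_apply]

/-- Elementary operations. Besides plain memory accesses there are accesses to four interleaved
arrays. -/
inductive Op where
  | const (d c : ℕ)
  | add (d a b : ℕ)
  | sub (d a b : ℕ)
  | mul (d a b : ℕ)
  | load (d i : ℕ)
  | store (i b : ℕ)
  | get (d r i : ℕ)
  | put (r i b : ℕ)

/-- The effect of an elementary operation. -/
def Op.exec : Op → St → St
  | .const d c, σ => σ.set d c
  | .add d a b, σ => σ.set d (σ.v a + σ.v b)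
  | .sub d a b, σ => σ.set d (σ.v a - σ.v b)
  | .mul d a b, σ => σ.set d (σ.v a * σ.v b)
  | .load d i, σ => σ.set d (σ.m (σ.v i))
  | .store i b, σ => σ.write (σ.v i) (σ.v b)
  | .get d r i, σ => σ.set d (σ.m (4 * σ.v i + r))
  | .put r i b, σ => σ.write (4 * σ.v i + r) (σ.v b)

/-- All numbers produced by the operation are at most `W` and all addresses below `N`. -/
def Op.ok (W N : ℕ) : Op → St → Prop
  | .const _ c, _ => c ≤ W
  | .add _ a b, σ => σ.v a + σ.v b ≤ W
  | .sub _ _ _, _ => True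
  | .mul _ a b, σ => σ.v a * σ.v b ≤ W
  | .load _ i, σ => σ.v i < N
  | .store i _, σ => σ.v i < N
  | .get _ r i, σ => 4 * σ.v i + r < N
  | .put r i _, σ => 4 * σ.v i + r < N

/-- All variables of the operation have numbers below 30. -/
def Op.wf : Op → Bool
  | .const d _ => d < 30
  | .add d a b => d < 30 && a < 30 && b < 30
  | .sub d a b => d < 30 && a < 30 && b < 30
  | .mul d a b => d < 30 && a < 30 && b < 30
  | .load d i => d < 30 && i < 30
  | .store i b => i < 30 && b < 30
  | .get d _ i => d < 30 && i < 30
  | .put _ i b => i < 30 && b < 30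

/-- The machine code of an operation. Registers 0 and 1 are scratch registers, variable `i` is
register `i + 2`, and memory cell `a` is register `32 + a`. -/
def Op.code : Op → List Instr
  | .const d c => [.const (d + 2) c]
  | .add d a b => [.add (d + 2) (a + 2) (b + 2)]
  | .sub d a b => [.sub (d + 2) (a + 2) (b + 2)]
  | .mul d a b => [.mul (d + 2) (a + 2) (b + 2)]
  | .load d i => [.const 0 32, .add 0 0 (i + 2), .load (d + 2) 0]
  | .store i b => [.const 0 32, .add 0 0 (i + 2), .store 0 (b + 2)]
  | .get d r i => [.const 0 4, .mul 0 0 (i + 2), .const 1 (32 + r), .add 0 0 1, .load (d + 2) 0]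
  | .put r i b => [.const 0 4, .mul 0 0 (i + 2), .const 1 (32 + r), .add 0 0 1, .store 0 (b + 2)]

theorem Op.length_code_le (o : Op) : o.code.length ≤ 5 := by
  cases o <;> simp [Op.code]

/-- Structured programs: `ite x c₁ c₂` executes `c₁` if `x = 0` and `c₂` otherwise, and `loop x c`
executes `c` and decrements `x`, as long as `x` is not zero. -/
inductive Cmd where
  | ops (l : List Op)
  | seq (c₁ c₂ : Cmd)
  | ite (x : ℕ) (c₁ c₂ : Cmd)
  | loop (x : ℕ) (c : Cmd)

infixr:60 " ;; " => Cmd.seq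

/-- The effect of a list of operations. -/
def runOps : List Op → St → St
  | [], σ => σ
  | o :: l, σ => runOps l (o.exec σ)

/-- The bounds are respected by a list of operations. -/
def okOps (W N : ℕ) : List Op → St → Prop
  | [], _ => True
  | o :: l, σ => o.ok W N σ ∧ okOps W N l (o.exec σ)

def Cmd.wf : Cmd → Bool
  | .ops l => l.all Op.wf
  | .seq c₁ c₂ => c₁.wf && c₂.wf
  | .ite x c₁ c₂ => x < 30 && c₁.wf && c₂.wf
  | .loop x c => x < 30 && c.wf

/-- The length of the machine code of a program. -/
def Cmd.size : Cmd → ℕ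
  | .ops l => (l.flatMap Op.code).length
  | .seq c₁ c₂ => c₁.size + c₂.size
  | .ite _ c₁ c₂ => c₂.size + c₁.size + 3
  | .loop _ c => c.size + 5

/-- The machine code of a program, placed at the given address. -/
def Cmd.code : Cmd → ℕ → List Instr
  | .ops l, _ => l.flatMap Op.code
  | .seq c₁ c₂, p => c₁.code p ++ c₂.code (p + c₁.size)
  | .ite x c₁ c₂, p => .jumpZero (x + 2) (p + c₂.size + 3) :: (c₂.code (p + 1) ++
      .const 0 0 :: .jumpZero 0 (p + c₂.size + c₁.size + 3) :: c₁.code (p + c₂.size + 3))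
  | .loop x c, p => .jumpZero (x + 2) (p + c.size + 5) :: (c.code (p + 1) ++
      [.const 1 1, .sub (x + 2) (x + 2) 1, .const 0 0, .jumpZero 0 p])

theorem Cmd.length_code (c : Cmd) : ∀ p, (c.code p).length = c.size := by
  induction c with
  | ops l => intro p; rfl
  | seq c₁ c₂ h₁ h₂ => intro p; simp [Cmd.code, Cmd.size, h₁, h₂]
  | ite x c₁ c₂ h₁ h₂ => intro p; simp [Cmd.code, Cmd.size, h₁, h₂]; omega
  | loop x c h => intro p; simp [Cmd.code, Cmd.size, h]

/-- Terminating executions with their running time, respecting the bounds. -/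
inductive Ex (W N : ℕ) : Cmd → St → ℕ → St → Prop
  | ops {l σ} : okOps W N l σ → Ex W N (.ops l) σ (l.flatMap Op.code).length (runOps l σ)
  | seq {c₁ c₂ σ t₁ σ₁ t₂ σ₂} : Ex W N c₁ σ t₁ σ₁ → Ex W N c₂ σ₁ t₂ σ₂ →
      Ex W N (.seq c₁ c₂) σ (t₁ + t₂) σ₂
  | iteZero {x c₁ c₂ σ t σ'} : σ.v x = 0 → Ex W N c₁ σ t σ' → Ex W N (.ite x c₁ c₂) σ (1 + t) σ'
  | iteNe {x c₁ c₂ σ t σ'} : σ.v x ≠ 0 → Ex W N c₂ σ t σ' → Ex W N (.ite x c₁ c₂) σ (1 + (t + 2)) σ'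
  | loopZero {x c σ} : σ.v x = 0 → Ex W N (.loop x c) σ 1 σ
  | loopNe {x c σ t σ₁ t' σ₂} : σ.v x ≠ 0 → Ex W N c σ t σ₁ →
      Ex W N (.loop x c) (σ₁.set x (σ₁.v x - 1)) t' σ₂ →
      Ex W N (.loop x c) σ (1 + (t + (4 + t'))) σ₂

/-! ### Correctness of the machine code -/

/-- Executions of the machine that respect the bounds on addresses and words. -/
inductive Steps (P : List Instr) (S W : ℕ) : Config → ℕ → Config → Prop
  | refl (c) : Steps P S W c 0 c
  | cons {c I t c₁ c'} : P[c.pc]? = some I → (∀ a ∈ I.touched c, a < S) → I.exec c = c₁ →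
      (∀ a, c₁.reg a ≤ W) → Steps P S W c₁ t c' → Steps P S W c (t + 1) c'

theorem Steps.next {P : List Instr} {S W : ℕ} {p : ℕ} {reg reg' : ℕ → ℕ} {I : Instr} {t : ℕ} {c' : Config}
    (h1 : P[p]? = some I) (h2 : ∀ a ∈ I.touched ⟨p, reg⟩, a < S) (h3 : I.exec ⟨p, reg⟩ = ⟨p + 1, reg'⟩)
    (h4 : ∀ a, reg' a ≤ W) (h5 : Steps P S W ⟨p + 1, reg'⟩ t c') : Steps P S W ⟨p, reg⟩ (t + 1) c' :=
  .cons h1 h2 h3 h4 h5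

theorem Steps.trans {P : List Instr} {S W : ℕ} {c c' c'' : Config} {t t' : ℕ} (h : Steps P S W c t c')
    (h' : Steps P S W c' t' c'') : Steps P S W c (t + t') c'' := by
  induction h with
  | refl c => rwa [zero_add]
  | cons h1 h2 h3 h4 _ ih => rw [add_right_comm]; exact .cons h1 h2 h3 h4 (ih h')

theorem Steps.iterate {P : List Instr} {S W : ℕ} {c c' : Config} {t : ℕ} (h : Steps P S W c t c')
    (hc : ∀ a, c.reg a ≤ W) : (step P)^[t] c = c' ∧
      (∀ i < t, ∀ a ∈ touched P ((step P)^[i] c), a < S) ∧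
      (∀ i ≤ t, ∀ a, ((step P)^[i] c).reg a ≤ W) := by
  induction h with
  | refl c =>
    refine ⟨rfl, fun i hi => by omega, fun i hi a => ?_⟩
    obtain rfl : i = 0 := by omega
    exact hc a
  | @cons c I t c₁ c' h1 h2 h3 h4 _ ih =>
    have hs : step P c = c₁ := by rw [step, h1]; exact h3
    obtain ⟨g1, g2, g3⟩ := ih h4
    refine ⟨?_, fun i hi a ha => ?_, fun i hi a => ?_⟩
    · rw [Function.iterate_succ_apply, hs, g1]
    · rcases i with _ | i
      · refine h2 a ?_
        rwa [Function.iterate_zero_apply, touched, h1] at ha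
      · rw [Function.iterate_succ_apply, hs] at ha
        exact g2 i (by omega) a ha
    · rcases i with _ | i
      · exact hc a
      · rw [Function.iterate_succ_apply, hs]
        exact g3 i (by omega) a

/-- The list `l` occurs in `P` at position `p`. -/
def CodeAt (P : List Instr) (p : ℕ) (l : List Instr) : Prop := ∃ A B, P = A ++ (l ++ B) ∧ A.length = p

theorem CodeAt.append {P l₁ l₂ : List Instr} {p : ℕ} (h : CodeAt P p (l₁ ++ l₂)) :
    CodeAt P p l₁ ∧ CodeAt P (p + l₁.length) l₂ := by
  obtain ⟨A, B, rfl, rfl⟩ := h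
  exact ⟨⟨A, l₂ ++ B, by simp, rfl⟩, ⟨A ++ l₁, B, by simp, by simp⟩⟩

theorem CodeAt.cons {P l : List Instr} {I : Instr} {p : ℕ} (h : CodeAt P p (I :: l)) :
    P[p]? = some I ∧ CodeAt P (p + 1) l := by
  obtain ⟨A, B, rfl, rfl⟩ := h
  exact ⟨by simp, ⟨A ++ [I], B, by simp, by simp⟩⟩

/-- The registers represent the state. -/
structure Rep (W : ℕ) (σ : St) (reg : ℕ → ℕ) : Prop where
  var : ∀ i < 30, reg (i + 2) = σ.v i
  mem : ∀ a, reg (32 + a) = σ.m a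
  le : ∀ a, reg a ≤ W

theorem Rep.scratch {W : ℕ} {σ : St} {reg : ℕ → ℕ} (h : Rep W σ reg) {d x : ℕ} (hd : d < 2) (hx : x ≤ W) :
    Rep W σ (Function.update reg d x) := by
  refine ⟨fun i hi => ?_, fun a => ?_, fun a => ?_⟩
  · rw [Function.update_of_ne (by omega)]; exact h.var i hi
  · rw [Function.update_of_ne (by omega)]; exact h.mem a
  · rw [Function.update_apply]; split_ifs
    · exact hx
    · exact h.le a

theorem Rep.set {W : ℕ} {σ : St} {reg : ℕ → ℕ} (h : Rep W σ reg) {d x : ℕ} (hd : d < 30) (hx : x ≤ W) :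
    Rep W (σ.set d x) (Function.update reg (d + 2) x) := by
  refine ⟨fun i hi => ?_, fun a => ?_, fun a => ?_⟩
  · rw [Function.update_apply, St.set_v, h.var i hi]
    simp
  · rw [Function.update_of_ne (by omega)]; exact h.mem a
  · rw [Function.update_apply]; split_ifs
    · exact hx
    · exact h.le a

theorem Rep.write {W : ℕ} {σ : St} {reg : ℕ → ℕ} (h : Rep W σ reg) {a x : ℕ} (hx : x ≤ W) :
    Rep W (σ.write a x) (Function.update reg (32 + a) x) := by
  refine ⟨fun i hi => ?_, fun b => ?_, fun b => ?_⟩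
  · rw [Function.update_of_ne (by omega)]; exact h.var i hi
  · rw [Function.update_apply, St.write_m, h.mem b]
    simp
  · rw [Function.update_apply]; split_ifs
    · exact hx
    · exact h.le b

/-- The slack of 40 covers the offset 32 of memory cells, the registers of the variables and the
constants loaded during address computations. -/
theorem Op.sim {P : List Instr} {S W N : ℕ} (hS : 40 + N ≤ S) (hW : 40 + N ≤ W) {o : Op} (hwf : o.wf)
    {σ : St} (hok : o.ok W N σ) {p : ℕ} (hP : CodeAt P p o.code) {reg : ℕ → ℕ} (h : Rep W σ reg) :
    ∃ reg', Steps P S W ⟨p, reg⟩ o.code.length ⟨p + o.code.length, reg'⟩ ∧ Rep W (o.exec σ) reg' := by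
  cases o with
  | const d c =>
    simp only [Op.wf, decide_eq_true_eq] at hwf
    obtain ⟨h1, -⟩ := hP.cons
    have hr := h.set hwf hok
    exact ⟨_, .next h1 (by simp [Instr.touched]; omega) rfl hr.le (.refl _), hr⟩
  | add d a b =>
    simp only [Op.wf, Bool.and_eq_true, decide_eq_true_eq] at hwf
    simp only [Op.ok] at hok
    obtain ⟨h1, -⟩ := hP.cons
    have hr := h.set (x := σ.v a + σ.v b) hwf.1.1
      (hok)
    refine ⟨_, .next h1 (by simp [Instr.touched]; omega) ?_ hr.le (.refl _), hr⟩
    simp [Instr.exec, h.var a hwf.1.2, h.var b hwf.2]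
  | sub d a b =>
    simp only [Op.wf, Bool.and_eq_true, decide_eq_true_eq] at hwf
    simp only [Op.ok] at hok
    obtain ⟨h1, -⟩ := hP.cons
    have hr := h.set (x := σ.v a - σ.v b) hwf.1.1
      ((Nat.sub_le _ _).trans (h.var a hwf.1.2 ▸ h.le _))
    refine ⟨_, .next h1 (by simp [Instr.touched]; omega) ?_ hr.le (.refl _), hr⟩
    simp [Instr.exec, h.var a hwf.1.2, h.var b hwf.2]
  | mul d a b =>
    simp only [Op.wf, Bool.and_eq_true, decide_eq_true_eq] at hwf
    simp only [Op.ok] at hok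
    obtain ⟨h1, -⟩ := hP.cons
    have hr := h.set (x := σ.v a * σ.v b) hwf.1.1
      (hok)
    refine ⟨_, .next h1 (by simp [Instr.touched]; omega) ?_ hr.le (.refl _), hr⟩
    simp [Instr.exec, h.var a hwf.1.2, h.var b hwf.2]
  | load d i =>
    simp only [Op.wf, Bool.and_eq_true, decide_eq_true_eq] at hwf
    simp only [Op.ok] at hok
    obtain ⟨h1, hP⟩ := hP.cons
    obtain ⟨h2, hP⟩ := hP.cons
    obtain ⟨h3, -⟩ := hP.cons
    have hr1 := h.scratch (d := 0) (x := 32) (by omega) (by omega)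
    have hr2 := hr1.scratch (d := 0) (x := 32 + σ.v i) (by omega) (by omega)
    have hr3 := hr2.set (d := d) (x := σ.m (σ.v i)) hwf.1 (by rw [← h.mem]; exact h.le _)
    refine ⟨_, .next h1 ?_ rfl hr1.le (.next h2 ?_ ?_ hr2.le (.next h3 ?_ ?_ hr3.le (.refl _))), hr3⟩
    · simp [Instr.touched]; omega
    · simp [Instr.touched]; omega
    · simp [Instr.exec, h.var i hwf.2]
    · simp [Instr.touched]; omega
    · simp only [Instr.exec, Function.update_self, hr2.mem]
  | store i b =>
    simp only [Op.wf, Bool.and_eq_true, decide_eq_true_eq] at hwf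
    simp only [Op.ok] at hok
    obtain ⟨h1, hP⟩ := hP.cons
    obtain ⟨h2, hP⟩ := hP.cons
    obtain ⟨h3, -⟩ := hP.cons
    have hr1 := h.scratch (d := 0) (x := 32) (by omega) (by omega)
    have hr2 := hr1.scratch (d := 0) (x := 32 + σ.v i) (by omega) (by omega)
    have hr3 := hr2.write (a := σ.v i) (x := σ.v b) (by rw [← h.var b hwf.2]; exact h.le _)
    refine ⟨_, .next h1 ?_ rfl hr1.le (.next h2 ?_ ?_ hr2.le (.next h3 ?_ ?_ hr3.le (.refl _))), hr3⟩
    · simp [Instr.touched]; omega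
    · simp [Instr.touched]; omega
    · simp [Instr.exec, h.var i hwf.1]
    · simp [Instr.touched]; omega
    · simp only [Instr.exec, Function.update_self, hr2.var b hwf.2]
  | get d r i =>
    simp only [Op.wf, Bool.and_eq_true, decide_eq_true_eq] at hwf
    simp only [Op.ok] at hok
    obtain ⟨h1, hP⟩ := hP.cons
    obtain ⟨h2, hP⟩ := hP.cons
    obtain ⟨h3, hP⟩ := hP.cons
    obtain ⟨h4, hP⟩ := hP.cons
    obtain ⟨h5, -⟩ := hP.cons
    have hr1 := h.scratch (d := 0) (x := 4) (by omega) (by omega)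
    have hr2 := hr1.scratch (d := 0) (x := 4 * σ.v i) (by omega) (by omega)
    have hr3 := hr2.scratch (d := 1) (x := 32 + r) (by omega) (by omega)
    have hr4 := hr3.scratch (d := 0) (x := 32 + (4 * σ.v i + r)) (by omega) (by omega)
    have hr5 := hr4.set (d := d) (x := σ.m (4 * σ.v i + r)) hwf.1 (by rw [← h.mem]; exact h.le _)
    refine ⟨_, .next h1 ?_ rfl hr1.le (.next h2 ?_ ?_ hr2.le (.next h3 ?_ rfl hr3.le
      (.next h4 ?_ ?_ hr4.le (.next h5 ?_ ?_ hr5.le (.refl _))))), hr5⟩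
    · simp [Instr.touched]; omega
    · simp [Instr.touched]; omega
    · simp [Instr.exec, h.var i hwf.2]
    · simp [Instr.touched]; omega
    · simp [Instr.touched]; omega
    · simp [Instr.exec, add_left_comm, add_comm]; rw [add_assoc]
    · simp [Instr.touched]; omega
    · simp only [Instr.exec, Function.update_self, hr4.mem]
  | put r i b =>
    simp only [Op.wf, Bool.and_eq_true, decide_eq_true_eq] at hwf
    simp only [Op.ok] at hok
    obtain ⟨h1, hP⟩ := hP.cons
    obtain ⟨h2, hP⟩ := hP.cons
    obtain ⟨h3, hP⟩ := hP.cons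
    obtain ⟨h4, hP⟩ := hP.cons
    obtain ⟨h5, -⟩ := hP.cons
    have hr1 := h.scratch (d := 0) (x := 4) (by omega) (by omega)
    have hr2 := hr1.scratch (d := 0) (x := 4 * σ.v i) (by omega) (by omega)
    have hr3 := hr2.scratch (d := 1) (x := 32 + r) (by omega) (by omega)
    have hr4 := hr3.scratch (d := 0) (x := 32 + (4 * σ.v i + r)) (by omega) (by omega)
    have hr5 := hr4.write (a := 4 * σ.v i + r) (x := σ.v b) (by rw [← h.var b hwf.2]; exact h.le _)
    refine ⟨_, .next h1 ?_ rfl hr1.le (.next h2 ?_ ?_ hr2.le (.next h3 ?_ rfl hr3.le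
      (.next h4 ?_ ?_ hr4.le (.next h5 ?_ ?_ hr5.le (.refl _))))), hr5⟩
    · simp [Instr.touched]; omega
    · simp [Instr.touched]; omega
    · simp [Instr.exec, h.var i hwf.1]
    · simp [Instr.touched]; omega
    · simp [Instr.touched]; omega
    · simp [Instr.exec, add_left_comm, add_comm]; rw [add_assoc]
    · simp [Instr.touched]; omega
    · simp only [Instr.exec, Function.update_self, hr4.var b hwf.2]

theorem sim_ops {P : List Instr} {S W N : ℕ} (hS : 40 + N ≤ S) (hW : 40 + N ≤ W) : ∀ {l : List Op},
    l.all Op.wf → ∀ {σ : St}, okOps W N l σ → ∀ {p : ℕ}, CodeAt P p (l.flatMap Op.code) →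
    ∀ {reg : ℕ → ℕ}, Rep W σ reg → ∃ reg', Steps P S W ⟨p, reg⟩ (l.flatMap Op.code).length
      ⟨p + (l.flatMap Op.code).length, reg'⟩ ∧ Rep W (runOps l σ) reg'
  | [], _, _, _, _, _, _, h => ⟨_, .refl _, h⟩
  | o :: l, hwf, σ, hok, p, hP, reg, h => by
    rw [List.all_cons, Bool.and_eq_true] at hwf
    rw [List.flatMap_cons] at hP ⊢
    obtain ⟨hP1, hP2⟩ := hP.append
    obtain ⟨r1, s1, h1⟩ := Op.sim hS hW hwf.1 hok.1 hP1 h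
    obtain ⟨r2, s2, h2⟩ := sim_ops hS hW hwf.2 hok.2 hP2 h1
    rw [List.length_append, ← add_assoc]
    exact ⟨r2, s1.trans s2, h2⟩

/-- The machine code of a structured program does what the program does. -/
theorem Ex.sim {P : List Instr} {S W N : ℕ} (hS : 40 + N ≤ S) (hW : 40 + N ≤ W) {c : Cmd} {σ σ' : St} {t : ℕ}
    (he : Ex W N c σ t σ') (hwf : c.wf) {p : ℕ} (hP : CodeAt P p (c.code p)) {reg : ℕ → ℕ}
    (h : Rep W σ reg) : ∃ reg', Steps P S W ⟨p, reg⟩ t ⟨p + c.size, reg'⟩ ∧ Rep W σ' reg' := by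
  induction he generalizing p reg with
  | ops hok => exact sim_ops hS hW hwf hok hP h
  | @seq c₁ c₂ σ t₁ σ₁ t₂ σ₂ _ _ ih1 ih2 =>
    rw [Cmd.wf, Bool.and_eq_true] at hwf
    obtain ⟨hP1, hP2⟩ := CodeAt.append hP
    rw [Cmd.length_code] at hP2
    obtain ⟨r1, s1, h1⟩ := ih1 hwf.1 hP1 h
    obtain ⟨r2, s2, h2⟩ := ih2 hwf.2 hP2 h1
    rw [Cmd.size, ← add_assoc]
    exact ⟨r2, s1.trans s2, h2⟩
  | @iteZero x c₁ c₂ σ t σ' hx _ ih =>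
    simp only [Cmd.wf, Bool.and_eq_true, decide_eq_true_eq] at hwf
    obtain ⟨g1, hP⟩ := CodeAt.cons hP
    obtain ⟨-, hP⟩ := hP.append
    obtain ⟨-, hP⟩ := hP.cons
    obtain ⟨-, hP⟩ := hP.cons
    rw [Cmd.length_code, show p + 1 + c₂.size + 1 + 1 = p + c₂.size + 3 by omega] at hP
    obtain ⟨r1, s1, h1⟩ := ih hwf.1.2 hP h
    refine ⟨r1, ?_, h1⟩
    rw [add_comm 1]
    rw [show p + c₂.size + 3 + c₁.size = p + (Cmd.ite x c₁ c₂).size by simp only [Cmd.size]; omega] at s1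
    refine .cons g1 ?_ ?_ h.le s1
    · simp [Instr.touched]; omega
    · simp [Instr.exec, h.var x hwf.1.1, hx]
  | @iteNe x c₁ c₂ σ t σ' hx _ ih =>
    simp only [Cmd.wf, Bool.and_eq_true, decide_eq_true_eq] at hwf
    obtain ⟨g1, hP⟩ := CodeAt.cons hP
    obtain ⟨hP2, hP⟩ := hP.append
    obtain ⟨g3, hP⟩ := hP.cons
    obtain ⟨g4, hP⟩ := hP.cons
    rw [Cmd.length_code] at g3 g4
    obtain ⟨r1, s1, h1⟩ := ih hwf.2 hP2 h
    have hr := h1.scratch (d := 0) (x := 0) (by omega) (by omega)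
    refine ⟨_, ?_, hr⟩
    rw [add_comm 1]
    refine .cons g1 ?_ ?_ h.le (s1.trans (.next g3 ?_ rfl hr.le (.cons g4 ?_ ?_ hr.le (.refl _))))
    · simp [Instr.touched]; omega
    · simp [Instr.exec, h.var x hwf.1.1, hx]
    · simp [Instr.touched]; omega
    · simp [Instr.touched]; omega
    · simp only [Instr.exec, Function.update_self, if_true, Cmd.size]; congr 1; omega
  | @loopZero x c σ hx =>
    simp only [Cmd.wf, Bool.and_eq_true, decide_eq_true_eq] at hwf
    obtain ⟨g1, hP⟩ := CodeAt.cons hP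
    refine ⟨_, .cons g1 ?_ ?_ h.le (.refl _), h⟩
    · simp [Instr.touched]; omega
    · simp [Instr.exec, h.var x hwf.1, hx, Cmd.size]; omega
  | @loopNe x c σ t σ₁ t' σ₂ hx _ _ ih1 ih2 =>
    have hwf' := hwf
    have hP' := hP
    simp only [Cmd.wf, Bool.and_eq_true, decide_eq_true_eq] at hwf
    obtain ⟨g1, hP⟩ := CodeAt.cons hP
    obtain ⟨hP2, hP⟩ := hP.append
    obtain ⟨g3, hP⟩ := hP.cons
    obtain ⟨g4, hP⟩ := hP.cons
    obtain ⟨g5, hP⟩ := hP.cons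
    obtain ⟨g6, hP⟩ := hP.cons
    rw [Cmd.length_code] at g3 g4 g5 g6
    obtain ⟨r1, s1, h1⟩ := ih1 hwf.2 hP2 h
    have hr1 := h1.scratch (d := 1) (x := 1) (by omega) (by omega)
    have hr2 := hr1.set (d := x) (x := σ₁.v x - 1) hwf.1
      ((Nat.sub_le _ _).trans (h1.var x hwf.1 ▸ h1.le _))
    have hr3 := hr2.scratch (d := 0) (x := 0) (by omega) (by omega)
    obtain ⟨r2, s2, h2⟩ := ih2 hwf' hP' hr3
    refine ⟨r2, ?_, h2⟩
    rw [add_comm 1, add_comm 4]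
    refine .cons g1 ?_ ?_ h.le (s1.trans (.next g3 ?_ rfl hr1.le (.next g4 ?_ ?_ hr2.le
      (.next g5 ?_ rfl hr3.le (.cons g6 ?_ ?_ hr3.le s2)))))
    · simp [Instr.touched]; omega
    · simp [Instr.exec, h.var x hwf.1, hx]
    · simp [Instr.touched]; omega
    · simp [Instr.touched]; omega
    · simp [Instr.exec, h1.var x hwf.1]
    · simp [Instr.touched]; omega
    · simp [Instr.touched]; omega
    · simp [Instr.exec]

/-! ### Program logic -/

attribute [simp] St.set_v St.set_m St.write_v St.write_m okOps runOps Op.exec Op.ok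

/-- The variables that an operation may change. -/
def Op.mods : Op → List ℕ
  | .const d _ | .add d _ _ | .sub d _ _ | .mul d _ _ | .load d _ | .get d _ _ => [d]
  | .store _ _ | .put _ _ _ => []

/-- The operation does not change the memory. -/
def Op.pure : Op → Bool
  | .store _ _ | .put _ _ _ => false
  | _ => true

/-- The variables that a program may change. -/
def Cmd.mods : Cmd → List ℕ
  | .ops l => l.flatMap Op.mods
  | .seq c₁ c₂ => c₁.mods ++ c₂.mods
  | .ite _ c₁ c₂ => c₁.mods ++ c₂.mods
  | .loop x c => x :: c.mods

/-- The program does not change the memory. -/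
def Cmd.pure : Cmd → Bool
  | .ops l => l.all Op.pure
  | .seq c₁ c₂ => c₁.pure && c₂.pure
  | .ite _ c₁ c₂ => c₁.pure && c₂.pure
  | .loop _ c => c.pure

/-- Two states agree in all variables outside a list. -/
def Frame (l : List ℕ) (σ τ : St) : Prop := ∀ y, y ∉ l → τ.v y = σ.v y

theorem frame_ops : ∀ (l : List Op) (σ : St), Frame (l.flatMap Op.mods) σ (runOps l σ)
  | [], _, _, _ => rfl
  | o :: l, σ, y, hy => by
    rw [List.flatMap_cons, List.mem_append, not_or] at hy
    rw [runOps, frame_ops l _ y hy.2]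
    cases o <;> simp_all [Op.mods]

theorem pure_ops : ∀ (l : List Op) (σ : St), l.all Op.pure → (runOps l σ).m = σ.m
  | [], _, _ => rfl
  | o :: l, σ, h => by
    rw [List.all_cons, Bool.and_eq_true] at h
    rw [runOps, pure_ops l _ h.2]
    cases o <;> simp_all [Op.pure]

theorem Ex.frame {W N : ℕ} {c : Cmd} {σ σ' : St} {t : ℕ} (h : Ex W N c σ t σ') : Frame c.mods σ σ' := by
  induction h with
  | ops _ => exact frame_ops _ _
  | seq _ _ h1 h2 =>
    intro y hy
    rw [Cmd.mods, List.mem_append, not_or] at hy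
    rw [h2 y hy.2, h1 y hy.1]
  | iteZero _ _ h =>
    intro y hy
    rw [Cmd.mods, List.mem_append, not_or] at hy
    exact h y hy.1
  | iteNe _ _ h =>
    intro y hy
    rw [Cmd.mods, List.mem_append, not_or] at hy
    exact h y hy.2
  | loopZero _ => exact fun _ _ => rfl
  | loopNe _ _ _ h1 h2 =>
    intro y hy
    rw [h2 y hy, St.set_v]
    rw [Cmd.mods, List.mem_cons, not_or] at hy
    rw [if_neg hy.1, h1 y hy.2]

theorem Ex.pure {W N : ℕ} {c : Cmd} {σ σ' : St} {t : ℕ} (h : Ex W N c σ t σ') (hc : c.pure) :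
    σ'.m = σ.m := by
  induction h with
  | ops _ => exact pure_ops _ _ hc
  | seq _ _ h1 h2 =>
    rw [Cmd.pure, Bool.and_eq_true] at hc
    rw [h2 hc.2, h1 hc.1]
  | iteZero _ _ h =>
    rw [Cmd.pure, Bool.and_eq_true] at hc
    exact h hc.1
  | iteNe _ _ h =>
    rw [Cmd.pure, Bool.and_eq_true] at hc
    exact h hc.2
  | loopZero _ => rfl
  | loopNe _ _ _ h1 h2 => rw [h2 hc, St.set_m, h1 hc]

/-- Started in `σ`, the program terminates within time `T` in a state that satisfies `Q`, and
respects the bounds. -/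
def Tri (W N : ℕ) (c : Cmd) (σ : St) (T : ℕ) (Q : St → Prop) : Prop :=
  ∃ t σ', t ≤ T ∧ Ex W N c σ t σ' ∧ Q σ'

section

variable {W N : ℕ} {c c₁ c₂ : Cmd} {σ : St} {T T₁ T₂ : ℕ} {Q R : St → Prop}

theorem Tri.time (h : Tri W N c σ T₁ Q) (hT : T₁ ≤ T) : Tri W N c σ T Q := by
  obtain ⟨t, σ', h1, h2⟩ := h
  exact ⟨t, σ', h1.trans hT, h2⟩

/-- The unchanged variables, and the unchanged memory of a pure program, are supplied here once and
for all, so specifications only mention what a program computes. -/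
theorem Tri.mono (h : Tri W N c σ T Q) (hR : ∀ τ, Q τ → Frame c.mods σ τ → (c.pure → τ.m = σ.m) → R τ) :
    Tri W N c σ T R := by
  obtain ⟨t, σ', h1, h2, h3⟩ := h
  exact ⟨t, σ', h1, h2, hR _ h3 h2.frame h2.pure⟩

theorem Tri.seq (h : Tri W N c₁ σ T₁ R) (h' : ∀ τ, R τ → Frame c₁.mods σ τ → (c₁.pure → τ.m = σ.m) →
    Tri W N c₂ τ T₂ Q) : Tri W N (c₁ ;; c₂) σ (T₁ + T₂) Q := by
  obtain ⟨t, σ', h1, h2, h3⟩ := h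
  obtain ⟨t', σ'', h1', h2', h3'⟩ := h' _ h3 h2.frame h2.pure
  exact ⟨_, _, Nat.add_le_add h1 h1', .seq h2 h2', h3'⟩

theorem length_code_le (l : List Op) : (l.flatMap Op.code).length ≤ 5 * l.length := by
  induction l with
  | nil => rfl
  | cons o l ih =>
    have := o.length_code_le
    rw [List.flatMap_cons, List.length_append, List.length_cons]
    omega

theorem Tri.ops {l : List Op} (h : okOps W N l σ) (hQ : Q (runOps l σ)) :
    Tri W N (.ops l) σ (5 * l.length) Q :=
  ⟨_, _, length_code_le l, .ops h, hQ⟩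

theorem Tri.opsSeq {l : List Op} (h : okOps W N l σ) (h' : Tri W N c (runOps l σ) T Q) :
    Tri W N (.ops l ;; c) σ (5 * l.length + T) Q := by
  obtain ⟨t, σ', h1, h2, h3⟩ := h'
  exact ⟨_, _, Nat.add_le_add (length_code_le l) h1, .seq (.ops h) h2, h3⟩

theorem Tri.ite {x : ℕ} (h1 : σ.v x = 0 → Tri W N c₁ σ T Q) (h2 : σ.v x ≠ 0 → Tri W N c₂ σ T Q) :
    Tri W N (.ite x c₁ c₂) σ (T + 3) Q := by
  by_cases hx : σ.v x = 0
  · obtain ⟨t, σ', h1, h2, h3⟩ := h1 hx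
    exact ⟨_, _, by omega, .iteZero hx h2, h3⟩
  · obtain ⟨t, σ', h1, h2, h3⟩ := h2 hx
    exact ⟨_, _, by omega, .iteNe hx h2, h3⟩

/-- The invariant is indexed by the number of completed rounds and must hold after the counter has
been decremented. Each round costs one test and four instructions besides the body; `T + 5` accounts
for these, and the final `+ 1` for the last test. -/
theorem Tri.loop {x : ℕ} {M : ℕ} (hx : x ∉ c.mods) (I : ℕ → St → Prop) (hM : σ.v x ≤ M) (h0 : I 0 σ)
    (hb : ∀ i < σ.v x, ∀ τ, I i τ → τ.v x = σ.v x - i → Frame (x :: c.mods) σ τ →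
      (c.pure → τ.m = σ.m) → Tri W N c τ T fun τ' => I (i + 1) (τ'.set x (σ.v x - i - 1))) :
    Tri W N (.loop x c) σ (M * (T + 5) + 1) fun τ => τ.v x = 0 ∧ I (σ.v x) τ := by
  suffices H : ∀ d i, i + d = σ.v x → ∀ τ, I i τ → τ.v x = d → Frame (x :: c.mods) σ τ →
      (c.pure → τ.m = σ.m) → ∃ t τ', t ≤ d * (T + 5) + 1 ∧ Ex W N (.loop x c) τ t τ' ∧
        τ'.v x = 0 ∧ I (σ.v x) τ' by
    obtain ⟨t, τ, h1, h2⟩ := H _ 0 (zero_add _) σ h0 rfl (fun _ _ => rfl) fun _ => rfl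
    exact ⟨t, τ, h1.trans (by gcongr), h2⟩
  intro d
  induction d with
  | zero =>
    intro i hi τ h1 h2 h3 h4
    rw [add_zero] at hi
    subst hi
    exact ⟨1, τ, by omega, .loopZero h2, h2, h1⟩
  | succ d ih =>
    intro i hi τ h1 h2 h3 h4
    obtain ⟨t, τ', g1, g2, g3⟩ := hb i (by omega) τ h1 (by omega) h3 h4
    have e1 : τ'.v x = d + 1 := by rw [g2.frame x hx, h2]
    have e2 : σ.v x - i - 1 = d := by omega
    rw [e2] at g3
    obtain ⟨t', τ'', k1, k2, k3⟩ := ih (i + 1) (by omega) _ g3 (by simp)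
      (fun y hy => by
        rw [St.set_v, if_neg (by simp at hy; exact hy.1), g2.frame y (by simp at hy; exact hy.2), h3 y hy])
      (fun hc => by rw [St.set_m, g2.pure hc, h4 hc])
    refine ⟨_, τ'', ?_, .loopNe (by omega) g2 (by rwa [e1, Nat.add_sub_cancel]), k3⟩
    rw [add_mul]
    omega

end

/-! ### Programming the recursion -/

/-- The recursion for the numbers `D t v`. -/
structure IsCountTable (n k B : ℕ) (x : ℕ → ℕ) (D : ℕ → ℕ → ℕ) : Prop where
  zero : ∀ v, D 0 v = if v = 0 then 1 else 0
  succ : ∀ t, 1 ≤ t → t ≤ n → ∀ v, D t v = ∑ j ∈ Finset.range t, ∑ i ∈ Finset.range (k - x j),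
    D (t - 1 - j) (v - (∑ e ∈ Finset.range (j + 1), x e + 1 + i))
  le : ∀ t ≤ n, ∀ v, D t v ≤ B

/-- The bounds on the parameters that the programs need. -/
structure ParamBounds (n k w B W N : ℕ) : Prop where
  table : 4 * ((n + 1) * (w + 1)) + 2 < N
  array : 32 * n + k + 100 < N
  prod : (n + 1) * (k + 1) ≤ N
  le : N ≤ W
  sum : n * (n * (k * B)) ≤ W
  pow : (k + 1) ^ n ≤ W

/-- One entry of the table; also computes the weighted sum. -/
def cellCmd : Cmd :=
  .ops [.const 10 0, .const 11 0, .const 12 0, .const 13 0, .const 18 0, .add 14 8 18, .add 15 5 18] ;;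
  .loop 15 (
    .ops [.sub 14 14 3, .get 16 1 13, .add 13 13 4, .add 12 12 16, .add 17 12 4, .const 18 0,
      .sub 19 1 16] ;;
    .loop 19 (.ops [.sub 20 7 17, .add 20 20 14, .get 20 2 20, .add 18 18 20, .add 17 17 4]) ;;
    .ops [.add 10 10 18, .mul 21 18 13, .add 11 11 21])

theorem cell_lt {n w t v : ℕ} (ht : t ≤ n) (hv : v ≤ w) : t * (w + 1) + v < (n + 1) * (w + 1) := by
  have := Nat.mul_le_mul_right (w + 1) ht
  rw [add_mul]
  omega

theorem cell_inj {w t t' v v' : ℕ} (hv : v ≤ w) (hv' : v' ≤ w) (h : t * (w + 1) + v = t' * (w + 1) + v') :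
    t = t' ∧ v = v' := by
  have h1 : (t * (w + 1) + v) % (w + 1) = v := by
    rw [add_comm, Nat.add_mul_mod_self_right, Nat.mod_eq_of_lt (by omega)]
  have h2 : (t' * (w + 1) + v') % (w + 1) = v' := by
    rw [add_comm, Nat.add_mul_mod_self_right, Nat.mod_eq_of_lt (by omega)]
  have h3 : v = v' := by rw [← h1, h, h2]
  subst h3
  exact ⟨Nat.eq_of_mul_eq_mul_right (by omega : 0 < w + 1) (by omega), rfl⟩

/-- In round `j`, variable 12 holds the sum of the `x e` with `e < j`, variable 13 holds `j`, and
variable 14 the start `(t - j)(w + 1)` of a row, moved back before use. The inner loop sums `k - x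
j` entries of that row into variable 18, with truncated subtraction for the remaining weight.
Variables 10 and 11 collect the plain and the weighted sum. -/
theorem cellCmd_spec {n k w B W N t v : ℕ} {x : ℕ → ℕ} {D : ℕ → ℕ → ℕ} (hb : ParamBounds n k w B W N)
    (hx : ∀ e < n, x e ≤ k) (hD : ∀ t ≤ n, ∀ v, D t v ≤ B) (ht : t ≤ n) (hv : v ≤ w)
    {σ : St} (h1 : σ.v 1 = k) (h3 : σ.v 3 = w + 1) (h4 : σ.v 4 = 1) (h5 : σ.v 5 = t) (h7 : σ.v 7 = v)
    (h8 : σ.v 8 = t * (w + 1)) (hmx : ∀ e < n, σ.m (4 * e + 1) = x e)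
    (hmD : ∀ t' < t, ∀ v' ≤ w, σ.m (4 * (t' * (w + 1) + v') + 2) = D t' v') :
    Tri W N cellCmd σ (n * (30 * k + 60) + 40) fun τ =>
      τ.v 10 = ∑ j ∈ Finset.range t, ∑ i ∈ Finset.range (k - x j),
        D (t - 1 - j) (v - (∑ e ∈ Finset.range (j + 1), x e + 1 + i)) ∧
      τ.v 11 = ∑ j ∈ Finset.range t, (j + 1) * ∑ i ∈ Finset.range (k - x j),
        D (t - 1 - j) (v - (∑ e ∈ Finset.range (j + 1), x e + 1 + i)) := by
  have b1 := hb.table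
  have b2 := hb.array
  have b3 := hb.prod
  have b4 := hb.le
  have b5 := hb.sum
  have c1 := cell_lt ht hv
  set inner : ℕ → ℕ := fun j => ∑ i ∈ Finset.range (k - x j),
        D (t - 1 - j) (v - (∑ e ∈ Finset.range (j + 1), x e + 1 + i)) with hinner
  have hA : ∀ j < n, ∑ e ∈ Finset.range (j + 1), x e ≤ n * k := by
    intro j hj
    calc ∑ e ∈ Finset.range (j + 1), x e ≤ ∑ e ∈ Finset.range (j + 1), k :=
          Finset.sum_le_sum fun e he => hx e (by simp at he; omega)
      _ ≤ n * k := by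
          rw [Finset.sum_const, Finset.card_range, smul_eq_mul]; gcongr; omega
  have hin : ∀ j < t, inner j ≤ k * B := by
    intro j hj
    calc inner j ≤ ∑ i ∈ Finset.range (k - x j), B :=
          Finset.sum_le_sum fun e he => hD _ (by omega) _
      _ ≤ k * B := by
          rw [Finset.sum_const, Finset.card_range, smul_eq_mul]; gcongr; omega
  have hs1 : ∀ j ≤ t, ∑ i ∈ Finset.range j, inner i ≤ n * (k * B) := by
    intro j hj
    calc ∑ i ∈ Finset.range j, inner i ≤ ∑ i ∈ Finset.range j, k * B :=
          Finset.sum_le_sum fun e he => hin e (by simp at he; omega)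
      _ ≤ n * (k * B) := by
          rw [Finset.sum_const, Finset.card_range, smul_eq_mul]; gcongr; omega
  have hs2 : ∀ j ≤ t, ∑ i ∈ Finset.range j, (i + 1) * inner i ≤ n * (n * (k * B)) := by
    intro j hj
    calc ∑ i ∈ Finset.range j, (i + 1) * inner i ≤ ∑ i ∈ Finset.range j, n * (k * B) :=
          Finset.sum_le_sum fun e he => by
            simp at he
            exact Nat.mul_le_mul (by omega) (hin e (by omega))
      _ ≤ n * (n * (k * B)) := by
          rw [Finset.sum_const, Finset.card_range, smul_eq_mul]; gcongr; omega
  have b6 : n * (k * B) ≤ W := by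
    rcases Nat.eq_zero_or_pos n with rfl | hn
    · simp
    · exact (Nat.le_mul_of_pos_left _ hn).trans b5
  have b7 : k * B ≤ W ∨ t = 0 := by
    rcases Nat.eq_zero_or_pos n with rfl | hn
    · right; omega
    · left; exact (Nat.le_mul_of_pos_left _ hn).trans b6
  have b8 : n * k + k + n + 1 ≤ W := by rw [add_mul, mul_add] at b3; omega
  refine Tri.time (T₁ := 5 * 7 + (n * (5 * 7 + (k * (5 * 5 + 5) + 1 + 5 * 3) + 5) + 1)) (Tri.opsSeq ?_ ?_) ?_
  · simp [h8, h5]; omega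
  · refine (Tri.loop (M := n) (T := 5 * 7 + (k * (5 * 5 + 5) + 1 + 5 * 3)) (by decide)
      (fun j τ => τ.v 10 = ∑ i ∈ Finset.range j, inner i ∧
        τ.v 11 = ∑ i ∈ Finset.range j, (i + 1) * inner i ∧ τ.v 12 = ∑ e ∈ Finset.range j, x e ∧
        τ.v 13 = j ∧ τ.v 14 = (t - j) * (w + 1)) ?_ ?_ ?_).mono ?_
    · simp [h5, ht]
    · simp [h8]
    · intro j hj τ ⟨g10, g11, g12, g13, g14⟩ g15 hf hm
      have hm := hm (by decide)
      simp only [runOps, Op.exec, St.set_m] at hm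
      simp only [runOps, Op.exec, St.set_v, if_true] at hj
      simp [h5] at hj
      have f1 : τ.v 1 = k := by rw [hf 1 (by decide)]; simp [h1]
      have f3 : τ.v 3 = w + 1 := by rw [hf 3 (by decide)]; simp [h3]
      have f4 : τ.v 4 = 1 := by rw [hf 4 (by decide)]; simp [h4]
      have f7 : τ.v 7 = v := by rw [hf 7 (by decide)]; simp [h7]
      have hA1 := hA j (by omega)
      have e14 : (t - j) * (w + 1) - (w + 1) = (t - 1 - j) * (w + 1) := by
        rw [← Nat.sub_one_mul]; congr 1; omega
      have ex : τ.m (4 * j + 1) = x j := by rw [hm, hmx j (by omega)]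
      have hxj := hx j (by omega)
      refine Tri.opsSeq ?_ (Tri.seq (R := fun τ' => τ'.v 18 = inner j) (Tri.mono (Tri.loop (M := k) (by decide)
        (fun i τ' => τ'.v 17 = ∑ e ∈ Finset.range (j + 1), x e + 1 + i ∧ τ'.v 18 = ∑ i' ∈ Finset.range i,
          D (t - 1 - j) (v - (∑ e ∈ Finset.range (j + 1), x e + 1 + i'))) ?_ ?_ ?_) ?_) ?_)
      · simp [f3, f4, g12, g13, g14, ex, ← Finset.sum_range_succ]
        omega
      · simp [f1, g13, ex]
      · simp [g12, f4, g13, ex, ← Finset.sum_range_succ]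
      · intro i hi τ' ⟨k17, k18⟩ k19 hf' hm'
        have hm' := hm' (by decide)
        simp [f1, g13, ex] at hi hm'
        have q4 : τ'.v 4 = 1 := by rw [hf' 4 (by decide)]; simp [f4]
        have q7 : τ'.v 7 = v := by rw [hf' 7 (by decide)]; simp [f7]
        have q14 : τ'.v 14 = (t - 1 - j) * (w + 1) := by
          rw [hf' 14 (by decide)]; simp [g14, f3, e14]
        have ec := hmD (t - 1 - j) (by omega) (v - (∑ e ∈ Finset.range (j + 1), x e + 1 + i)) (by omega)
        have c2 := cell_lt (n := n) (t := t - 1 - j) (v := v - (∑ e ∈ Finset.range (j + 1), x e + 1 + i))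
          (w := w) (by omega) (by omega)
        rw [add_comm ((t - 1 - j) * (w + 1))] at ec c2
        have hle : ∑ i' ∈ Finset.range (i + 1),
            D (t - 1 - j) (v - (∑ e ∈ Finset.range (j + 1), x e + 1 + i')) ≤ k * B :=
          le_trans (Finset.sum_le_sum_of_subset (Finset.range_subset_range.2 (by omega))) (hin j hj)
        rw [Finset.sum_range_succ _ i] at hle
        refine Tri.ops ?_ ?_
        · simp [q7, q14, q4, k17, k18, hm', hm, ec]
          omega
        · simp [q7, q14, q4, k17, k18, hm', hm, ec, Finset.sum_range_succ _ i]
          omega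
      · intro τ' ⟨_, _, k18⟩ _ _
        rw [k18]
        simp [f1, g13, ex, hinner]
      · intro τ' k18 hf' hm'
        have q10 : τ'.v 10 = ∑ i ∈ Finset.range j, inner i := by rw [hf' 10 (by decide)]; simp [g10]
        have q11 : τ'.v 11 = ∑ i ∈ Finset.range j, (i + 1) * inner i := by rw [hf' 11 (by decide)]; simp [g11]
        have q12 : τ'.v 12 = ∑ i ∈ Finset.range (j + 1), x i := by
          rw [hf' 12 (by decide)]; simp [g12, g13, ex, Finset.sum_range_succ]
        have q13 : τ'.v 13 = j + 1 := by rw [hf' 13 (by decide)]; simp [g13, f4]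
        have q14 : τ'.v 14 = (t - (j + 1)) * (w + 1) := by
          rw [hf' 14 (by decide), ← Nat.sub_sub, Nat.sub_right_comm]; simp [g14, f3, e14]
        have u1 := hs1 (j + 1) (by omega)
        have u2 := hs2 (j + 1) (by omega)
        rw [Finset.sum_range_succ] at u1 u2
        refine Tri.ops ?_ ?_
        · simp [q10, q11, q13, k18, mul_comm (inner j)]
          omega
        · simp [q10, q11, q12, q13, q14, k18, Finset.sum_range_succ, mul_comm (inner j)]
    · intro τ ⟨_, g10, g11, _⟩ _ _
      simp [h5] at g10 g11
      exact ⟨g10, g11⟩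
  · simp
    ring_nf
    omega

/-- One row of the table. -/
def rowCmd : Cmd :=
  .ops [.add 5 5 4, .mul 8 5 3, .const 7 0, .add 9 3 7] ;;
  .loop 9 (cellCmd ;; .ops [.add 20 8 7, .put 2 20 10, .add 7 7 4])

/-- The table, and the weighted sum for its last entry. -/
def countCmd : Cmd :=
  .ops [.add 3 2 4, .const 5 0, .put 2 5 4, .add 6 2 5] ;;
  .loop 6 (.ops [.const 7 0, .put 2 6 7]) ;;
  .ops [.const 5 0, .add 6 0 5] ;;
  .loop 6 rowCmd

/-- The weighted sum belonging to an entry of the table. -/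
def weightedSum (k : ℕ) (x : ℕ → ℕ) (D : ℕ → ℕ → ℕ) (t v : ℕ) : ℕ :=
  ∑ j ∈ Finset.range t, (j + 1) * ∑ i ∈ Finset.range (k - x j),
    D (t - 1 - j) (v - (∑ e ∈ Finset.range (j + 1), x e + 1 + i))

/-- An entry depends only on earlier rows, so a row can be filled in any order. Only cells that are
2 modulo 4 are written; the other interleaved arrays survive. After the last entry, variable 11
still holds its weighted sum. -/
theorem rowCmd_spec {n k w B W N t : ℕ} {x : ℕ → ℕ} {D : ℕ → ℕ → ℕ} (hb : ParamBounds n k w B W N)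
    (hx : ∀ e < n, x e ≤ k) (hD : IsCountTable n k B x D) (ht : t < n)
    {σ : St} (h1 : σ.v 1 = k) (h3 : σ.v 3 = w + 1) (h4 : σ.v 4 = 1) (h5 : σ.v 5 = t)
    (hmx : ∀ e < n, σ.m (4 * e + 1) = x e)
    (hmD : ∀ t' < t + 1, ∀ v' ≤ w, σ.m (4 * (t' * (w + 1) + v') + 2) = D t' v') :
    Tri W N rowCmd σ ((w + 1) * (n * (30 * k + 60) + 60) + 21) fun τ => τ.v 5 = t + 1 ∧
      (∀ t' < t + 2, ∀ v' ≤ w, τ.m (4 * (t' * (w + 1) + v') + 2) = D t' v') ∧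
      (∀ a, a % 4 ≠ 2 → τ.m a = σ.m a) ∧ τ.v 11 = weightedSum k x D (t + 1) w := by
  have b1 := hb.table
  have b2 := hb.array
  have b3 := hb.prod
  have b4 := hb.le
  have c0 : w + 1 ≤ (n + 1) * (w + 1) := Nat.le_mul_of_pos_left (w + 1) (Nat.succ_pos n)
  have c1 := cell_lt (n := n) (w := w) (t := t + 1) (v := 0) ht (Nat.zero_le _)
  refine Tri.time (T₁ := 5 * 4 + ((w + 1) * ((n * (30 * k + 60) + 40) + 5 * 3 + 5) + 1))
    (Tri.opsSeq ?_ ?_) (by ring_nf; omega)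
  · simp [h3, h5, h4]; omega
  refine (Tri.loop (M := w + 1) (T := (n * (30 * k + 60) + 40) + 5 * 3) (by decide) (fun i τ => τ.v 7 = i ∧
    (∀ t' < t + 1, ∀ v' ≤ w, τ.m (4 * (t' * (w + 1) + v') + 2) = D t' v') ∧
    (∀ v' < i, τ.m (4 * ((t + 1) * (w + 1) + v') + 2) = D (t + 1) v') ∧
    (∀ a, a % 4 ≠ 2 → τ.m a = σ.m a) ∧ (0 < i → τ.v 11 = weightedSum k x D (t + 1) (i - 1))) ?_ ?_ ?_).mono ?_
  · simp [h3]
  · simpa using hmD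
  · intro i hi τ ⟨g7, gp, gc, gm, _⟩ _ hf _
    simp [h3] at hi
    have f1 : τ.v 1 = k := by rw [hf 1 (by decide)]; simp [h1]
    have f3 : τ.v 3 = w + 1 := by rw [hf 3 (by decide)]; simp [h3]
    have f4 : τ.v 4 = 1 := by rw [hf 4 (by decide)]; simp [h4]
    have f5 : τ.v 5 = t + 1 := by rw [hf 5 (by decide)]; simp [h5, h4]
    have f8 : τ.v 8 = (t + 1) * (w + 1) := by rw [hf 8 (by decide)]; simp [h5, h4, h3]
    have c2 := cell_lt (n := n) (w := w) (t := t + 1) (v := i) ht (by omega)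
    refine Tri.seq (cellCmd_spec (t := t + 1) (v := i) hb hx hD.le (by omega) (by omega) f1 f3 f4 f5 g7 f8
      (fun e he => by rw [gm _ (by omega), hmx e he]) gp) ?_
    intro τ' ⟨k10, k11⟩ hf' hm'
    have hm' := hm' (by decide)
    have q4 : τ'.v 4 = 1 := by rw [hf' 4 (by decide), f4]
    have q7 : τ'.v 7 = i := by rw [hf' 7 (by decide), g7]
    have q8 : τ'.v 8 = (t + 1) * (w + 1) := by rw [hf' 8 (by decide), f8]
    rw [← hD.succ (t + 1) (by omega) (by omega)] at k10
    refine Tri.ops ?_ ⟨?_, ?_, ?_, ?_, ?_⟩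
    · simp [q7, q8, q4]
      omega
    · simp [q7, q4]
    · intro t' ht' v' hv'
      simp [q7, q8, q4, hm', gp t' ht' v' hv']
      intro h
      have := cell_inj hv' (by omega) h
      omega
    · intro v' hv'
      simp [q7, q8, q4, k10, hm']
      split_ifs with h
      · rw [h]
      · exact gc v' (by omega)
    · intro a ha
      simp [q7, q8, q4, hm']
      rw [if_neg (by omega), gm a ha]
    · intro _
      simpa [weightedSum] using k11
  · intro τ ⟨_, g7, gp, gc, gm, g11⟩ hf _
    simp [h3] at g11 gc
    refine ⟨by rw [hf 5 (by decide)]; simp [h5, h4], fun t' ht' v' hv' => ?_, gm, g11⟩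
    rcases Nat.lt_succ_iff_lt_or_eq.1 ht' with h | rfl
    · exact gp t' h v' hv'
    · exact gc v' (by omega)

/-- Row 0 is `1, 0, …, 0`. The time is dominated by `n (w + 1)` entries of cost `O(n k)` each. -/
theorem countCmd_spec {n k w B W N : ℕ} {x : ℕ → ℕ} {D : ℕ → ℕ → ℕ} (hb : ParamBounds n k w B W N)
    (hn : 1 ≤ n) (hx : ∀ e < n, x e ≤ k) (hD : IsCountTable n k B x D)
    {σ : St} (h0 : σ.v 0 = n) (h1 : σ.v 1 = k) (h2 : σ.v 2 = w) (h4 : σ.v 4 = 1)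
    (hmx : ∀ e < n, σ.m (4 * e + 1) = x e) :
    Tri W N countCmd σ (n * ((w + 1) * (n * (30 * k + 60) + 80) + 26) + 40) fun τ =>
      (∀ a, a % 4 ≠ 2 → τ.m a = σ.m a) ∧ τ.v 11 = weightedSum k x D n w := by
  have b1 := hb.table
  have b2 := hb.array
  have b3 := hb.prod
  have b4 := hb.le
  have c1 := cell_lt (n := n) (w := w) (t := 0) (v := w) (Nat.zero_le _) le_rfl
  refine Tri.time (T₁ := 5 * 4 + ((w * (5 * 2 + 5) + 1) + (5 * 2 + (n * (((w + 1) * (n * (30 * k + 60) + 60) + 21)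
    + 5) + 1)))) (Tri.opsSeq ?_ (Tri.seq (R := fun τ => (∀ v ≤ w, τ.m (4 * v + 2) = D 0 v) ∧
      ∀ a, a % 4 ≠ 2 → τ.m a = σ.m a) (Tri.mono (Tri.loop (M := w) (by decide) (fun i τ =>
      τ.m 2 = 1 ∧ (∀ v ≤ w, w - i < v → τ.m (4 * v + 2) = 0) ∧ ∀ a, a % 4 ≠ 2 → τ.m a = σ.m a)
      ?_ ?_ ?_) ?_) ?_)) ?_
  · simp [h2, h4]; omega
  · simp [h2]
  · simp [h2, h4]
    exact ⟨fun v h1 h2 => by omega, fun a ha h => by omega⟩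
  · intro i hi τ ⟨g1, g2, g3⟩ g6 _ _
    simp [h2] at hi g6
    refine Tri.ops ?_ ⟨?_, ?_, ?_⟩
    · simp [g6]; omega
    · simp [g6, g1]; omega
    · intro v hv hv'
      simp [g6]
      intro hne
      exact g2 v hv (by omega)
    · intro a ha
      simp [g6]
      rw [if_neg (by omega), g3 a ha]
  · intro τ ⟨_, g1, g2, g3⟩ _ _
    simp [h2] at g2
    refine ⟨fun v hv => ?_, g3⟩
    rw [hD.zero]
    split_ifs with h
    · rw [h, mul_zero, zero_add, g1]
    · exact g2 v hv (by omega)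
  · intro τ ⟨g1, g2⟩ hf _
    have f0 : τ.v 0 = n := by rw [hf 0 (by decide)]; simp [h0]
    have f1 : τ.v 1 = k := by rw [hf 1 (by decide)]; simp [h1]
    have f3 : τ.v 3 = w + 1 := by rw [hf 3 (by decide)]; simp [h2, h4]
    have f4 : τ.v 4 = 1 := by rw [hf 4 (by decide)]; simp [h4]
    refine Tri.opsSeq ?_ (Tri.mono (Tri.loop (M := n) (by decide) (fun i τ => τ.v 5 = i ∧
      (∀ t' < i + 1, ∀ v' ≤ w, τ.m (4 * (t' * (w + 1) + v') + 2) = D t' v') ∧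
      (∀ a, a % 4 ≠ 2 → τ.m a = σ.m a) ∧ (0 < i → τ.v 11 = weightedSum k x D i w)) ?_ ?_ ?_) ?_)
    · simp [f0]; omega
    · simp [f0]
    · simpa using ⟨g1, g2⟩
    · intro i hi τ' ⟨k5, kD, km, _⟩ _ hf' _
      simp [f0] at hi
      have q1 : τ'.v 1 = k := by rw [hf' 1 (by decide)]; simp [f1]
      have q3 : τ'.v 3 = w + 1 := by rw [hf' 3 (by decide)]; simp [f3]
      have q4 : τ'.v 4 = 1 := by rw [hf' 4 (by decide)]; simp [f4]
      refine (rowCmd_spec hb hx hD hi q1 q3 q4 k5 (fun e he => by rw [km _ (by omega), hmx e he]) kD).mono ?_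
      intro ρ ⟨r1, r2, r3, r4⟩ _ _
      simp only [St.set_v, St.set_m]
      exact ⟨by simp [r1], r2, fun a ha => by rw [r3 a ha, km a ha], fun _ => by simp [r4]⟩
    · intro τ' ⟨_, _, _, km, k11⟩ _ _
      simp [f0] at k11
      exact ⟨km, k11 hn⟩
  · have hw : w ≤ w * n := Nat.le_mul_of_pos_right w hn
    ring_nf
    omega

/-! ### Programs for the input, the factorization and the thresholds. -/

/-- Unpack the input: recover `k` and `w` and store the string twice. -/
def initCmd : Cmd :=
  .ops [.const 4 1, .const 5 29, .sub 1 1 5, .const 6 32, .mul 7 6 0, .sub 8 1 6, .sub 1 1 7, .load 2 8,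
    .add 7 8 4, .sub 8 0 5, .const 6 0, .add 9 0 6] ;;
  .loop 8 (.ops [.sub 9 9 4, .sub 10 9 5, .load 10 10, .put 0 9 10]) ;;
  .loop 9 (.ops [.sub 10 9 4, .add 11 7 10, .load 11 11, .put 0 10 11]) ;;
  .ops [.const 6 0, .add 9 0 6] ;;
  .loop 9 (.ops [.sub 10 9 4, .get 11 0 10, .add 12 10 0, .put 0 12 11])

/-- The parameters and two copies of the string are in place. -/
structure Ready (n k w : ℕ) (f : ℕ → ℕ) (σ : St) : Prop where
  v0 : σ.v 0 = n
  v1 : σ.v 1 = k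
  v2 : σ.v 2 = w
  v4 : σ.v 4 = 1
  mem : ∀ e < 2 * n, σ.m (4 * e) = f e

theorem Ready.of_frame {n k w : ℕ} {f : ℕ → ℕ} {σ τ : St} {l : List ℕ} (h : Ready n k w f σ)
    (hf : Frame l σ τ) (hl : 0 ∉ l ∧ 1 ∉ l ∧ 2 ∉ l ∧ 4 ∉ l)
    (hm : ∀ e < 2 * n, τ.m (4 * e) = σ.m (4 * e)) : Ready n k w f τ :=
  ⟨by rw [hf 0 hl.1, h.v0], by rw [hf 1 hl.2.1, h.v1], by rw [hf 2 hl.2.2.1, h.v2],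
    by rw [hf 4 hl.2.2.2, h.v4], fun e he => by rw [hm e he, h.mem e he]⟩

/-- The symbols from index 29 on still lie at cells `e - 29`, while `w` and the first 29 symbols
were saved beyond cell `4n`. Working downwards, writing cell `4e` never destroys a symbol that is
still to be read. The second copy makes every rotation a contiguous window. -/
theorem initCmd_spec {n k w B W N : ℕ} {f : ℕ → ℕ} (hb : ParamBounds n k w B W N) (hn : 2 ≤ n)
    (hf : ∀ e, f (n + e) = f e) {σ : St} (h0 : σ.v 0 = n) (h1 : σ.v 1 = k + 32 * n + 29)
    (hw : σ.m (k + 32 * n - 32) = w) (hs : ∀ e, 29 ≤ e → e < n → σ.m (e - 29) = f e)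
    (hs' : ∀ e < 29, e < n → σ.m (k + 32 * n - 31 + e) = f e) :
    Tri W N initCmd σ (75 * n + 80) (Ready n k w f) := by
  have b2 := hb.array
  have b4 := hb.le
  refine Tri.time (T₁ := 5 * 12 + ((n * (5 * 4 + 5) + 1) + ((n * (5 * 4 + 5) + 1) +
    (5 * 2 + (n * (5 * 4 + 5) + 1))))) (Tri.opsSeq ?_ (Tri.seq (R := fun τ => τ.v 9 = n - (n - 29) ∧
      (∀ e < n, n - (n - 29) ≤ e → τ.m (4 * e) = f e) ∧ ∀ a, 4 * n ≤ a → τ.m a = σ.m a)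
    (Tri.mono (Tri.loop (M := n) (by decide) (fun i τ => τ.v 9 = n - i ∧
      (∀ e < n, n - i ≤ e → τ.m (4 * e) = f e) ∧ (∀ e, 29 ≤ e → e < n - i → τ.m (e - 29) = f e) ∧
      ∀ a, 4 * n ≤ a → τ.m a = σ.m a) ?_ ?_ ?_) ?_) ?_)) (by omega)
  · simp [h0, h1]; omega
  · simp [h0]
  · simp [h0]
    exact ⟨fun e h1 h2 => by omega, hs⟩
  · intro i hi τ ⟨g9, gf, gs, gm⟩ _ hf' _
    simp [h0] at hi
    have f4 : τ.v 4 = 1 := by rw [hf' 4 (by decide)]; simp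
    have f5 : τ.v 5 = 29 := by rw [hf' 5 (by decide)]; simp
    refine Tri.ops ?_ ⟨?_, ?_, ?_, ?_⟩
    · simp [g9, f4, f5]; omega
    · simp [g9, f4]; omega
    · intro e he hie
      simp [g9, f4, f5]
      split_ifs with h
      · rw [gs _ (by omega) (by omega), h]
      · exact gf e he (by omega)
    · intro e he hie
      simp [g9, f4, f5]
      rw [if_neg (by omega), gs e he (by omega)]
    · intro a ha
      simp [g9, f4, f5]
      rw [if_neg (by omega), gm a ha]
  · intro τ ⟨_, g9, gf, gs, gm⟩ _ _
    simp [h0] at g9 gf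
    exact ⟨g9, fun e he hle => gf e he (by omega), gm⟩
  · intro τ ⟨g9, gf, gm⟩ hfr _
    have f0 : τ.v 0 = n := by rw [hfr 0 (by decide)]; simp [h0]
    have f1 : τ.v 1 = k := by rw [hfr 1 (by decide)]; simp [h0, h1]
    have f2 : τ.v 2 = w := by rw [hfr 2 (by decide)]; simp [h1, hw]
    have f4 : τ.v 4 = 1 := by rw [hfr 4 (by decide)]; simp
    have f7 : τ.v 7 = k + 32 * n - 31 := by rw [hfr 7 (by decide)]; simp [h1]; omega
    refine Tri.seq (R := fun τ => ∀ e < n, τ.m (4 * e) = f e) (Tri.mono (Tri.loop (M := n) (by decide)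
      (fun i τ' => (∀ e < n, n - (n - 29) - i ≤ e → τ'.m (4 * e) = f e) ∧
        ∀ a, 4 * n ≤ a → τ'.m a = σ.m a) ?_ ?_ ?_) ?_) ?_
    · omega
    · exact ⟨gf, gm⟩
    · intro i hi τ' ⟨kf, km⟩ k9 hf' _
      rw [g9] at hi k9
      have q4 : τ'.v 4 = 1 := by rw [hf' 4 (by decide), f4]
      have q7 : τ'.v 7 = k + 32 * n - 31 := by rw [hf' 7 (by decide), f7]
      refine Tri.ops ?_ ⟨?_, ?_⟩
      · simp [k9, q4, q7]; omega
      · intro e he hie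
        simp [k9, q4, q7]
        split_ifs with h
        · rw [← h, km _ (by omega), hs' e (by omega) he]
        · exact kf e he (by omega)
      · intro a ha
        simp [k9, q4, q7]
        rw [if_neg (by omega), km a ha]
    · intro τ' ⟨_, kf, _⟩ _ _ e he
      exact kf e he (by omega)
    · intro τ' kf hf' _
      have q0 : τ'.v 0 = n := by rw [hf' 0 (by decide), f0]
      have q1 : τ'.v 1 = k := by rw [hf' 1 (by decide), f1]
      have q2 : τ'.v 2 = w := by rw [hf' 2 (by decide), f2]
      have q4 : τ'.v 4 = 1 := by rw [hf' 4 (by decide), f4]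
      refine Tri.opsSeq ?_ (Tri.mono (Tri.loop (M := n) (by decide) (fun i ρ => (∀ e < n, ρ.m (4 * e) = f e) ∧
        (∀ e < n, n - i ≤ e → ρ.m (4 * (n + e)) = f e)) ?_ ?_ ?_) ?_)
      · simp [q0]; omega
      · simp [q0]
      · simp
        exact ⟨kf, fun e _ _ => by omega⟩
      · intro i hi ρ ⟨r1, r2⟩ r9 hfρ _
        simp [q0] at hi r9
        have p0 : ρ.v 0 = n := by rw [hfρ 0 (by decide)]; simp [q0]
        have p4 : ρ.v 4 = 1 := by rw [hfρ 4 (by decide)]; simp [q4]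
        refine Tri.ops ?_ ⟨?_, ?_⟩
        · simp [p0, p4, r9]; omega
        · intro e he
          simp [p0, p4, r9]
          rw [if_neg (by omega), r1 e he]
        · intro e he hie
          simp [p0, p4, r9]
          split_ifs with h
          · rw [r1 _ (by omega), show n - i - 1 = e by omega]
          · exact r2 e he (by omega)
      · intro ρ ⟨_, r1, r2⟩ hfρ _
        simp [q0] at r2
        refine ⟨?_, ?_, ?_, ?_, fun e he => ?_⟩
        · rw [hfρ 0 (by decide)]; simp [q0]
        · rw [hfρ 1 (by decide)]; simp [q1]
        · rw [hfρ 2 (by decide)]; simp [q2]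
        · rw [hfρ 4 (by decide)]; simp [q4]
        · by_cases h : e < n
          · exact r1 e h
          · have := r2 (e - n) (by omega)
            rwa [show n + (e - n) = e by omega, ← hf, show n + (e - n) = e by omega] at this

/-- Find the first smallest rotation. -/
def rotCmd : Cmd :=
  .ops [.const 15 0, .add 5 1 4, .const 6 1, .add 7 0 15] ;;
  .loop 7 (.ops [.mul 6 6 5]) ;;
  .ops [.const 23 0, .const 9 0, .add 10 0 15] ;;
  .loop 10 (
    .ops [.const 11 0, .add 12 9 15, .add 13 0 15] ;;
    .loop 13 (.ops [.mul 11 11 5, .get 14 0 12, .add 11 11 14, .add 12 12 4]) ;;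
    .ops [.sub 14 6 11] ;;
    .ite 14 (.ops []) (.ops [.add 6 11 15, .add 23 9 15]) ;;
    .ops [.add 9 9 4])

/-- The running minimum starts at `(k + 1)^n`, which exceeds the value of every rotation, so the
first rotation is always recorded. Later ones replace it only if strictly smaller, which selects the
first minimal rotation. -/
theorem rotCmd_spec {n k w B W N : ℕ} {f : ℕ → ℕ} (hb : ParamBounds n k w B W N) (hn : 2 ≤ n)
    (hf : ∀ e, f e < k + 1) {σ : St} (h : Ready n k w f σ) :
    Tri W N rotCmd σ (n * (25 * n + 60) + 60) fun τ => Ready n k w f τ ∧ ∃ b < n, τ.v 23 = b ∧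
      (∀ i < n, horner (k + 1) (fun e => f (b + e)) n ≤ horner (k + 1) (fun e => f (i + e)) n) ∧
      ∀ i < b, horner (k + 1) (fun e => f (b + e)) n < horner (k + 1) (fun e => f (i + e)) n := by
  have b2 := hb.array
  have b4 := hb.le
  have b5 := hb.pow
  have hpow : ∀ m ≤ n, (k + 1) ^ m ≤ W := fun m hm => (Nat.pow_le_pow_right (by omega) hm).trans b5
  have hpos : ∀ m, 1 ≤ (k + 1) ^ m := fun m => Nat.one_le_pow _ _ (by omega)
  have hlt : ∀ i, ∀ m, horner (k + 1) (fun e => f (i + e)) m < (k + 1) ^ m :=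
    fun i m => horner_lt_pow fun e => hf _
  refine Tri.time (T₁ := 5 * 4 + ((n * (5 * 1 + 5) + 1) + (5 * 3 + (n * ((5 * 3 + ((n * (5 * 4 + 5) + 1) +
    (5 * 1 + ((5 * 2 + 3) + 5 * 1)))) + 5) + 1))))
    (Tri.mono (Q := fun τ => ∃ b < n, τ.v 23 = b ∧
      (∀ i < n, horner (k + 1) (fun e => f (b + e)) n ≤ horner (k + 1) (fun e => f (i + e)) n) ∧
      ∀ i < b, horner (k + 1) (fun e => f (b + e)) n < horner (k + 1) (fun e => f (i + e)) n)
    (Tri.opsSeq ?_ (Tri.seq (R := fun τ => τ.v 6 = (k + 1) ^ n) (Tri.mono (Tri.loop (M := n) (by decide)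
      (fun i τ => τ.v 6 = (k + 1) ^ i) ?_ ?_ ?_) ?_) ?_)) ?_) (by ring_nf; omega)
  · simp [h.v0, h.v1, h.v4]; omega
  · simp [h.v0]
  · simp
  · intro i hi τ g6 _ hfr _
    simp [h.v0] at hi
    have f5 : τ.v 5 = k + 1 := by rw [hfr 5 (by decide)]; simp [h.v1, h.v4]
    refine Tri.ops ?_ ?_
    · simp [g6, f5, ← pow_succ]; exact hpow _ hi
    · simp [g6, f5, ← pow_succ]
  · intro τ ⟨_, g6⟩ _ _
    simpa [h.v0] using g6
  · intro τ g6 hfr hm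
    have hm := hm (by decide)
    have f0 : τ.v 0 = n := by rw [hfr 0 (by decide)]; simp [h.v0]
    have f4 : τ.v 4 = 1 := by rw [hfr 4 (by decide)]; simp [h.v4]
    have f5 : τ.v 5 = k + 1 := by rw [hfr 5 (by decide)]; simp [h.v1, h.v4]
    have f15 : τ.v 15 = 0 := by rw [hfr 15 (by decide)]; simp
    have hmem : ∀ e < 2 * n, τ.m (4 * e) = f e := fun e he => by rw [hm]; simpa using h.mem e he
    refine Tri.opsSeq ?_ (Tri.mono (Tri.loop (M := n) (T := 5 * 3 + ((n * (5 * 4 + 5) + 1) +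
      (5 * 1 + ((5 * 2 + 3) + 5 * 1)))) (by decide) (fun i τ' => τ'.v 9 = i ∧
      (∀ j < i, τ'.v 6 ≤ horner (k + 1) (fun e => f (j + e)) n) ∧
      (∀ j < τ'.v 23, τ'.v 6 < horner (k + 1) (fun e => f (j + e)) n) ∧
      (i = 0 ∧ τ'.v 6 = (k + 1) ^ n ∨ τ'.v 6 = horner (k + 1) (fun e => f (τ'.v 23 + e)) n ∧ τ'.v 23 < i))
      ?_ ?_ ?_) ?_)
    · simp [f0, f15]; omega
    · simp [f0, f15]
    · simp [g6]
    · intro i hi τ' ⟨k9, k6, k23, kk⟩ _ hfr' hm'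
      have hm' := hm' (by decide)
      simp [f0, f15] at hi hm'
      have q0 : τ'.v 0 = n := by rw [hfr' 0 (by decide)]; simp [f0]
      have q4 : τ'.v 4 = 1 := by rw [hfr' 4 (by decide)]; simp [f4]
      have q5 : τ'.v 5 = k + 1 := by rw [hfr' 5 (by decide)]; simp [f5]
      have q15 : τ'.v 15 = 0 := by rw [hfr' 15 (by decide)]; simp [f15]
      refine Tri.opsSeq ?_ (Tri.seq (R := fun ρ => ρ.v 11 = horner (k + 1) (fun e => f (i + e)) n)
        (Tri.mono (Tri.loop (M := n) (by decide) (fun m ρ => ρ.v 12 = i + m ∧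
          ρ.v 11 = horner (k + 1) (fun e => f (i + e)) m) ?_ ?_ ?_) ?_) ?_)
      · simp [k9, q15, q0]; omega
      · simp [q15, q0]
      · simp [q15, k9, horner]
      · intro m hmn ρ ⟨r12, r11⟩ _ hfρ hmρ
        have hmρ := hmρ (by decide)
        simp [q15, q0] at hmn hmρ
        have p4 : ρ.v 4 = 1 := by rw [hfρ 4 (by decide)]; simp [q4]
        have p5 : ρ.v 5 = k + 1 := by rw [hfρ 5 (by decide)]; simp [q5]
        have e1 : ρ.m (4 * (i + m)) = f (i + m) := by rw [hmρ, hm', hmem _ (by omega)]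
        have e2 := hlt i (m + 1)
        have e3 := hpow (m + 1) hmn
        rw [horner] at e2
        refine Tri.ops ?_ ?_
        · simp [r12, r11, p4, p5, e1]
          omega
        · simp [r12, r11, p4, p5, e1, horner]
          omega
      · intro ρ ⟨_, _, r11⟩ _ _
        simpa [q15, q0] using r11
      · intro ρ r11 hfρ _
        have p4 : ρ.v 4 = 1 := by rw [hfρ 4 (by decide)]; simp [q4]
        have p6 : ρ.v 6 = τ'.v 6 := by rw [hfρ 6 (by decide)]; simp
        have p23 : ρ.v 23 = τ'.v 23 := by rw [hfρ 23 (by decide)]; simp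
        have p9 : ρ.v 9 = i := by rw [hfρ 9 (by decide)]; simp [k9]
        have p15 : ρ.v 15 = 0 := by rw [hfρ 15 (by decide)]; simp [q15]
        have e2 := hlt i n
        refine Tri.opsSeq ?_ (Tri.seq (T₁ := 5 * 2 + 3) (R := fun ρ' => ρ'.v 9 = i ∧ ρ'.v 4 = 1 ∧
          (∀ j < i + 1, ρ'.v 6 ≤ horner (k + 1) (fun e => f (j + e)) n) ∧
          (∀ j < ρ'.v 23, ρ'.v 6 < horner (k + 1) (fun e => f (j + e)) n) ∧
          (ρ'.v 6 = horner (k + 1) (fun e => f (ρ'.v 23 + e)) n ∧ ρ'.v 23 < i + 1)) (Tri.ite ?_ ?_) ?_)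
        · simp
        · intro hz
          simp [p6, r11] at hz
          refine Tri.time (Tri.ops ?_ ⟨?_, ?_, ?_, ?_, ?_⟩) (by simp)
          · simp
          · simp [p9]
          · simp [p4]
          · intro j hj
            simp [p6]
            rcases Nat.lt_succ_iff_lt_or_eq.1 hj with hj | rfl
            · exact k6 j hj
            · omega
          · simpa [p6, p23] using k23
          · simp [p6, p23]
            rcases kk with ⟨rfl, kk⟩ | ⟨kk, kk'⟩
            · omega
            · exact ⟨kk, by omega⟩
        · intro hz
          simp [p6, r11] at hz
          have hz : horner (k + 1) (fun e => f (i + e)) n < τ'.v 6 := by omega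
          refine Tri.ops ?_ ⟨?_, ?_, ?_, ?_, ?_⟩
          · simp [p15, r11, p9]; have := hpow n le_rfl; omega
          · simp [p9]
          · simp [p4]
          · intro j hj
            simp [p15, r11]
            rcases Nat.lt_succ_iff_lt_or_eq.1 hj with hj | rfl
            · exact hz.le.trans (k6 j hj)
            · exact le_rfl
          · intro j hj
            simp [p15, r11, p9] at hj ⊢
            exact hz.trans_le (k6 j hj)
          · simp [p15, r11, p9]
        · intro ρ' ⟨u9, u4, u6, u23, uu⟩ _ _
          refine Tri.ops ?_ ⟨?_, ?_, ?_, ?_⟩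
          · simp [u9, u4]; omega
          · simp [u9, u4]
          · simpa using u6
          · simpa using u23
          · simpa using uu
    · intro τ' ⟨_, _, k6, k23, kk⟩ _ _
      simp [f0, f15] at k6 kk
      rcases kk with ⟨h0, _⟩ | ⟨h6, hn'⟩
      · omega
      · rw [h6] at k6 k23
        exact ⟨_, hn', rfl, k6, k23⟩
  · intro τ hb hfr hm
    exact ⟨h.of_frame hfr (by decide) fun e _ => by rw [hm (by decide)], hb⟩

/-- Write `0 k ⋯ k`. -/
def zeroCmd : Cmd :=
  .ops [.const 15 0, .add 9 0 15] ;; .loop 9 (.ops [.sub 10 9 4, .put 1 10 1]) ;;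
  .ops [.const 10 0, .put 1 10 10]

theorem zeroCmd_spec {n k w B W N : ℕ} {f : ℕ → ℕ} (hb : ParamBounds n k w B W N) (hn : 1 ≤ n)
    {σ : St} (h : Ready n k w f σ) :
    Tri W N zeroCmd σ (15 * n + 21) fun τ => Ready n k w f τ ∧
      ∀ e < n, τ.m (4 * e + 1) = if e = 0 then 0 else k := by
  have b2 := hb.array
  have b4 := hb.le
  refine Tri.mono (Q := fun τ => (∀ a, a % 4 ≠ 1 → τ.m a = σ.m a) ∧
      ∀ e < n, τ.m (4 * e + 1) = if e = 0 then 0 else k) (Tri.time (T₁ := 5 * 2 + ((n * (5 * 2 + 5) + 1) + 5 * 2))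
    (Tri.opsSeq ?_ (Tri.seq (Tri.loop (M := n) (by decide) (fun i τ => (∀ a, a % 4 ≠ 1 → τ.m a = σ.m a) ∧
      ∀ e < n, n - i ≤ e → τ.m (4 * e + 1) = k) ?_ ?_ ?_) ?_)) (by omega)) ?_
  · simp [h.v0]; omega
  · simp [h.v0]
  · simp
    exact fun e h1 h2 => by omega
  · intro i hi τ ⟨gm, gk⟩ g9 hfr _
    simp [h.v0] at hi g9
    have f1 : τ.v 1 = k := by rw [hfr 1 (by decide)]; simp [h.v1]
    have f4 : τ.v 4 = 1 := by rw [hfr 4 (by decide)]; simp [h.v4]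
    refine Tri.ops ?_ ⟨?_, ?_⟩
    · simp [g9, f4]; omega
    · intro a ha
      simp [g9, f4]
      rw [if_neg (by omega), gm a ha]
    · intro e he hie
      simp [g9, f4, f1]
      intro hne
      exact gk e he (by omega)
  · intro τ ⟨_, gm, gk⟩ _ _
    simp [h.v0] at gk
    refine Tri.ops ?_ ⟨?_, ?_⟩
    · simp; omega
    · intro a ha
      simp
      rw [if_neg (by rintro rfl; simp at ha), gm a ha]
    · intro e he
      simp [gk e he]
  · intro τ ⟨hm, hx⟩ hfr _
    exact ⟨h.of_frame hfr (by decide) fun e _ => hm _ (by omega), hx⟩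

/-- Replace the string in the second array by the largest smaller threshold. -/
def lowerCmd : Cmd :=
  .ops [.const 6 1, .const 7 1, .sub 9 0 23, .sub 9 9 4] ;;
  .loop 9 (
    .ops [.sub 10 7 6, .get 11 1 10, .get 12 1 7, .sub 10 11 12, .sub 13 12 11, .add 10 10 13] ;;
    .ite 10 (.ops []) (.ops [.add 6 7 4]) ;;
    .ops [.add 7 7 4]) ;;
  .ops [.sub 9 0 6, .sub 6 6 4, .get 10 1 6, .sub 10 10 4, .put 1 6 10] ;;
  .loop 9 (.ops [.add 10 6 9, .put 1 10 1])

/-- The first loop is Duval's algorithm, with the period in variable 6. Equality of two symbols is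
tested by adding the two truncated differences. The second loop writes `k` from position `p` on. -/
theorem lowerCmd_spec {n k w b B W N : ℕ} {f a : ℕ → ℕ} (hb : ParamBounds n k w B W N) (hbn : b < n)
    (hak : ∀ e, a e ≤ k) (ha : PreNeck (n - b) a) {σ : St} (h : Ready n k w f σ) (h23 : σ.v 23 = b)
    (hm : ∀ e < n, σ.m (4 * e + 1) = a e) :
    Tri W N lowerCmd σ (90 * n + 60) fun τ => Ready n k w f τ ∧
      ∃ p, IsLyndonPeriod a (n - b) p ∧ ∀ e < n, τ.m (4 * e + 1) = lowered k p a e := by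
  have b2 := hb.array
  have b4 := hb.le
  refine Tri.mono (Q := fun τ => (∀ a, a % 4 ≠ 1 → τ.m a = σ.m a) ∧
      ∃ p, IsLyndonPeriod a (n - b) p ∧ ∀ e < n, τ.m (4 * e + 1) = lowered k p a e)
    (Tri.time (T₁ := 5 * 4 + ((n * ((5 * 6 + ((5 + 3) + 5 * 1)) + 5) + 1) + (5 * 5 + (n * (5 * 2 + 5) + 1))))
    (Tri.opsSeq ?_ (Tri.seq (R := fun τ => IsLyndonPeriod a (n - b) (τ.v 6) ∧ τ.m = σ.m) (Tri.mono (Tri.loop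
      (M := n) (T := 5 * 6 + ((5 + 3) + 5 * 1)) (by decide) (fun i τ =>
      τ.v 7 = i + 1 ∧ IsLyndonPeriod a (i + 1) (τ.v 6)) ?_ ?_ ?_) ?_) ?_)) (by omega)) ?_
  · simp; omega
  · simp [h.v0, h23, h.v4]; omega
  · simp [isLyndonPeriod_one]
  · intro i hi τ ⟨g7, g6⟩ _ hfr hpm
    have hpm := hpm (by decide)
    simp [h.v0, h23, h.v4] at hi hpm
    have f4 : τ.v 4 = 1 := by rw [hfr 4 (by decide)]; simp [h.v4]
    have hpos := g6.pos
    have hle := g6.le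
    have e1 : τ.m (4 * (i + 1 - τ.v 6) + 1) = a (i + 1 - τ.v 6) := by rw [hpm, hm _ (by omega)]
    have e2 : τ.m (4 * (i + 1) + 1) = a (i + 1) := by rw [hpm, hm _ (by omega)]
    have k1 := hak (i + 1)
    have k2 := hak (i + 1 - τ.v 6)
    have hs := g6.succ (ha.mono (by omega))
    refine Tri.opsSeq ?_ (Tri.seq (R := fun ρ => ρ.v 7 = i + 1 ∧ ρ.v 4 = 1 ∧ IsLyndonPeriod a (i + 1 + 1) (ρ.v 6))
      (Tri.ite (T := 5) ?_ ?_) ?_)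
    · simp [g7, e1, e2]; omega
    · intro hz
      simp [g7, e1, e2] at hz
      rw [if_pos (by omega)] at hs
      refine Tri.time (Tri.ops ?_ ⟨?_, ?_, ?_⟩) (by simp)
      · simp
      · simp [g7]
      · simp [f4]
      · simpa using hs
    · intro hz
      simp [g7, e1, e2] at hz
      rw [if_neg (by omega)] at hs
      refine Tri.time (Tri.ops ?_ ⟨?_, ?_, ?_⟩) (by simp)
      · simp [g7, f4]; omega
      · simp [g7]
      · simp [f4]
      · simpa [g7, f4] using hs
    · intro ρ ⟨r7, r4, r6⟩ _ _
      refine Tri.ops ?_ ⟨?_, ?_⟩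
      · simp [r7, r4]; omega
      · simp [r7, r4]
      · simpa using r6
  · intro τ ⟨_, _, g6⟩ hfr hpm
    simp [h.v0, h23, h.v4] at g6
    refine ⟨?_, by rw [hpm (by decide)]; simp⟩
    rwa [show n - b - 1 + 1 = n - b by omega] at g6
  · intro τ ⟨g6, gm⟩ hfr _
    have hpos := g6.pos
    have hle := g6.le
    set p := τ.v 6 with hp
    have f0 : τ.v 0 = n := by rw [hfr 0 (by decide)]; simp [h.v0]
    have f1 : τ.v 1 = k := by rw [hfr 1 (by decide)]; simp [h.v1]
    have f4 : τ.v 4 = 1 := by rw [hfr 4 (by decide)]; simp [h.v4]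
    have e1 : τ.m (4 * (p - 1) + 1) = a (p - 1) := by rw [gm, hm _ (by omega)]
    refine Tri.opsSeq ?_ (Tri.mono (Tri.loop (M := n) (by decide) (fun i ρ => (∀ a, a % 4 ≠ 1 → ρ.m a = σ.m a) ∧
      (∀ e < p, ρ.m (4 * e + 1) = lowered k p a e) ∧ (∀ e < n, n - i ≤ e → ρ.m (4 * e + 1) = k)) ?_ ?_ ?_) ?_)
    · simp [f0, f4, ← hp]; omega
    · simp [f0]
    · refine ⟨fun a ha => ?_, fun e he => ?_, fun e h1 h2 => by omega⟩
      · simp [f4, ← hp]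
        rw [if_neg (by omega), gm]
      · simp [f4, ← hp, e1, lowered]
        split_ifs with h1 h2 h3 h4
        · omega
        · rw [h1]
        · omega
        · rw [gm, hm e (by omega)]
        · omega
        · omega
    · intro i hi ρ ⟨rm, rl, rk⟩ r9 hfρ _
      simp [f0, ← hp] at hi r9
      have p1 : ρ.v 1 = k := by rw [hfρ 1 (by decide)]; simp [f1]
      have p6 : ρ.v 6 = p - 1 := by rw [hfρ 6 (by decide)]; simp [← hp, f4]
      refine Tri.ops ?_ ⟨?_, ?_, ?_⟩
      · simp [r9, p6]; omega
      · intro a ha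
        simp [r9, p6]
        rw [if_neg (by omega), rm a ha]
      · intro e he
        simp [r9, p6]
        rw [if_neg (by omega), rl e he]
      · intro e he hie
        simp [r9, p6, p1]
        intro hne
        exact rk e he (by omega)
    · intro ρ ⟨_, rm, rl, rk⟩ _ _
      simp [f0, ← hp] at rk
      refine ⟨rm, p, g6, fun e he => ?_⟩
      by_cases hep : e < p
      · exact rl e hep
      · rw [rk e he (by omega), lowered, if_neg (by omega), if_neg (by omega)]
  · intro τ ⟨hm', hx⟩ hfr _
    exact ⟨h.of_frame hfr (by decide) fun e _ => hm' _ (by omega), hx⟩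

/-- Write the threshold of the string. -/
def thresholdCmd : Cmd :=
  .ops [.const 15 0, .add 9 0 15] ;; .loop 9 (.ops [.sub 10 9 4, .add 11 23 10, .get 11 0 11, .put 1 10 11]) ;;
  .ops [.const 5 0, .add 9 23 5] ;; .loop 9 (.ops [.sub 10 9 4, .get 11 0 10, .sub 12 1 11, .add 5 5 12]) ;;
  .ite 5 lowerCmd (.ops [])

/-- Variable 5 sums `k - s_e` over the part `p`; it is zero exactly when `p` is a power of `k`, and
then the threshold must be lowered. -/
theorem thresholdCmd_spec {n k w B W N : ℕ} {s : List ℕ} (hb : ParamBounds n k w B W N) (hs : s.length = n)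
    (hbn : splitIndex s < n) (hsk : ∀ e, ext s e ≤ k) (ha : PreNeck (n - splitIndex s) fun e =>
      ext s (splitIndex s + e)) {σ : St} (h : Ready n k w (ext s) σ) (h23 : σ.v 23 = splitIndex s) :
    Tri W N thresholdCmd σ (150 * n + 100) fun τ => Ready n k w (ext s) τ ∧
      ∃ x, IsThreshold k s x ∧ ∀ e < n, τ.m (4 * e + 1) = x e := by
  have b2 := hb.array
  have b3 := hb.prod
  have b4 := hb.le
  set b := splitIndex s with hbdef
  refine Tri.time (T₁ := 5 * 2 + ((n * (5 * 4 + 5) + 1) + (5 * 2 + ((n * (5 * 4 + 5) + 1) + (90 * n + 60 + 3)))))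
    (Tri.opsSeq ?_ (Tri.seq (Tri.loop (M := n) (by decide) (fun i τ => (∀ a, a % 4 ≠ 1 → τ.m a = σ.m a) ∧
      ∀ e < n, n - i ≤ e → τ.m (4 * e + 1) = ext s (b + e)) ?_ ?_ ?_) ?_)) (by omega)
  · simp [h.v0]; omega
  · simp [h.v0]
  · simp
    exact fun e h1 h2 => by omega
  · intro i hi τ ⟨gm, gk⟩ g9 hfr _
    simp [h.v0] at hi g9
    have f4 : τ.v 4 = 1 := by rw [hfr 4 (by decide)]; simp [h.v4]
    have f23 : τ.v 23 = b := by rw [hfr 23 (by decide)]; simp [h23]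
    have e1 : τ.m (4 * (b + (n - i - 1))) = ext s (b + (n - i - 1)) := by
      rw [gm _ (by omega), h.mem _ (by omega)]
    refine Tri.ops ?_ ⟨?_, ?_⟩
    · simp [g9, f4, f23]; omega
    · intro a ha
      simp [g9, f4]
      rw [if_neg (by omega), gm a ha]
    · intro e he hie
      simp [g9, f4, f23, e1]
      split_ifs with hne
      · rw [hne]
      · exact gk e he (by omega)
  · intro τ ⟨_, gm, gk⟩ hfr _
    simp [h.v0] at gk
    have hR : Ready n k w (ext s) τ := by
      refine ⟨?_, ?_, ?_, ?_, fun e he => by rw [gm _ (by omega), h.mem e he]⟩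
      · rw [hfr 0 (by decide)]; simp [h.v0]
      · rw [hfr 1 (by decide)]; simp [h.v1]
      · rw [hfr 2 (by decide)]; simp [h.v2]
      · rw [hfr 4 (by decide)]; simp [h.v4]
    have f23 : τ.v 23 = b := by rw [hfr 23 (by decide)]; simp [h23]
    refine Tri.opsSeq ?_ (Tri.seq (R := fun ρ => (ρ.v 5 = 0 ↔ ∀ e < b, ext s e = k)) (Tri.mono (Tri.loop (M := n)
      (by decide) (fun i ρ => ρ.v 5 ≤ i * k ∧ (ρ.v 5 = 0 ↔ ∀ e < b, b - i ≤ e → ext s e = k)) ?_ ?_ ?_) ?_) ?_)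
    · simp [f23]; omega
    · simp [f23]; omega
    · simp
      exact fun e h1 h2 => by omega
    · intro i hi ρ ⟨r5, r5'⟩ r9 hfρ hmρ
      have hmρ := hmρ (by decide)
      simp [f23] at hi r9 hmρ
      have p1 : ρ.v 1 = k := by rw [hfρ 1 (by decide)]; simp [hR.v1]
      have p4 : ρ.v 4 = 1 := by rw [hfρ 4 (by decide)]; simp [hR.v4]
      have e1 : ρ.m (4 * (b - i - 1)) = ext s (b - i - 1) := by rw [hmρ, hR.mem _ (by omega)]
      have e2 := hsk (b - i - 1)
      have e3 : (i + 1) * k ≤ n * k := Nat.mul_le_mul_right _ (by omega)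
      have e4 : (n + 1) * (k + 1) = n * k + n + k + 1 := by ring
      rw [add_mul, one_mul] at e3
      refine Tri.ops ?_ ⟨?_, ?_⟩
      · simp [r9, p4, p1, e1]; omega
      · simp [r9, p4, p1, e1, add_mul]; omega
      · simp [r9, p4, p1, e1, r5']
        constructor
        · intro ⟨h1, h2⟩ e he hie
          by_cases hee : e = b - i - 1
          · rw [hee]; omega
          · exact h1 e he (by omega)
        · intro h1
          exact ⟨fun e he hie => h1 e he (by omega), by rw [h1 (b - i - 1) (by omega) (by omega), Nat.sub_self]⟩
    · intro ρ ⟨_, _, r5⟩ _ _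
      simpa [f23] using r5
    · intro ρ r5 hfρ hmρ
      have hmρ := hmρ (by decide)
      simp at hmρ
      have hR' : Ready n k w (ext s) ρ := by
        refine ⟨?_, ?_, ?_, ?_, fun e he => by rw [hmρ, hR.mem e he]⟩
        · rw [hfρ 0 (by decide)]; simp [hR.v0]
        · rw [hfρ 1 (by decide)]; simp [hR.v1]
        · rw [hfρ 2 (by decide)]; simp [hR.v2]
        · rw [hfρ 4 (by decide)]; simp [hR.v4]
      have p23 : ρ.v 23 = b := by rw [hfρ 23 (by decide)]; simp [f23]
      refine Tri.ite ?_ ?_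
      · intro hz
        have hz := r5.1 hz
        refine (lowerCmd_spec hb hbn (fun e => hsk _) ha hR' p23 fun e he => by rw [hmρ, gk e he]).mono ?_
        intro κ ⟨hκ, p, hp, hx⟩ _ _
        refine ⟨hκ, _, ⟨fun ⟨e, he, hne⟩ => ?_, fun _ => ⟨p, ?_, fun e _ => rfl⟩⟩, hx⟩
        · rw [← ext_of_lt (by omega)] at hne
          exact absurd (hz e he) hne
        · rwa [hs]
      · intro hz
        rw [Ne, r5] at hz
        refine Tri.time (Tri.ops (by simp) ⟨hR', _, ⟨fun _ e _ => rfl, fun h => ?_⟩, fun e he => ?_⟩) (by simp)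
        · refine absurd (fun e he => ?_) hz
          rw [ext_of_lt (by omega)]
          exact h e he
        · simp only [runOps]
          rw [hmρ, gk e he]

/-! ### Assembling the ranking algorithm. -/

theorem card_strings_le (k t v : ℕ) : (strings k t v).card ≤ k ^ t := by
  unfold strings
  refine (Finset.card_filter_le _ _).trans (Finset.card_image_le.trans ?_)
  simp

theorem card_exceeding_le (k : ℕ) (x : ℕ → ℕ) (t v : ℕ) : (exceeding k x t v).card ≤ k ^ t :=
  (Finset.card_le_card fun _ hg => (mem_exceeding.1 hg).1).trans (card_strings_le k t v)

theorem isCountTable_card_exceeding {n k : ℕ} {x : ℕ → ℕ} (hk : 1 ≤ k) (hx : PreNeck n x)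
    (hxk : ∀ e < n, x e ≤ k) (hx0 : ∀ j < n, x j < k → ∀ e < j, 1 ≤ x e) :
    IsCountTable n k (k ^ n) x fun t v => (exceeding k x t v).card :=
  ⟨fun v => card_exceeding_zero k x v, fun _ ht htn _ => card_exceeding hx htn ht hxk hx0,
    fun t ht v => (card_exceeding_le k x t v).trans (Nat.pow_le_pow_right hk ht)⟩

/-- The rank from the numbers computed before. -/
def formulaCmd : Cmd :=
  .ops [.get 5 0 23, .sub 5 1 5] ;; .ite 5 (.ops [.sub 23 0 4]) (.ops []) ;;
  .ops [.sub 6 22 11, .sub 7 23 6] ;;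
  .ite 7 (.ops [.add 5 6 4, .sub 5 5 23]) (.ops [.add 5 22 6, .add 5 5 4, .sub 5 5 23])

theorem formulaCmd_spec {n k w b tot g B W N : ℕ} {f : ℕ → ℕ} (hb : ParamBounds n k w B W N) (hn : 1 ≤ n)
    (hbn : b < n) (hfk : f b ≤ k) (htot : 2 * tot + 1 ≤ W) {σ : St} (h : Ready n k w f σ) (h23 : σ.v 23 = b)
    (h22 : σ.v 22 = tot) (h11 : σ.v 11 = g) :
    Tri W N formulaCmd σ 60 fun τ => τ.v 5 = rankFormula tot g (if f b = k then n - 1 else b) := by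
  have b2 := hb.array
  have b4 := hb.le
  have e1 : σ.m (4 * b) = f b := h.mem b (by omega)
  refine Tri.time (T₁ := 5 * 2 + ((5 + 3) + (5 * 2 + (15 + 3)))) (Tri.opsSeq ?_ (Tri.seq (R := fun τ =>
    τ.v 4 = 1 ∧ τ.v 11 = g ∧ τ.v 22 = tot ∧ τ.v 23 = if f b = k then n - 1 else b) (Tri.ite ?_ ?_) ?_))
    (by omega)
  · simp [h23]; omega
  · intro hz
    simp [h23, e1, h.v1] at hz
    refine Tri.ops (by simp) ?_
    simp [h.v0, h.v4, h11, h22]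
    omega
  · intro hz
    simp [h23, e1, h.v1] at hz
    refine Tri.time (Tri.ops (by simp) ?_) (by simp)
    simp [h.v4, h11, h22, h23]
    omega
  · intro τ ⟨g4, g11, g22, g23⟩ _ _
    set b' := if f b = k then n - 1 else b
    refine Tri.opsSeq (by simp) (Tri.ite ?_ ?_)
    · intro hz
      simp [g11, g22, g23] at hz
      refine Tri.time (Tri.ops ?_ ?_) (by simp)
      · simp [g11, g22, g4]; omega
      · simp [g11, g22, g4, g23, rankFormula]
        omega
    · intro hz
      simp [g11, g22, g23] at hz
      refine Tri.time (Tri.ops ?_ ?_) (by simp)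
      · simp [g11, g22, g4]; omega
      · simp [g11, g22, g4, g23, rankFormula]
        omega

/-- The ranking algorithm. -/
def rankCmd : Cmd :=
  initCmd ;; rotCmd ;; zeroCmd ;; countCmd ;; .ops [.const 5 0, .add 22 11 5] ;; thresholdCmd ;; countCmd ;;
    formulaCmd

/-- The counting program runs twice: with the threshold `0 k ⋯ k`, which every necklace exceeds, it
yields the total number of strings, and with the threshold of `s` the number of strings that are not
read before the cut. -/
theorem rankCmd_spec {n k w W N : ℕ} {s : List ℕ} (hb : ParamBounds n k w (k ^ n) W N) (hn : 2 ≤ n) (hk : 2 ≤ k)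
    (hw : w < k * n) (hs : s ∈ strings k n w) {σ : St} (h0 : σ.v 0 = n) (h1 : σ.v 1 = k + 32 * n + 29)
    (hmw : σ.m (k + 32 * n - 32) = w) (hm : ∀ e, 29 ≤ e → e < n → σ.m (e - 29) = s.getD e 0)
    (hm' : ∀ e < 29, e < n → σ.m (k + 32 * n - 31 + e) = s.getD e 0) :
    Tri W N rankCmd σ
      (2 * (n * ((w + 1) * (n * (30 * k + 60) + 80))) + 25 * n ^ 2 + 400 * n + 500) fun τ =>
        HasRank (granddaddy k n w) s (τ.v 5) := by
  have hsl := (mem_strings.1 hs).1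
  have hsne : s ≠ [] := fun h => by rw [h] at hsl; simp at hsl; omega
  have hsk : ∀ e, ext s e ≤ k := fun e => ((mem_strings.1 hs).2.1 _ (ext_mem hsne e)).2
  have hbn : splitIndex s < n := by
    have h1 := splitIndex_lt hsne
    have h2 := (ap_prefix (neck s)).length_le
    rw [length_neck] at h2
    omega
  have hN : PreNeck (n - splitIndex s) fun e => ext s (splitIndex s + e) := (neck_ext_splitIndex s).preNeck _
  have hg : 2 * (strings k n w).card + 1 ≤ W := by
    have h1 := card_strings_le k n w
    have h2 : 1 ≤ k ^ n := Nat.one_le_pow _ _ (by omega)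
    have h3 : 2 * (2 * (2 * k ^ n)) ≤ n * (n * (k * k ^ n)) := by gcongr
    have := hb.sum
    omega
  obtain ⟨z, hz, hz1, hz2, hz3, hz4⟩ := threshold_zero (k := k) (w := w) (show 1 ≤ n by omega)
  have key : ∀ x, PreNeck n x → (∀ e < n, x e ≤ k) → (∀ j < n, x j < k → ∀ e < j, 1 ≤ x e) →
      ∀ τ, Ready n k w (ext s) τ → (∀ e < n, τ.m (4 * e + 1) = x e) →
      Tri W N countCmd τ (n * ((w + 1) * (n * (30 * k + 60) + 80) + 26) + 40) fun ρ => Ready n k w (ext s) ρ ∧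
        ρ.v 22 = τ.v 22 ∧ ρ.v 23 = τ.v 23 ∧
        ρ.v 11 = ((strings k n w).filter fun u => word n x < neck u).card := by
    intro x hx hxk hx0 τ hτ hmx
    refine (countCmd_spec hb (by omega) hxk (isCountTable_card_exceeding (by omega) hx hxk hx0) hτ.v0 hτ.v1 hτ.v2
      hτ.v4 hmx).mono fun ρ ⟨hρ, h11⟩ hf _ => ?_
    refine ⟨hτ.of_frame hf (by decide) fun e _ => hρ _ (by omega), hf 22 (by decide), hf 23 (by decide), ?_⟩
    rw [h11, weightedSum, card_cyclic_exceeding (by omega) hx hxk hx0]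
  have hbs : ∀ b < n, (∀ i < n, horner (k + 1) (fun e => ext s (b + e)) n ≤
      horner (k + 1) (fun e => ext s (i + e)) n) → (∀ i < b, horner (k + 1) (fun e => ext s (b + e)) n <
      horner (k + 1) (fun e => ext s (i + e)) n) → b = splitIndex s := by
    intro b hb h1 h2
    rw [← hsl] at hb h1 h2
    exact (splitIndex_eq_of_horner (fun e => Nat.lt_succ_of_le (hsk e)) hb h1 h2).symm
  refine Tri.time (Tri.seq (initCmd_spec hb hn (fun e => by rw [add_comm, ← hsl, ext_add_length]) h0 h1 hmw
    (fun e he hen => ?_) fun e he hen => ?_) fun σ₁ r₁ _ _ =>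
    Tri.seq (rotCmd_spec hb hn (fun e => Nat.lt_succ_of_le (hsk e)) r₁) fun σ₂ ⟨r₂, b, hbn', e₂, hle, hlt⟩ _ _ =>
    Tri.seq (zeroCmd_spec hb (by omega) r₂) fun σ₃ ⟨r₃, g₃⟩ f₃ _ =>
    Tri.seq (key z hz1 hz2 hz3 σ₃ r₃ fun e he => by rw [g₃ e he, hz]) fun σ₄ ⟨r₄, _, e₄, g₄⟩ _ _ =>
    Tri.opsSeq ?_ (Tri.seq (thresholdCmd_spec hb hsl hbn hsk hN ?_ ?_) fun σ₅ ⟨r₅, x, hx, g₅⟩ f₅ _ =>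
    Tri.seq (key x (hx.spec (by omega) hs).1 (hx.spec (by omega) hs).2.1 (hx.spec (by omega) hs).2.2.1 σ₅ r₅ g₅)
      fun σ₆ ⟨r₆, d₆, e₆, g₆⟩ _ _ =>
    Tri.mono (formulaCmd_spec (b := splitIndex s) (tot := (strings k n w).card) hb (by omega) hbn (hsk _) hg r₆ ?_ ?_ g₆)
      fun _ h _ _ => h ▸ hasRank_rankFormula (by omega) hk hw hs hx)) ?_
  · rw [hm e he hen, ext_of_lt (by omega)]
  · rw [hm' e he hen, ext_of_lt (by omega)]
  · have := hb.le
    have := hb.array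
    simp [g₄]
    omega
  · exact r₄.of_frame (frame_ops [.const 5 0, .add 22 11 5] σ₄) (by decide) fun e _ => by simp
  · simp [e₄, f₃ 23 (by decide), e₂]
    exact hbs _ hbn' hle hlt
  · simp [e₆, f₅ 23 (by decide), e₄, f₃ 23 (by decide), e₂]
    exact hbs _ hbn' hle hlt
  · simp [d₆, f₅ 22 (by decide), g₄, hz4]
  · simp only [List.length_cons, List.length_nil]
    ring_nf
    omega

/-! ### The complete machine program -/

/-- Move the registers from number 2 on out of the way. -/
def prologue : List Instr :=
  List.replicate 32 (.add 1 1 0) ++ ([.store 1 2, .const 2 1] ++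
    ((List.range 29).flatMap (fun j => [.add 1 1 2, .store 1 (j + 3)]) ++
      [.const 3 0, .add 2 0 3, .add 3 1 3]))

/-- The program that computes ranks. -/
def rankProgram : List Instr :=
  prologue ++ (rankCmd.code 95 ++ [.const 1 0, .add 0 7 1])

/-- Registers during the first part of the prologue. -/
def shifted (c n : ℕ) (inp : ℕ → ℕ) (i a : ℕ) : ℕ := if a = 1 then c + i * n else inp a

/-- Registers during the second part of the prologue. -/
def moved (F : ℕ) (inp : ℕ → ℕ) (j a : ℕ) : ℕ :=
  if a = 1 then F + j else if a = 2 then 1 else if F ≤ a ∧ a ≤ F + j then inp (a - F + 2) else inp a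

theorem steps_shift {P : List Instr} {S W k n : ℕ} {inp : ℕ → ℕ} (hS : 2 ≤ S) (h0 : inp 0 = n)
    (hW : ∀ a, inp a ≤ W) (h1 : inp 1 = k) {p : ℕ} : ∀ i, k + i * n ≤ W →
    CodeAt P p (List.replicate i (.add 1 1 0)) →
    Steps P S W ⟨p, inp⟩ i ⟨p + i, shifted k n inp i⟩
  | 0, _, _ => by
    have : shifted k n inp 0 = inp := by
      funext a
      rw [shifted, zero_mul, add_zero]
      split_ifs with h
      · rw [h, h1]
      · rfl
    rw [this]
    exact .refl _
  | i + 1, hi, hP => by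
    rw [add_mul, one_mul] at hi
    rw [List.replicate_succ'] at hP
    obtain ⟨hP1, hP2⟩ := hP.append
    rw [List.length_replicate] at hP2
    refine (steps_shift hS h0 hW h1 i (by omega) hP1).trans (.next hP2.cons.1 ?_ ?_ ?_ (.refl _))
    · simp [Instr.touched]; omega
    · rw [Instr.exec]
      congr 1
      funext a
      simp only [Function.update_apply, shifted]
      split_ifs with h <;> simp_all [add_mul, add_assoc]
    · intro a
      rw [shifted]
      split_ifs
      · rw [add_mul, one_mul]; omega
      · exact hW a

theorem steps_move {P : List Instr} {S W F : ℕ} {inp : ℕ → ℕ} (hF : 31 < F) (hW : ∀ a, inp a ≤ W) {p : ℕ} :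
    ∀ j ≤ 29, F + j < S → F + j ≤ W →
    CodeAt P p ((List.range j).flatMap fun j => [.add 1 1 2, .store 1 (j + 3)]) →
    Steps P S W ⟨p, moved F inp 0⟩ (2 * j) ⟨p + 2 * j, moved F inp j⟩
  | 0, _, _, _, _ => .refl _
  | j + 1, hj, hS, hFW, hP => by
    rw [List.range_succ, List.flatMap_append] at hP
    obtain ⟨hP1, hP2⟩ := hP.append
    have hl : ((List.range j).flatMap fun j => [Instr.add 1 1 2, .store 1 (j + 3)]).length = 2 * j := by
      simp [List.length_flatMap, mul_comm]
    rw [hl] at hP2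
    obtain ⟨g1, hP2⟩ := hP2.cons
    obtain ⟨g2, -⟩ := hP2.cons
    refine (steps_move hF hW j (by omega) (by omega) (by omega) hP1).trans (.next g1 ?_ rfl ?_
      (.next g2 ?_ ?_ ?_ (.refl _)))
    · simp [Instr.touched]; omega
    · intro a
      simp only [Function.update_apply, moved]
      split_ifs <;> first | omega | exact hW _
    · simp [Instr.touched, moved]; omega
    · rw [Instr.exec]
      congr 1
      funext a
      simp only [Function.update_apply, moved, if_true]
      have e : F + j + 1 - F + 2 = j + 3 := by omega
      split_ifs <;> first | omega | rfl | (subst_vars; simp_all; try omega)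
    · intro a
      simp only [moved]
      split_ifs <;> first | omega | exact hW _

/-- Registers after the prologue. -/
def prepared (F n : ℕ) (inp : ℕ → ℕ) : ℕ → ℕ :=
  Function.update (Function.update (moved F inp 29) 2 n) 3 (F + 29)

theorem length_prologue : prologue.length = 95 := by decide

/-- Registers 2 to 31 are to hold the variables but contain `w` and the first 29 symbols. These are
copied to the registers from `k + 32n` on, an address obtained by adding `n` to register 1
repeatedly. Once `w` is saved, register 2 supplies the increment 1. At the end variable 0 is `n`,
and variable 1 is `k + 32n + 29`, from which `k` can be recovered. -/
theorem steps_prologue {P : List Instr} {S W k n : ℕ} {inp : ℕ → ℕ} (hS : k + 32 * n + 29 < S)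
    (hFW : k + 32 * n + 29 ≤ W) (hn : 1 ≤ n) (hW : ∀ a, inp a ≤ W) (h0 : inp 0 = n) (h1 : inp 1 = k)
    (hP : CodeAt P 0 prologue) : Steps P S W ⟨0, inp⟩ 95 ⟨95, prepared (k + 32 * n) n inp⟩ := by
  obtain ⟨hP1, hP⟩ := hP.append
  obtain ⟨hP2, hP⟩ := hP.append
  obtain ⟨hP3, hP⟩ := hP.append
  obtain ⟨g1, hP2⟩ := hP2.cons
  obtain ⟨g2, -⟩ := hP2.cons
  obtain ⟨g3, hP⟩ := hP.cons
  obtain ⟨g4, hP⟩ := hP.cons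
  obtain ⟨g5, -⟩ := hP.cons
  rw [List.length_replicate] at hP3 g1 g2 g3 g4 g5
  have hl : ((List.range 29).flatMap fun j => [Instr.add 1 1 2, .store 1 (j + 3)]).length = 58 := by decide
  rw [hl] at g3 g4 g5
  have hm : ∀ j ≤ 29, ∀ a, moved (k + 32 * n) inp j a ≤ W := by
    intro j hj a
    simp only [moved]
    split_ifs <;> first | omega | exact hW _
  have e1 : Function.update (Function.update (shifted k n inp 32) (k + 32 * n) (inp 2)) 2 1 =
      moved (k + 32 * n) inp 0 := by
    funext a
    simp only [Function.update_apply, moved, shifted]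
    split_ifs <;> first | omega | rfl | (congr 1; omega)
  have e2 : Function.update (Function.update (Function.update (moved (k + 32 * n) inp 29) 3 0) 2 n) 3
      (k + 32 * n + 29) = prepared (k + 32 * n) n inp := by
    rw [prepared, Function.update_comm (by omega), Function.update_idem, Function.update_comm (by omega)]
  have s1 : Steps P S W ⟨0, inp⟩ 32 ⟨32, shifted k n inp 32⟩ := by
    simpa using steps_shift (by omega) h0 hW h1 32 (by omega) hP1
  have s2 : Steps P S W ⟨32, shifted k n inp 32⟩ 2 ⟨34, moved (k + 32 * n) inp 0⟩ := by
    refine .next (reg' := Function.update (shifted k n inp 32) (k + 32 * n) (inp 2)) g1 ?_ ?_ ?_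
      (.next g2 ?_ ?_ (hm 0 (by omega)) (.refl _))
    · simp [Instr.touched, shifted]; omega
    · simp [Instr.exec, shifted]
    · intro a
      simp only [Function.update_apply, shifted]
      split_ifs <;> first | omega | exact hW _
    · simp [Instr.touched]; omega
    · rw [Instr.exec, e1]
  have s3 : Steps P S W ⟨34, moved (k + 32 * n) inp 0⟩ 58 ⟨92, moved (k + 32 * n) inp 29⟩ :=
    steps_move (by omega) hW 29 le_rfl (by omega) (by omega) hP3
  have b3 : ∀ a, Function.update (moved (k + 32 * n) inp 29) 3 0 a ≤ W := by
    intro a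
    rw [Function.update_apply]
    split_ifs
    · omega
    · exact hm _ le_rfl a
  have b4 : ∀ a, Function.update (Function.update (moved (k + 32 * n) inp 29) 3 0) 2 n a ≤ W := by
    intro a
    rw [Function.update_apply]
    split_ifs
    · omega
    · exact b3 a
  have b5 : ∀ a, prepared (k + 32 * n) n inp a ≤ W := by
    intro a
    rw [← e2, Function.update_apply]
    split_ifs
    · omega
    · exact b4 a
  have s4 : Steps P S W ⟨92, moved (k + 32 * n) inp 29⟩ 3 ⟨95, prepared (k + 32 * n) n inp⟩ := by
    refine .next g3 ?_ rfl b3 (.next g4 ?_ ?_ b4 (.next g5 ?_ ?_ b5 (.refl _)))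
    · simp [Instr.touched]; omega
    · simp [Instr.touched]; omega
    · have e3 : moved (k + 32 * n) inp 29 0 = n := by
        rw [moved, if_neg (by omega), if_neg (by omega), if_neg (by omega), h0]
      simp [Instr.exec, e3]
    · simp [Instr.touched]; omega
    · rw [Instr.exec, ← e2]
      simp [moved]
  exact s1.trans (s2.trans (s3.trans s4))

theorem wf_rankCmd : rankCmd.wf = true := by decide

/-- Since `w < k n`, the `(n + 1)(w + 1)` table entries fit into `O(n²k)` cells, well within the
space allowed, and the two counting runs dominate the time with `O(n³k²)` steps. The word bounds
stay as hypotheses here. -/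
theorem rankProgram_computes {n k w W S : ℕ} {s : List ℕ} (hS : 40 + 100 * (n ^ 3 * k) ≤ S)
    (hW : 40 + 100 * (n ^ 3 * k) ≤ W) (hsum : n * (n * (k * k ^ n)) ≤ W) (hpow : (k + 1) ^ n ≤ W)
    (hn : 2 ≤ n) (hk : 2 ≤ k) (hw : w < k * n) (hs : s ∈ strings k n w) :
    ∃ r, HasRank (granddaddy k n w) s r ∧
      Computes rankProgram (input k n w s) r (2000 * (n ^ 3 * k ^ 2)) S W := by
  have hsl := (mem_strings.1 hs).1
  have x1 : 4 * (n * k) ≤ n ^ 3 * k := by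
    have : n ^ 3 * k = (n * n) * (n * k) := by ring
    rw [this]
    gcongr
    nlinarith
  have x2 : 2 * n ≤ n * k := by rw [mul_comm]; gcongr
  have x3 : 2 * k ≤ n * k := by gcongr
  have x4 : 2 * (n * (n * k)) ≤ n ^ 3 * k := by
    have : n ^ 3 * k = n * (n * (n * k)) := by ring
    rw [this]
    gcongr
  have hb : ParamBounds n k w (k ^ n) W (100 * (n ^ 3 * k)) := by
    refine ⟨?_, ?_, ?_, by omega, hsum, hpow⟩
    · have : (n + 1) * (w + 1) ≤ (n + 1) * (n * k) := by gcongr; rw [mul_comm n]; omega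
      rw [add_mul n 1 (n * k), one_mul] at this
      omega
    · omega
    · rw [add_mul, mul_add, one_mul, mul_one]
      omega
  have hinp0 : input k n w s 0 = n := rfl
  have hinp1 : input k n w s 1 = k := rfl
  have hinp2 : input k n w s 2 = w := rfl
  have hinp3 : ∀ e, input k n w s (e + 3) = s.getD e 0 := fun e => rfl
  have hinp : ∀ a, input k n w s a ≤ W := by
    intro a
    match a with
    | 0 => rw [hinp0]; omega
    | 1 => rw [hinp1]; omega
    | 2 => rw [hinp2]; rw [mul_comm] at hw; omega
    | e + 3 =>
      rw [hinp3]
      by_cases he : e < s.length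
      · have := ((mem_strings.1 hs).2.1 _ (getD_mem he)).2
        omega
      · rw [List.getD_eq_default _ _ (by omega)]
        omega
  obtain ⟨hP1, hP2⟩ := CodeAt.append (P := rankProgram) (p := 0) (l₁ := prologue)
    (l₂ := rankCmd.code 95 ++ [.const 1 0, .add 0 7 1]) ⟨[], [], by simp [rankProgram], rfl⟩
  rw [length_prologue, zero_add] at hP2
  obtain ⟨hP2, hP3⟩ := hP2.append
  rw [Cmd.length_code] at hP3
  obtain ⟨g1, hP3⟩ := hP3.cons
  obtain ⟨g2, -⟩ := hP3.cons
  have s1 := steps_prologue (S := S) (by omega) (by omega) (by omega) hinp hinp0 hinp1 hP1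
  set R := prepared (k + 32 * n) n (input k n w s) with hR
  have hRep : Rep W ⟨fun i => R (i + 2), fun a => R (32 + a)⟩ R := by
    refine ⟨fun _ _ => rfl, fun _ => rfl, fun a => ?_⟩
    simp only [hR, prepared, moved, Function.update_apply]
    split_ifs <;> first | omega | exact hinp _
  obtain ⟨t, σ, ht, hex, hrank⟩ := rankCmd_spec (σ := ⟨fun i => R (i + 2), fun a => R (32 + a)⟩) hb hn hk hw hs
    (by simp [hR, prepared]) (by simp [hR, prepared])
    (by
      simp only [hR, prepared, moved, Function.update_apply]
      rw [if_neg (by omega), if_neg (by omega), if_neg (by omega), if_neg (by omega), if_pos (by omega)]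
      exact congrArg (input k n w s) (by omega : _ = 2))
    (fun e he hen => by
      simp only [hR, prepared, moved, Function.update_apply]
      rw [if_neg (by omega), if_neg (by omega), if_neg (by omega), if_neg (by omega), if_neg (by omega)]
      exact congrArg (input k n w s) (by omega : _ = e + 3))
    (fun e he hen => by
      simp only [hR, prepared, moved, Function.update_apply]
      rw [if_neg (by omega), if_neg (by omega), if_neg (by omega), if_neg (by omega), if_pos (by omega)]
      exact congrArg (input k n w s) (by omega : _ = e + 3))
  obtain ⟨R', s2, hRep'⟩ := hex.sim (S := S) hS hW wf_rankCmd hP2 hRep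
  have hr1 := hRep'.scratch (d := 1) (x := 0) (by omega) (by omega)
  have hr2 := hr1.scratch (d := 0) (x := σ.v 5) (by omega) (by rw [← hRep'.var 5 (by omega)]; exact hRep'.le _)
  have s3 : Steps rankProgram S W ⟨95 + rankCmd.size, R'⟩ 2 ⟨95 + rankCmd.size + 1 + 1,
      Function.update (Function.update R' 1 0) 0 (σ.v 5)⟩ := by
    refine .next g1 ?_ rfl hr1.le (.next g2 ?_ ?_ hr2.le (.refl _))
    · simp [Instr.touched]; omega
    · simp [Instr.touched]; omega
    · rw [Instr.exec, ← hRep'.var 5 (by omega)]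
      simp
  obtain ⟨i1, i2, i3⟩ := (s1.trans (s2.trans s3)).iterate hinp
  refine ⟨σ.v 5, hrank, 95 + (t + 2), ?_, ?_, ?_, i2, i3⟩
  · have y1 : 2 * (n ^ 3 * k) ≤ n ^ 3 * k ^ 2 := by
      calc 2 * (n ^ 3 * k) ≤ k * (n ^ 3 * k) := Nat.mul_le_mul_right _ hk
        _ = n ^ 3 * k ^ 2 := by ring
    have y2 : n * ((w + 1) * (n * (30 * k + 60) + 80)) ≤ n * ((n * k) * (n * (30 * k + 60) + 80)) := by
      gcongr
      rw [mul_comm n]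
      omega
    have y3 : n * ((n * k) * (n * (30 * k + 60) + 80)) =
        30 * (n ^ 3 * k ^ 2) + 60 * (n ^ 3 * k) + 80 * (n * (n * k)) := by ring
    have y4 : n ^ 2 ≤ n * (n * k) := by
      rw [sq]
      gcongr
      exact Nat.le_mul_of_pos_right _ (by omega)
    omega
  · rw [run, i1, halted]
    refine List.getElem?_eq_none ?_
    simp [rankProgram, length_prologue, Cmd.length_code]
    omega
  · rw [run, i1]
    simp

theorem exists_program : ∃ (P : List Instr) (C : ℕ), ∀ n k w : ℕ, 2 ≤ n → 2 ≤ k → w < k * n →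
    ∀ s ∈ strings k n w, ∃ r : ℕ, HasRank (granddaddy k n w) s r ∧
      Computes P (input k n w s) r (C * (n ^ 3 * k ^ 2)) (C * (n ^ 3 * k)) (k ^ (C * n)) := by
  refine ⟨rankProgram, 2000, fun n k w hn hk hw s hs => ?_⟩
  have e0 : 1 ≤ n ^ 3 * k := Nat.mul_pos (Nat.pow_pos (by omega)) (by omega)
  have e1 : n ≤ k ^ n := (Nat.lt_two_pow_self (n := n)).le.trans (Nat.pow_le_pow_left hk n)
  have e2 : k ≤ k ^ n := Nat.le_self_pow (by omega) k
  have e3 : 140 ≤ k ^ (8 * n) := by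
    calc 140 ≤ 2 ^ 8 := by norm_num
      _ ≤ k ^ 8 := Nat.pow_le_pow_left hk 8
      _ ≤ k ^ (8 * n) := Nat.pow_le_pow_right (by omega) (by omega)
  have e4 : ∀ c ≤ 2000, k ^ (c * n) ≤ k ^ (2000 * n) := fun c hc =>
    Nat.pow_le_pow_right (by omega) (Nat.mul_le_mul_right n hc)
  refine rankProgram_computes (by omega) ?_ ?_ ?_ hn hk hw hs
  -- All polynomial factors are absorbed through `n ≤ k^n`, `k ≤ k^n` and `140 ≤ 2^8`, which use `k
  -- ≥ 2`.
  · calc 40 + 100 * (n ^ 3 * k) ≤ 140 * (n ^ 3 * k) := by omega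
      _ ≤ k ^ (8 * n) * ((k ^ n) ^ 3 * k ^ n) := by gcongr
      _ = k ^ (12 * n) := by ring
      _ ≤ k ^ (2000 * n) := e4 12 (by omega)
  · calc n * (n * (k * k ^ n)) ≤ k ^ n * (k ^ n * (k ^ n * k ^ n)) := by gcongr
      _ = k ^ (4 * n) := by ring
      _ ≤ k ^ (2000 * n) := e4 4 (by omega)
  · calc (k + 1) ^ n ≤ (k ^ 2) ^ n := Nat.pow_le_pow_left (by nlinarith) n
      _ = k ^ (2 * n) := by rw [← pow_mul]
      _ ≤ k ^ (2000 * n) := e4 2 (by omega)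

end BoundedWeight

theorem mainTheorem1 :
    (∀ n k w : ℕ, 2 ≤ n → 2 ≤ k → w < k * n →
      -- the sequence is the lexicographically smallest universal cycle
      BoundedWeight.IsUniversalCycle (BoundedWeight.strings k n w)
        (BoundedWeight.granddaddy k n w) ∧
      (∀ U : List ℕ, BoundedWeight.IsUniversalCycle (BoundedWeight.strings k n w) U →
        BoundedWeight.granddaddy k n w ≤ U) ∧
      ∀ s ∈ BoundedWeight.strings k n w,
        -- the rank of a string in the wraparound
        (∀ j, BoundedWeight.IsWraparound k n w s j →
          ∀ r : ℕ, BoundedWeight.HasRank (BoundedWeight.granddaddy k n w) s r ↔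
            (r : ℤ) = ((BoundedWeight.strings k n w).card : ℤ) - ((n : ℤ) - (j : ℤ)) + 1) ∧
        -- the rank of any other string
        ((¬ ∃ j, BoundedWeight.IsWraparound k n w s j) →
          (∃! β : List ℕ × List ℕ, BoundedWeight.IsGranddaddyPair k n s β.1 β.2) ∧
          ∀ β₁ β₂ : List ℕ, BoundedWeight.IsGranddaddyPair k n s β₁ β₂ →
            ∀ r : ℕ, BoundedWeight.HasRank (BoundedWeight.granddaddy k n w) s r ↔
              (r : ℤ) = (BoundedWeight.smallerCount k n w β₂ : ℤ) -
                ((BoundedWeight.pPart s).length : ℤ) + 1)) ∧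
    -- one program computes all ranks within the time and space bounds
    (∃ (P : List BoundedWeight.Instr) (C : ℕ), ∀ n k w : ℕ, 2 ≤ n → 2 ≤ k → w < k * n →
      ∀ s ∈ BoundedWeight.strings k n w,
        ∃ r : ℕ, BoundedWeight.HasRank (BoundedWeight.granddaddy k n w) s r ∧
          BoundedWeight.Computes P (BoundedWeight.input k n w s) r
            (C * (n ^ 3 * k ^ 2)) (C * (n ^ 3 * k)) (k ^ (C * n))) := by
  refine ⟨fun n k w hn hk hw => ?_, BoundedWeight.exists_program⟩
  have hU := BoundedWeight.isUniversalCycle_granddaddy (by omega) hk hw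
  refine ⟨hU, fun U hU' => ?_, fun s hs => ⟨fun j hj r => ?_, fun h => ⟨BoundedWeight.existsUnique_isGranddaddyPair hk hs, ?_⟩⟩⟩
  · obtain ⟨m, rfl⟩ : ∃ m, n = m + 1 := ⟨n - 1, by omega⟩
    exact BoundedWeight.granddaddy_le hk hw hU'
  · have hr := BoundedWeight.hasRank_of_isWraparound (by omega) hk hw hj
    -- There are more than `n` strings, so the truncated subtraction in the rank agrees with the
    -- integer one.
    have hc := BoundedWeight.le_card_strings (by omega) hk hw
    have hjn := hj.1
    rw [hU.hasRank_iff hs hr]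
    omega
  · intro β₁ β₂ hβ r
    -- Here `hle` says that `|p|` is at most `lowCount`, which makes the natural subtraction exact.
    obtain ⟨hle, hr⟩ := BoundedWeight.rank_of_not_isWraparound (by omega) hk hw hs h
    rw [hU.hasRank_iff hs hr, hβ.smallerCount_eq hk hs, BoundedWeight.length_pPart]
    omega
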